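/- Let $k$ be an algebraically closed field of characteristic zero. Varieties (not necessarily irreducible) are reduced separated schemes of finite type over $k$; points are $k$-points. Let $G$ be an algebraic group over $k$, $H$ a finite abelian subgroup of $G$ of rank $r$ (the minimal number of generators of $H$), and $H^* = \operatorname{Hom}(H, k^\times)$, viewed as a $\mathbb{Z}$-module. A $G$-variety $X$ is generically free if $\operatorname{Stab}(x) = \{1\}$ for all points $x$ of a dense open subset of $X$. If $X$ is a $G$-variety of dimension $\dim G + r$ and $x$ is a smooth $H$-fixed point of $X$ with finite stabilizer $\operatorname{Stab}(x) \subset G$, then the representation of $H$ on $T_x(X)/T_x(Gx)$ is a direct sum of $r$ characters $\chi_1, \dots, \chi_r \in H^*$, and one sets $$ i(X, x, H) = \chi_1 \wedge \dots \wedge \chi_r \in \textstyle\bigwedge^r_{\mathbb{Z}}(H^*), $$ which is well-defined up to sign, i.e. as an element of $\bigwedge^r(H^*)/\{\pm 1\}$. Theorem. Let $X$ and $Y$ be irreducible generically free $G$-varieties of dimension $\dim G + r$, and let $f \colon X \to Y$ be a $G$-equivariant birational morphism. Let $x$ be a smooth $H$-fixed point of $X$ such that $y = f(x)$ is a smooth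 point of $Y$ and $\operatorname{Stab}(y)$ is finite. Then the representations of $H$ on $T_x(X)/T_x(Gx)$ and on $T_y(Y)/T_y(Gy)$ are direct sums of $r$ characters, so that both invariants are defined, and $i(X, x, H) = i(Y, y, H)$ in $\bigwedge^r(H^*)/\{\pm 1\}$. -/

import Mathlib

open CategoryTheory AlgebraicGeometry MonoidalCategory CartesianMonoidalCategory
open scoped MonObj

universe u

noncomputable section

namespace GVariety

/-! ### Varieties, points and group actions over a field `K` -/

section Varieties

variable {K : Type u} [Field K]

/-- A variety over `K` (not necessarily irreducible): a reduced separated scheme of finite type. -/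
class IsVariety (X : Over (Spec (.of K))) : Prop where
  isReduced : IsReduced X.left
  isSeparated : IsSeparated X.hom
  locallyOfFiniteType : LocallyOfFiniteType X.hom
  quasiCompact : QuasiCompact X.hom

/-- The `K`-points of `X`. For a group object `G` these form a group (pointwise operations), and
if `G` acts on `X` they act on the `K`-points of `X`. -/
abbrev Point (X : Over (Spec (.of K))) : Type u := 𝟙_ (Over (Spec (.of K))) ⟶ X

/-- The point of the underlying topological space given by a `K`-point. -/
def pt {X : Over (Spec (.of K))} (x : Point X) : X.left :=
  x.left (IsLocalRing.closedPoint K)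

/-- `f` is birational: it restricts to an isomorphism from a dense open subscheme of `X` onto a
dense open subscheme of `Y`. -/
def IsBirational {X Y : Over (Spec (.of K))} (f : X ⟶ Y) : Prop :=
  ∃ e : X.left.PartialIso Y.left, e.iso.hom ≫ e.target.ι = e.source.ι ≫ f.left

/-- The local ring `O_{X,x}` at a `K`-point. -/
def LocalRing {X : Over (Spec (.of K))} (x : Point X) : Type u :=
  X.left.presheaf.stalk (pt x)

variable {X Y Z : Over (Spec (.of K))}

instance (x : Point X) : CommRing (LocalRing x) :=
  inferInstanceAs (CommRing (X.left.presheaf.stalk (pt x)))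

instance (x : Point X) : IsLocalRing (LocalRing x) :=
  inferInstanceAs (IsLocalRing (X.left.presheaf.stalk (pt x)))

/-- The germ at `x` of a regular function on an open neighbourhood `U` of `x`. -/
def germ (x : Point X) (U : X.left.Opens) (hx : pt x ∈ U) : Γ(X.left, U) →+* LocalRing x :=
  (X.left.presheaf.germ U (pt x) hx).hom

/-- Constants as global regular functions. -/
def const (X : Over (Spec (.of K))) : K →+* Γ(X.left, ⊤) :=
  ((Scheme.ΓSpecIso (.of K)).inv ≫ X.hom.appTop).hom

instance (x : Point X) : Algebra K (LocalRing x) :=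
  ((germ x ⊤ (TopologicalSpace.Opens.mem_top _)).comp (const X)).toAlgebra

/-- `x` is a smooth point: its local ring is regular (`K` will be algebraically closed). -/
def IsSmoothPoint (x : Point X) : Prop := IsRegularLocalRing (LocalRing x)

/-! ### Tangent spaces -/

lemma pt_comp {x : Point X} {y : Point Y} {φ : X ⟶ Y} (h : x ≫ φ = y) :
    φ.left (pt x) = pt y := by
  subst h
  exact (Scheme.Hom.comp_apply x.left φ.left _).symm

/-- The ring homomorphism `O_{Y,y} → O_{X,x}` underlying `pullback`. -/
def pullbackHom {x : Point X} {y : Point Y} (φ : X ⟶ Y) (h : x ≫ φ = y) :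
    LocalRing y →+* LocalRing x :=
  (Y.left.presheaf.stalkSpecializes (specializes_of_eq (pt_comp h)) ≫ φ.left.stalkMap (pt x)).hom

lemma mem_preimage {x : Point X} {y : Point Y} {φ : X ⟶ Y} (h : x ≫ φ = y)
    {U : Y.left.Opens} (hy : pt y ∈ U) : pt x ∈ φ.left ⁻¹ᵁ U := by
  change φ.left (pt x) ∈ U
  rwa [pt_comp h]

lemma pullbackHom_germ {x : Point X} {y : Point Y} (φ : X ⟶ Y) (h : x ≫ φ = y)
    (U : Y.left.Opens) (hy : pt y ∈ U) (s : Γ(Y.left, U)) :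
    pullbackHom φ h (germ y U hy s) =
      germ x (φ.left ⁻¹ᵁ U) (mem_preimage h hy) (φ.left.app U s) := by
  have h1 : Y.left.presheaf.germ U (pt y) hy ≫
      Y.left.presheaf.stalkSpecializes (specializes_of_eq (pt_comp h)) ≫
        φ.left.stalkMap (pt x) =
      φ.left.app U ≫ X.left.presheaf.germ (φ.left ⁻¹ᵁ U) (pt x) (mem_preimage h hy) := by
    rw [TopCat.Presheaf.germ_stalkSpecializes_assoc, Scheme.Hom.germ_stalkMap]
  exact congr($(h1).hom s)

lemma exists_germ {x : Point X} (a : LocalRing x) :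
    ∃ (U : X.left.Opens) (hx : pt x ∈ U) (s : Γ(X.left, U)), germ x U hx s = a :=
  X.left.presheaf.exists_germ_eq a

lemma app_const (φ : X ⟶ Y) (c : K) : φ.left.appTop (const Y c) = const X c := by
  have h1 : (Scheme.ΓSpecIso (.of K)).inv ≫ Y.hom.appTop ≫ φ.left.appTop =
      (Scheme.ΓSpecIso (.of K)).inv ≫ X.hom.appTop := by
    rw [← Scheme.Hom.comp_appTop, Over.w]
  exact congr($(h1).hom c)

/-- Pullback of germs `O_{Y,y} → O_{X,x}` along a morphism `φ` with `φ(x) = y`. -/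
def pullback {x : Point X} {y : Point Y} (φ : X ⟶ Y) (h : x ≫ φ = y) :
    LocalRing y →ₐ[K] LocalRing x :=
  { pullbackHom φ h with
    commutes' := fun c => by
      change pullbackHom φ h (germ y ⊤ (TopologicalSpace.Opens.mem_top _) (const Y c)) = germ x ⊤ (TopologicalSpace.Opens.mem_top _) (const X c)
      rw [pullbackHom_germ, ← app_const φ]
      rfl }

lemma pullback_germ {x : Point X} {y : Point Y} (φ : X ⟶ Y) (h : x ≫ φ = y)
    (U : Y.left.Opens) (hy : pt y ∈ U) (s : Γ(Y.left, U)) :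
    pullback φ h (germ y U hy s) =
      germ x (φ.left ⁻¹ᵁ U) (mem_preimage h hy) (φ.left.app U s) :=
  pullbackHom_germ φ h U hy s

lemma pullback_id (x : Point X) (h : x ≫ 𝟙 X = x) : pullback (𝟙 X) h = AlgHom.id K _ := by
  ext a
  obtain ⟨U, hx, s, rfl⟩ := exists_germ a
  rw [pullback_germ]
  change germ x U hx ((𝟙 X.left : X.left ⟶ X.left).app U s) = _
  rw [Scheme.Hom.id_app]
  rfl

lemma pullback_comp {x : Point X} {y : Point Y} {z : Point Z} (φ : X ⟶ Y) (ψ : Y ⟶ Z)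
    (h : x ≫ φ = y) (h' : y ≫ ψ = z) (h'' : x ≫ φ ≫ ψ = z) :
    pullback (φ ≫ ψ) h'' = (pullback φ h).comp (pullback ψ h') := by
  ext a
  obtain ⟨U, hx, s, rfl⟩ := exists_germ a
  rw [AlgHom.comp_apply, pullback_germ, pullback_germ, pullback_germ]
  change germ x _ _ ((φ.left ≫ ψ.left).app U s) = _
  rw [Scheme.Hom.comp_app]
  rfl

instance {x : Point X} {y : Point Y} (φ : X ⟶ Y) (h : x ≫ φ = y) :
    IsLocalHom (pullbackHom φ h) := by
  have h1 : IsIso (Y.left.presheaf.stalkSpecializes (specializes_of_eq (pt_comp h))) :=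
    (Y.left.presheaf.stalkCongr (.of_eq (pt_comp h).symm)).isIso_hom
  exact RingHom.isLocalHom_comp (φ.left.stalkMap (pt x)).hom
    (Y.left.presheaf.stalkSpecializes (specializes_of_eq (pt_comp h))).hom

/-- The maximal ideal `m_x` of `O_{X,x}`. -/
abbrev maxIdeal (x : Point X) : Ideal (LocalRing x) := IsLocalRing.maximalIdeal (LocalRing x)

lemma maxIdeal_le {x : Point X} {y : Point Y} (φ : X ⟶ Y) (h : x ≫ φ = y) :
    maxIdeal y ≤ (maxIdeal x).comap (pullback φ h) :=
  fun a ha => (IsLocalRing.mem_maximalIdeal _).mpr fun hu =>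
    (IsLocalRing.mem_maximalIdeal a).mp ha (isUnit_of_map_unit (pullbackHom φ h) a hu)

/-- The Zariski tangent space `T_x(X)`: the `K`-linear dual of `m_x / m_x²`. -/
abbrev TangentSpaceAt (x : Point X) : Type u := Module.Dual K (maxIdeal x).Cotangent

/-- The differential `T_x(X) → T_y(Y)` of a morphism `φ` with `φ(x) = y`. -/
def differential {x : Point X} {y : Point Y} (φ : X ⟶ Y) (h : x ≫ φ = y) :
    TangentSpaceAt x →ₗ[K] TangentSpaceAt y :=
  (Ideal.mapCotangent (maxIdeal y) (maxIdeal x) (pullback φ h) (maxIdeal_le φ h)).dualMap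

lemma differential_apply {x : Point X} {y : Point Y} (φ : X ⟶ Y) (h : x ≫ φ = y)
    (t : TangentSpaceAt x) (m : maxIdeal y) :
    differential φ h t ((maxIdeal y).toCotangent m) =
      t ((maxIdeal x).toCotangent ⟨pullback φ h m, maxIdeal_le φ h m.2⟩) := rfl

lemma differential_id (x : Point X) (φ : X ⟶ X) (hφ : φ = 𝟙 X) (h : x ≫ φ = x) :
    differential φ h = LinearMap.id := by
  subst hφ
  refine LinearMap.ext fun t => LinearMap.ext fun m => ?_
  obtain ⟨m, rfl⟩ := (maxIdeal x).toCotangent_surjective m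
  rw [differential_apply, LinearMap.id_apply]
  congr 2
  exact Subtype.ext (DFunLike.congr_fun (pullback_id x h) (m : LocalRing x))

lemma differential_comp {x : Point X} {y : Point Y} {z : Point Z} (φ : X ⟶ Y) (ψ : Y ⟶ Z)
    (ω : X ⟶ Z) (hω : ω = φ ≫ ψ) (h : x ≫ φ = y) (h' : y ≫ ψ = z) (h'' : x ≫ ω = z) :
    differential ω h'' = differential ψ h' ∘ₗ differential φ h := by
  subst hω
  refine LinearMap.ext fun t => LinearMap.ext fun m => ?_
  obtain ⟨m, rfl⟩ := (maxIdeal z).toCotangent_surjective m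
  rw [LinearMap.comp_apply, differential_apply, differential_apply, differential_apply]
  congr 2
  exact Subtype.ext (DFunLike.congr_fun (pullback_comp φ ψ h h' h'') (m : LocalRing z))

/-- The germ `a ∈ O_{X,x}` vanishes on the set `S` near `x`: it is represented by a regular
function on a neighbourhood of `x` which is zero at every point of `S` in that neighbourhood. -/
def VanishesOn (S : Set X.left) {x : Point X} (a : LocalRing x) : Prop :=
  ∃ (U : X.left.Opens) (hx : pt x ∈ U) (s : Γ(X.left, U)),
    germ x U hx s = a ∧ ∀ z ∈ S, z ∉ X.left.basicOpen s

/-- For a locally closed `S ⊆ X` through `x`, with its reduced structure, the tangent space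
`T_x(S)` as a subspace of `T_x(X)`: it is cut out by the differentials at `x` of the functions
vanishing on `S` near `x`. (It suffices that `S` contains the closed points of a locally closed
set.) -/
def tangentSubspace (S : Set X.left) (x : Point X) : Submodule K (TangentSpaceAt x) where
  carrier := {t | ∀ m : maxIdeal x, VanishesOn S (m : LocalRing x) →
    t ((maxIdeal x).toCotangent m) = 0}
  add_mem' := fun {t t'} ht ht' m hm => by
    rw [LinearMap.add_apply, ht m hm, ht' m hm, add_zero]
  zero_mem' := fun _ _ => rfl
  smul_mem' := fun c t ht m hm => by rw [LinearMap.smul_apply, ht m hm, smul_zero]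

lemma differential_mem {x : Point X} {y : Point Y} (φ : X ⟶ Y) (h : x ≫ φ = y)
    {S : Set X.left} {T : Set Y.left} (hST : Set.MapsTo φ.left S T) {t : TangentSpaceAt x}
    (ht : t ∈ tangentSubspace S x) : differential φ h t ∈ tangentSubspace T y := by
  intro m hm
  rw [differential_apply]
  apply ht
  obtain ⟨U, hy, s, hs, hz⟩ := hm
  refine ⟨φ.left ⁻¹ᵁ U, mem_preimage h hy, φ.left.app U s, ?_, fun z hzS hz' => ?_⟩
  · rw [← pullback_germ φ h U hy s, hs]
  · rw [← Scheme.preimage_basicOpen] at hz'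
    exact hz _ (hST hzS) hz'

end Varieties

/-! ### The representation of a stabilizer on the normal space to an orbit -/

section Actions

variable {K : Type u} [Field K] {G : Over (Spec (.of K))} [GrpObj G]
  {X Y : Over (Spec (.of K))} [ModObj G X] [ModObj G Y]

/-- The automorphism `z ↦ g z` of `X` given by `g ∈ G(K)`. -/
def translation (X : Over (Spec (.of K))) [ModObj G X] (g : Point G) : X ⟶ X :=
  lift (toUnit X ≫ g) (𝟙 X) ≫ γ[G, X]

lemma comp_translation (x : Point X) (g : Point G) : x ≫ translation X g = g • x := by
  rw [translation, comp_lift_assoc, Hom.smul_def]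
  congr 2
  · rw [← Category.assoc, Subsingleton.elim (x ≫ toUnit X) (𝟙 _), Category.id_comp]

lemma translation_one : translation X (1 : Point G) = 𝟙 X := by
  have h : translation X (1 : Point G) = (toUnit X ≫ (1 : Point G)) • (𝟙 X) := rfl
  rw [h, MonObj.comp_one, one_smul]

lemma translation_mul (g h : Point G) :
    translation X (g * h) = translation X h ≫ translation X g := by
  have e (g : Point G) : translation X g = (toUnit X ≫ g) • (𝟙 X) := rfl
  have e' : translation X h ≫ translation X g = (toUnit X ≫ g) • translation X h := by
    rw [e g, ModObj.comp_smul, Category.comp_id, ← Category.assoc,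
      Subsingleton.elim (translation X h ≫ toUnit X) (toUnit X)]
  rw [e', e, e, MonObj.comp_mul, mul_smul]

/-- The closed points of the orbit `G x`. -/
def orbitPoints (G : Over (Spec (.of K))) [GrpObj G] {X : Over (Spec (.of K))} [ModObj G X]
    (x : Point X) : Set X.left :=
  pt '' MulAction.orbit (Point G) x

/-- The tangent space `T_x(Gx)` of the orbit, inside `T_x(X)`. -/
def orbitTangentSpace (G : Over (Spec (.of K))) [GrpObj G] {X : Over (Spec (.of K))} [ModObj G X]
    (x : Point X) : Submodule K (TangentSpaceAt x) :=
  tangentSubspace (orbitPoints G x) x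

/-- The representation of `Stab(x)` on `T_x(X)` by differentials. -/
def tangentRep (G : Over (Spec (.of K))) [GrpObj G] {X : Over (Spec (.of K))} [ModObj G X]
    (x : Point X) : Representation K (MulAction.stabilizer (Point G) x) (TangentSpaceAt x) where
  toFun g := differential (translation X g.1) ((comp_translation x g.1).trans g.2)
  map_one' := differential_id x _ translation_one _
  map_mul' g h := differential_comp _ _ _ (translation_mul g.1 h.1) _ _ _

lemma tangentRep_mem (x : Point X) (g : MulAction.stabilizer (Point G) x) :
    orbitTangentSpace G x ≤ (orbitTangentSpace G x).comap (tangentRep G x g) := by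
  intro t ht
  refine differential_mem (translation X g.1) _ ?_ ht
  rintro _ ⟨z, ⟨g', rfl⟩, rfl⟩
  refine ⟨g.1 • g' • x, ⟨g.1 * g', mul_smul _ _ _⟩, ?_⟩
  exact (pt_comp (comp_translation _ _)).symm

/-- The normal space `T_x(X) / T_x(Gx)` to the orbit. -/
abbrev NormalSpace (G : Over (Spec (.of K))) [GrpObj G] {X : Over (Spec (.of K))} [ModObj G X]
    (x : Point X) : Type u :=
  TangentSpaceAt x ⧸ orbitTangentSpace G x

/-- The representation of a subgroup `H ⊆ Stab(x)` on `T_x(X) / T_x(Gx)`. -/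
def normalRep {X : Over (Spec (.of K))} [ModObj G X] (x : Point X) (H : Subgroup (Point G))
    (hH : H ≤ MulAction.stabilizer (Point G) x) : Representation K H (NormalSpace G x) :=
  ((tangentRep G x).quotient (orbitTangentSpace G x) (tangentRep_mem x)).comp
    (Subgroup.inclusion hH)

lemma stabilizer_le (f : X ⟶ Y) [IsModHom G f] (x : Point X) :
    MulAction.stabilizer (Point G) x ≤ MulAction.stabilizer (Point G) (x ≫ f) := by
  intro g hg
  rw [MulAction.mem_stabilizer_iff] at hg ⊢
  rw [← IsModHom.map_smul, hg]

/-- The action is generically free: `Stab(x) = {1}` for all `x` in a dense open subset. -/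
def GenericallyFree (G X : Over (Spec (.of K))) [GrpObj G] [ModObj G X] : Prop :=
  ∃ U : X.left.Opens, Dense (U : Set X.left) ∧
    ∀ x : Point X, pt x ∈ U → MulAction.stabilizer (Point G) x = ⊥

end Actions

/-! ### The wedge of the characters of a diagonalizable representation -/

section Characters

/-- The dual group `H* = Hom(H, Kˣ)`, written additively. -/
abbrev CharGroup (H K : Type*) [Group H] [Field K] : Type _ := Additive (H →* Kˣ)

/-- The relation `w₁ = ± w₂` on an abelian group. -/
def signSetoid (A : Type*) [AddCommGroup A] : Setoid A where
  r w w' := w = w' ∨ w = -w'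
  iseqv :=
    { refl := fun _ => Or.inl rfl
      symm := by
        rintro w w' (h | h)
        · exact Or.inl h.symm
        · exact Or.inr (by rw [h, neg_neg])
      trans := by
        rintro a b c (rfl | rfl) (rfl | rfl)
        · exact Or.inl rfl
        · exact Or.inr rfl
        · exact Or.inr rfl
        · exact Or.inl (neg_neg c) }

/-- `⋀ʳ(H*)` modulo sign. -/
abbrev WedgeModSign (r : ℕ) (H K : Type*) [Group H] [Field K] : Type _ :=
  Quotient (signSetoid (⋀[ℤ]^r (CharGroup H K)))

variable {H K V : Type*} [Group H] [Field K] [AddCommGroup V] [Module K V] {r : ℕ}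

/-- The class of `χ₁ ∧ ... ∧ χᵣ` modulo sign. -/
def wedge (χ : Fin r → CharGroup H K) : WedgeModSign r H K :=
  Quotient.mk _ (exteriorPower.ιMulti ℤ r χ)

/-- The representation `ρ` is the direct sum of the characters `χ₁, ..., χᵣ`. -/
def IsSumOfCharacters (ρ : Representation K H V) (χ : Fin r → CharGroup H K) : Prop :=
  ∃ b : Module.Basis (Fin r) K V, ∀ h j, ρ h (b j) = ((χ j).toMul h : K) • b j

lemma wedge_eq_of_isSumOfCharacters {ρ : Representation K H V} {χ ξ : Fin r → CharGroup H K}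
    (hχ : IsSumOfCharacters ρ χ) (hξ : IsSumOfCharacters ρ ξ) : wedge χ = wedge ξ := by
  obtain ⟨b, hb⟩ := hχ
  obtain ⟨c, hc⟩ := hξ
  have key : ∀ i j, b.toMatrix c i j ≠ 0 → χ i = ξ j := by
    intro i j hij
    refine Additive.toMul.injective (MonoidHom.ext fun h => Units.ext ?_)
    rw [Module.Basis.toMatrix_apply] at hij
    have h1 : b.repr (ρ h (c j)) i = ((χ i).toMul h : K) * b.repr (c j) i := by
      conv_lhs => rw [← b.sum_repr (c j)]
      simp only [map_sum, map_smul, hb, Finsupp.coe_finsetSum, Finset.sum_apply,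
        Finsupp.smul_apply, Module.Basis.repr_self, smul_eq_mul]
      rw [Finset.sum_eq_single i]
      · rw [Finsupp.single_eq_same, mul_one, mul_comm]
      · intro k _ hk
        rw [Finsupp.single_eq_of_ne hk.symm, mul_zero, mul_zero]
      · intro hi
        exact absurd (Finset.mem_univ i) hi
    rw [hc, map_smul, Finsupp.smul_apply, smul_eq_mul] at h1
    exact (mul_right_cancel₀ hij h1).symm
  have hdet : (b.toMatrix c).det ≠ 0 := by
    have h2 : (b.toMatrix c).det * (c.toMatrix b).det = 1 := by
      rw [← Matrix.det_mul, b.toMatrix_mul_toMatrix_flip c, Matrix.det_one]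
    exact left_ne_zero_of_mul_eq_one h2
  obtain ⟨σ, -, hσ⟩ := Finset.exists_ne_zero_of_sum_ne_zero (by rwa [Matrix.det_apply] at hdet)
  have hprod : ∏ i, b.toMatrix c (σ i) i ≠ 0 := fun h0 => hσ (by rw [h0, smul_zero])
  have hperm : ξ = χ ∘ σ :=
    funext fun i => (key _ _ (Finset.prod_ne_zero_iff.mp hprod i (Finset.mem_univ i))).symm
  refine Quotient.sound ?_
  change _ = _ ∨ _ = _
  rw [hperm, AlternatingMap.map_perm]
  rcases Int.units_eq_one_or (Equiv.Perm.sign σ) with h1 | h1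
  · exact Or.inl (by rw [h1, one_smul])
  · exact Or.inr (by rw [h1, Units.neg_smul, one_smul, neg_neg])

open Classical in
/-- The class of `χ₁ ∧ ... ∧ χᵣ` in `⋀ʳ(H*) / ±` for a representation which is the direct sum of
`r` characters `χ₁, ..., χᵣ`; it does not depend on their numbering. (The value is the class
of `0` if there is no such decomposition.) -/
def characterWedge (r : ℕ) (ρ : Representation K H V) : WedgeModSign r H K :=
  if h : ∃ χ : Fin r → CharGroup H K, IsSumOfCharacters ρ χ then wedge h.choose
  else Quotient.mk _ 0

lemma characterWedge_eq {ρ : Representation K H V} {χ : Fin r → CharGroup H K}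
    (hχ : IsSumOfCharacters ρ χ) : characterWedge r ρ = wedge χ := by
  have h : ∃ χ : Fin r → CharGroup H K, IsSumOfCharacters ρ χ := ⟨χ, hχ⟩
  rw [characterWedge, dif_pos h]
  exact wedge_eq_of_isSumOfCharacters h.choose_spec hχ

end Characters

/-- The invariant `i(X, x, H) ∈ ⋀ʳ(H*) / ±`, where `r` is the rank of `H`: the wedge of the
characters of `H` on `T_x(X) / T_x(Gx)`. -/
def invariant {K : Type u} [Field K] {G X : Over (Spec (.of K))} [GrpObj G] [ModObj G X]
    (x : Point X) (H : Subgroup (Point G)) [Finite H]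
    (hH : H ≤ MulAction.stabilizer (Point G) x) : WedgeModSign (Group.rank H) H K :=
  characterWedge (Group.rank H) (normalRep x H hH)

end GVariety

end

/-! Write A and B for the local rings at y = f(x) and at x. Since Stab(y) is finite and the
characteristic is zero, the differential of the orbit map of y is injective
(`differential_orbitMap_injective`) with image T_y(Gy) (`exists_differential_orbitMap_eq`), and
likewise at x. Averaging over H yields parameters of A that are eigenvectors: functions v_1, ...,
v_r whose differentials vanish along the orbit, carrying the characters α_j of the normal space, and
functions s_i that are coordinates along the orbit. For B one takes similar functions u_l with
characters β_l, together with the pullbacks of the same s_i.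

The slice s = 0 is transversal to the orbit, and its generic point lies in every non-empty
G-invariant open set (`fromStalk_mem_of_invariant`). Indeed, if it did not, the functions vanishing
off the open set would generate an ideal inside (s) that is stable under the derivations induced by
Lie(G), and the Euler derivation pushes such an ideal into every power of (s)
(`eq_bot_of_derivation_mem`). This has two consequences. An element of H killed by all α_j acts
trivially on the slice at y, so it fixes a point with trivial stabilizer and equals 1
(`eq_one_of_forall_sub_mem`); hence the α_j generate H*. Also f is a local isomorphism at the
generic point of the slice at x, so every element of B is a fraction of pulled back functions with
denominator not vanishing on that slice (`exists_pullback_mul_eq`).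

The rest is commutative algebra (`wedge_eq_of_birational`). Order the monomials in u and s by
positive real weights independent over ℚ, those of s being very large. The pullback of v_j does not
vanish on the slice, so its leading monomial is a product of powers u_l ^ M_jl, and comparing
eigenvalues gives α_j = ∑ M_jl β_l. The group H* has rank r and is generated by the α_j, so det M ≠
0. It follows that leading exponents of pulled back functions are combinations of the rows of M and
the unit vectors of s. Each u_l is a quotient of two such functions, so the rows of M span ℤ^r, det
M = ±1, and the two wedges agree up to sign. -/

noncomputable section

namespace GVariety

/-! ### Regular systems of parameters in Noetherian local rings. -/

section RegularSystem

open IsLocalRing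

variable {R σ : Type*} [CommRing R] [IsLocalRing R] [IsNoetherianRing R] [Finite σ]

/-- A regular system of parameters of a Noetherian local ring. -/
structure IsRegularSystem (z : σ → R) : Prop where
  span_range : Ideal.span (Set.range z) = maximalIdeal R
  ringKrullDim_eq : ringKrullDim R = Nat.card σ

/-- Krull's height theorem: each further equation in the maximal ideal costs at most one dimension.
-/
lemma ringKrullDim_quotient_add_ncard_ge {S : Set R} (hS : S.Finite) (hm : S ⊆ maximalIdeal R) :
    ringKrullDim R ≤ ringKrullDim (R ⧸ Ideal.span S) + (S.ncard : ℕ) := by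
  have h1 : Ideal.span S ≤ maximalIdeal R := Ideal.span_le.mpr hm
  refine (ringKrullDim_le_ringKrullDim_quotient_add_spanFinrank (Ideal.span S)
    (by rwa [IsLocalRing.ringJacobson_eq_maximalIdeal])).trans ?_
  gcongr
  exact_mod_cast Submodule.spanFinrank_span_le_ncard_of_finite hS

lemma ringKrullDim_le_of_span_eq {κ : Type*} [Finite κ] {z : κ → R}
    (h : Ideal.span (Set.range z) = maximalIdeal R) : ringKrullDim R ≤ Nat.card κ := by
  refine (ringKrullDim_le_spanFinrank_maximalIdeal R).trans ?_
  rw [← h]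
  have h1 := Submodule.spanFinrank_span_le_ncard_of_finite (R := R) (Set.finite_range z)
  exact_mod_cast h1.trans (Finite.card_range_le z)

namespace IsRegularSystem

variable {z : σ → R} (hz : IsRegularSystem z)

include hz

omit [IsNoetherianRing R] [Finite σ] in
lemma mem (i : σ) : z i ∈ maximalIdeal R := hz.span_range ▸ Ideal.subset_span ⟨i, rfl⟩

omit [IsNoetherianRing R] [Finite σ] in
lemma span_le (T : Set σ) : Ideal.span (z '' T) ≤ maximalIdeal R :=
  Ideal.span_le.mpr fun _ ⟨i, _, h⟩ => h ▸ hz.mem i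

omit [IsNoetherianRing R] [Finite σ] in
lemma nontrivial_quotient (T : Set σ) : Nontrivial (R ⧸ Ideal.span (z '' T)) :=
  Ideal.Quotient.nontrivial_iff.mpr
    (ne_top_of_le_ne_top (maximalIdeal.isMaximal R).ne_top (hz.span_le T))

omit [IsNoetherianRing R] [Finite σ] in
lemma isLocalRing_quotient (T : Set σ) : IsLocalRing (R ⧸ Ideal.span (z '' T)) :=
  have := hz.nontrivial_quotient T
  .of_surjective' (Ideal.Quotient.mk _) Ideal.Quotient.mk_surjective

/-- The surviving parameters generate the maximal ideal, which bounds the dimension of the quotient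
from above by their number; Krull's bound for the parameters killed gives the opposite inequality.
-/
lemma quotient (T : Set σ) [IsLocalRing (R ⧸ Ideal.span (z '' T))] :
    IsRegularSystem (fun i : {i // i ∉ T} => Ideal.Quotient.mk (Ideal.span (z '' T)) (z i)) := by
  have h1 : Ideal.span (Set.range fun i : {i // i ∉ T} =>
      Ideal.Quotient.mk (Ideal.span (z '' T)) (z i)) =
        maximalIdeal (R ⧸ Ideal.span (z '' T)) := by
    rw [← IsLocalRing.map_maximalIdeal_of_surjective (Ideal.Quotient.mk _)
      Ideal.Quotient.mk_surjective, ← hz.span_range, Ideal.map_span]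
    refine le_antisymm (Ideal.span_mono ?_) (Ideal.span_le.mpr ?_)
    · rintro _ ⟨i, rfl⟩
      exact ⟨z i, ⟨i, rfl⟩, rfl⟩
    · rintro _ ⟨_, ⟨i, rfl⟩, rfl⟩
      by_cases hi : i ∈ T
      · rw [Ideal.Quotient.eq_zero_iff_mem.mpr (Ideal.subset_span (Set.mem_image_of_mem z hi))]
        exact Ideal.zero_mem _
      · exact Ideal.subset_span ⟨⟨i, hi⟩, rfl⟩
  refine ⟨h1, le_antisymm (ringKrullDim_le_of_span_eq h1) ?_⟩
  have h2 := ringKrullDim_quotient_add_ncard_ge (R := R) (T.toFinite.image z)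
    (by rintro _ ⟨i, _, rfl⟩; exact hz.mem i)
  have h3 : (z '' T).ncard ≤ Nat.card T := Set.ncard_image_le T.toFinite
  have h4 : Nat.card σ = Nat.card {i // i ∉ T} + Nat.card T := by
    classical
    rw [add_comm]
    exact (Nat.card_congr (Equiv.sumCompl (· ∈ T)).symm).trans Nat.card_sum
  rw [hz.ringKrullDim_eq, h4] at h2
  obtain ⟨m, hm⟩ : ∃ m : ℕ, ringKrullDim (R ⧸ Ideal.span (z '' T)) = m := by
    have := (ringKrullDim_le_of_span_eq h1)
    have h0 : 0 ≤ ringKrullDim (R ⧸ Ideal.span (z '' T)) := ringKrullDim_nonneg_of_nontrivial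
    generalize ringKrullDim (R ⧸ Ideal.span (z '' T)) = e at *
    induction e using WithBot.recBotCoe with
    | bot => exact absurd h0 (by simp)
    | coe e =>
      have : e ≠ ⊤ := by
        rintro rfl
        exact absurd (top_le_iff.mp (WithBot.coe_le_coe.mp this)) (ENat.natCast_ne_top _)
      obtain ⟨m, rfl⟩ := ENat.ne_top_iff_exists.mp this
      exact ⟨m, rfl⟩
  rw [hm] at h2 ⊢
  norm_cast at h2 ⊢
  omega

/-- Otherwise killing T and killing T together with k would give the same ring, with two different
dimensions. -/
lemma notMem_span {T : Set σ} {k : σ} (hk : k ∉ T) : z k ∉ Ideal.span (z '' T) := by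
  intro h
  have hT : Ideal.span (z '' insert k T) = Ideal.span (z '' T) := by
    rw [Set.image_insert_eq, Ideal.span, Submodule.span_insert_eq_span h]
  have := hz.isLocalRing_quotient T
  have := hz.isLocalRing_quotient (insert k T)
  have h1 := (hz.quotient T).ringKrullDim_eq
  have h2 := (hz.quotient (insert k T)).ringKrullDim_eq
  rw [ringKrullDim_eq_of_ringEquiv (Ideal.quotEquivOfEq hT), h1] at h2
  have h3 : Nat.card {i // i ∉ T} = Nat.card {i // i ∉ insert k T} := by exact_mod_cast h2
  have h5 : {i | i ∉ insert k T}.ncard < {i | i ∉ T}.ncard := by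
    refine Set.ncard_lt_ncard ⟨fun i hi hi' => hi (Or.inr hi'), fun hsub => ?_⟩
    exact hsub hk (Or.inl rfl)
  exact absurd h3 h5.ne'

end IsRegularSystem

/-- A ring with a regular system of parameters is a domain. -/
theorem IsRegularSystem.isDomain {n : ℕ} : ∀ {R : Type u} [CommRing R] [IsLocalRing R]
    [IsNoetherianRing R] {σ : Type} [Finite σ] {z : σ → R}, IsRegularSystem z → Nat.card σ = n →
      IsDomain R := by
  induction n with
  | zero =>
    intro R _ _ _ σ _ z hz hn
    have : IsEmpty σ := (Nat.card_eq_zero.mp hn).resolve_right (by simpa using ‹Finite σ›)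
    have h1 := hz.span_range
    rw [Set.range_eq_empty, Ideal.span_empty] at h1
    exact (IsLocalRing.isField_iff_maximalIdeal_eq.mpr h1.symm).isDomain
  | succ n ih =>
    intro R _ _ _ σ _ z hz hn
    obtain ⟨k⟩ : Nonempty σ := (Nat.card_pos_iff.mp (hn ▸ n.succ_pos)).1
    have hcard : Nat.card {i // i ∉ ({k} : Set σ)} = n := by
      classical
      have h := Nat.card_congr (Equiv.sumCompl (· ∈ ({k} : Set σ)))
      rw [Nat.card_sum, hn] at h
      have : Nat.card {i // i ∈ ({k} : Set σ)} = 1 := by simp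
      omega
    have := hz.isLocalRing_quotient {k}
    have hq := hz.quotient {k}
    have hdom := ih hq hcard
    have hdim := hq.ringKrullDim_eq
    rw [hcard] at hdim
    rw [Set.image_singleton] at *
    have hRdim := hz.ringKrullDim_eq
    rw [hn] at hRdim
    -- a prime of maximal dimension
    let p := LTSeries.longestOf (PrimeSpectrum R)
    let P := p.head
    have hPdim : (n + 1 : ℕ) ≤ ringKrullDim (R ⧸ P.asIdeal) := by
      have h1 : (p.length : WithBot ℕ∞) = ringKrullDim R :=
        (Order.krullDim_eq_length_of_finiteDimensionalOrder).symm
      have h2 : (p.length : ℕ∞) ≤ Order.coheight P := Order.length_le_coheight_head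
      rw [ringKrullDim_quotient]
      have h3 := Order.coheight_eq_krullDim_Ici P
      have h4 : PrimeSpectrum.zeroLocus (P.asIdeal : Set R) = Set.Ici P := by
        ext q
        exact Iff.rfl
      rw [h4, ← h3, ← hRdim, ← h1]
      exact_mod_cast h2
    -- R/P has the full dimension n + 1, while R/(z k) has dimension n.
    have hk : z k ∉ P.asIdeal := by
      intro hk
      have h1 : ringKrullDim (R ⧸ P.asIdeal) ≤ ringKrullDim (R ⧸ Ideal.span {z k}) :=
        ringKrullDim_le_of_surjective (Ideal.Quotient.factor
          ((Ideal.span_singleton_le_iff_mem _).mpr hk)) (Ideal.Quotient.factor_surjective _)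
      rw [hdim] at h1
      exact absurd (hPdim.trans h1) (by norm_cast; omega)
    -- Suppose a lies in P but not in (z k). By induction R/(z k) is a domain, so killing a lowers
    -- its dimension n by at least one; but the result surjects onto R/(P, z k), of dimension at
    -- least n.
    have hPle : P.asIdeal ≤ Ideal.span {z k} := by
      intro a ha
      by_contra hak
      have ha' : Ideal.Quotient.mk (Ideal.span {z k}) a ≠ 0 :=
        fun h => hak (Ideal.Quotient.eq_zero_iff_mem.mp h)
      have h1 := ringKrullDim_quotient_succ_le_of_nonZeroDivisor
        (mem_nonZeroDivisors_of_ne_zero ha')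
      have hPm : P.asIdeal ≤ maximalIdeal R := IsLocalRing.le_maximalIdeal P.2.ne_top
      have := (Ideal.Quotient.nontrivial_iff (I := P.asIdeal)).mpr P.2.ne_top
      have : IsLocalRing (R ⧸ P.asIdeal) :=
        .of_surjective' (Ideal.Quotient.mk _) Ideal.Quotient.mk_surjective
      have h2 := ringKrullDim_quotient_add_ncard_ge (R := R ⧸ P.asIdeal)
        (S := {Ideal.Quotient.mk _ (z k)}) (Set.finite_singleton _) (by
          rw [Set.singleton_subset_iff, ← IsLocalRing.map_maximalIdeal_of_surjective
            (Ideal.Quotient.mk _) Ideal.Quotient.mk_surjective]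
          exact Ideal.mem_map_of_mem _ (hz.mem k))
      rw [Set.ncard_singleton] at h2
      have h3 : ringKrullDim ((R ⧸ P.asIdeal) ⧸ Ideal.span {Ideal.Quotient.mk P.asIdeal (z k)}) ≤
          ringKrullDim ((R ⧸ Ideal.span {z k}) ⧸
            Ideal.span {Ideal.Quotient.mk (Ideal.span {z k}) a}) := by
        let q := (Ideal.Quotient.mk (Ideal.span {Ideal.Quotient.mk P.asIdeal (z k)})).comp
          (Ideal.Quotient.mk P.asIdeal)
        let q1 := Ideal.Quotient.lift (Ideal.span {z k}) q (fun b hb => by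
          obtain ⟨c, rfl⟩ := Ideal.mem_span_singleton.mp hb
          rw [map_mul]
          refine mul_eq_zero_of_left ?_ _
          exact Ideal.Quotient.eq_zero_iff_mem.mpr (Ideal.mem_span_singleton_self _))
        let q2 := Ideal.Quotient.lift (Ideal.span {Ideal.Quotient.mk (Ideal.span {z k}) a}) q1
          (fun b hb => by
            obtain ⟨c, rfl⟩ := Ideal.mem_span_singleton.mp hb
            rw [map_mul]
            refine mul_eq_zero_of_left ?_ _
            change Ideal.Quotient.mk _ (Ideal.Quotient.mk P.asIdeal a) = 0
            rw [Ideal.Quotient.eq_zero_iff_mem.mpr ha, map_zero])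
        refine ringKrullDim_le_of_surjective q2 fun b => ?_
        obtain ⟨b, rfl⟩ := Ideal.Quotient.mk_surjective b
        obtain ⟨b, rfl⟩ := Ideal.Quotient.mk_surjective b
        exact ⟨Ideal.Quotient.mk _ (Ideal.Quotient.mk _ b), rfl⟩
      have h4 : (n + 1 : ℕ) + 1 ≤ (n + 1 : ℕ) := by
        have h5 : ((n + 1 : ℕ) : WithBot ℕ∞) + 1 ≤ (n : ℕ) + 1 := by
          calc ((n + 1 : ℕ) : WithBot ℕ∞) + 1 ≤ ringKrullDim ((R ⧸ Ideal.span {z k}) ⧸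
                Ideal.span {Ideal.Quotient.mk (Ideal.span {z k}) a}) + 1 + 1 := by
                gcongr
                exact hPdim.trans (h2.trans (by exact add_le_add h3 le_rfl))
            _ ≤ (n : ℕ) + 1 := by
                gcongr
                exact h1.trans hdim.le
        exact_mod_cast h5
      omega
    -- Elements of P are multiples of z k with cofactor in P, so P = mP and Nakayama applies.
    have hbot : P.asIdeal = ⊥ := by
      refine Submodule.eq_bot_of_le_smul_of_le_jacobson_bot (maximalIdeal R) P.asIdeal
        (IsNoetherian.noetherian _) (fun a ha => ?_) (IsLocalRing.maximalIdeal_le_jacobson _)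
      obtain ⟨b, rfl⟩ := Ideal.mem_span_singleton.mp (hPle ha)
      exact Submodule.smul_mem_smul (hz.mem k) ((P.2.mem_or_mem ha).resolve_left hk)
    have := P.2
    rw [hbot] at this
    exact IsDomain.of_bot_isPrime R

/-! ### Monomials in a regular system of parameters. -/

section Monomials

variable {R : Type u} [CommRing R] [IsLocalRing R] [IsNoetherianRing R] {σ : Type} [Finite σ]
  {z : σ → R}

namespace IsRegularSystem

lemma isPrime_span (hz : IsRegularSystem z) (T : Set σ) : (Ideal.span (z '' T)).IsPrime := by
  have := hz.isLocalRing_quotient T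
  have := (hz.quotient T).isDomain rfl
  exact (Ideal.Quotient.isDomain_iff_prime _).mp this

/-- Powers of distinct parameters form regular sequences. -/
lemma mem_span_pow_of_mul_mem (hz : IsRegularSystem z) {N : ℕ} : ∀ {T : Finset σ} {a : σ → ℕ} {k : σ}, k ∉ T →
    (∀ i ∈ T, 1 ≤ a i) → ∑ i ∈ T, (a i) ≤ N → ∀ b : R,
      z k * b ∈ Ideal.span ((fun i => z i ^ a i) '' T) →
        b ∈ Ideal.span ((fun i => z i ^ a i) '' (T : Set σ)) := by
  classical
  induction N with
  | zero =>
    intro T a k hk ha hN b hb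
    have hT : T = ∅ := by
      by_contra hne
      obtain ⟨i, hi⟩ := Finset.nonempty_iff_ne_empty.mpr hne
      have h1 := Finset.single_le_sum (f := a) (fun i _ => Nat.zero_le _) hi
      have := ha i hi
      omega
    subst hT
    have := hz.isDomain rfl
    simp only [Finset.coe_empty, Set.image_empty, Ideal.span_empty, Ideal.mem_bot] at hb ⊢
    refine (mul_eq_zero.mp hb).resolve_left fun h0 => ?_
    have := hz.notMem_span (T := ∅) (k := k) (Set.notMem_empty _)
    exact this (h0 ▸ Ideal.zero_mem _)
  | succ N ih =>
    intro T a k hk ha hN b hb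
    by_cases hone : ∀ i ∈ T, a i = 1
    -- When all exponents are one, the ideal is prime and does not contain z k.
    · have h1 : (fun i => z i ^ a i) '' (T : Set σ) = z '' T :=
        Set.image_congr fun i hi => by rw [hone i hi, pow_one]
      rw [h1] at hb ⊢
      exact ((hz.isPrime_span T).mem_or_mem hb).resolve_left (hz.notMem_span hk)
    · push Not at hone
      obtain ⟨j, hj, hj1⟩ := hone
      have hj2 : 2 ≤ a j := by have := ha j hj; omega
      let T' := T.erase j
      let I' := Ideal.span ((fun i => z i ^ a i) '' (T' : Set σ))
      have hjT' : j ∉ T' := Finset.notMem_erase _ _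
      have hT : T = insert j T' := (Finset.insert_erase hj).symm
      have hspan (e : ℕ) (c : R) :
          c ∈ Ideal.span ((fun i => z i ^ (Function.update a j e i)) '' (T : Set σ)) ↔
            ∃ d, c - d * z j ^ e ∈ I' := by
        have h1 : (fun i => z i ^ (Function.update a j e i)) '' (T : Set σ) =
            insert (z j ^ e) ((fun i => z i ^ a i) '' (T' : Set σ)) := by
          rw [hT, Finset.coe_insert, Set.image_insert_eq]
          congr 1
          · simp
          · refine Set.image_congr fun i hi => ?_
            have : i ≠ j := by rintro rfl; exact hjT' hi
            simp [this]
        rw [h1, Ideal.mem_span_insert']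
        constructor
        · rintro ⟨d, hd⟩
          exact ⟨-d, by simpa [sub_eq_add_neg] using hd⟩
        · rintro ⟨d, hd⟩
          exact ⟨-d, by simpa [sub_eq_add_neg] using hd⟩
      have hsum : ∑ i ∈ T, a i = a j + ∑ i ∈ T', a i := (Finset.add_sum_erase T a hj).symm
      have hsum' (e : ℕ) : ∑ i ∈ T, Function.update a j e i = e + ∑ i ∈ T', a i := by
        rw [← Finset.add_sum_erase T _ hj, Function.update_self]
        congr 1
        refine Finset.sum_congr rfl fun i hi => ?_
        rw [Function.update_of_ne (Finset.ne_of_mem_erase hi)]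
      have hpos (e : ℕ) (he : 1 ≤ e) : ∀ i ∈ T, 1 ≤ Function.update a j e i := by
        intro i hi
        by_cases hij : i = j
        · subst hij; simpa using he
        · simpa [hij] using ha i hi
      have haj : Function.update a j (a j) = a := Function.update_eq_self j a
      have hmem := (hspan (a j) (z k * b)).mp (by rwa [haj])
      obtain ⟨c, hc⟩ := hmem
      -- Lowering one exponent to 1 lets the induction hypothesis write b as b' * z j modulo the
      -- other powers. Cancelling z j, again by induction, leaves the same question for b' with
      -- exponent a j - 1.
      have hb1 : b ∈ Ideal.span ((fun i => z i ^ (Function.update a j 1 i)) '' (T : Set σ)) := by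
        refine ih hk (hpos 1 le_rfl) (by rw [hsum']; omega) b ((hspan 1 _).mpr ⟨c * z j ^ (a j - 1), ?_⟩)
        rwa [mul_assoc, ← pow_add, show a j - 1 + 1 = a j by omega]
      obtain ⟨b', hb'⟩ := (hspan 1 b).mp hb1
      rw [pow_one] at hb'
      have h2 : z j * (z k * b' - c * z j ^ (a j - 1)) ∈ I' := by
        have h3 : z j * (z k * b' - c * z j ^ (a j - 1)) =
            (z k * b - c * z j ^ a j) - z k * (b - b' * z j) := by
          obtain ⟨e, he⟩ : ∃ e, a j = e + 1 := ⟨a j - 1, by omega⟩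
          rw [he, Nat.add_sub_cancel]
          ring
        rw [h3]
        exact Ideal.sub_mem _ hc (Ideal.mul_mem_left _ _ hb')
      have h4 := ih hjT' (fun i hi => ha i (Finset.mem_of_mem_erase hi)) (by omega) _ h2
      have h5 : b' ∈ Ideal.span ((fun i => z i ^ (Function.update a j (a j - 1) i)) '' (T : Set σ)) :=
        ih hk (hpos _ (by omega)) (by rw [hsum']; omega) _ ((hspan _ _).mpr ⟨c, h4⟩)
      obtain ⟨d, hd⟩ := (hspan _ _).mp h5
      rw [← haj]
      refine (hspan _ _).mpr ⟨d, ?_⟩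
      have h6 : b - d * z j ^ a j = (b - b' * z j) + z j * (b' - d * z j ^ (a j - 1)) := by
        obtain ⟨e, he⟩ : ∃ e, a j = e + 1 := ⟨a j - 1, by omega⟩
        rw [he, Nat.add_sub_cancel]
        ring
      rw [h6]
      exact Ideal.add_mem _ hb' (Ideal.mul_mem_left _ _ hd)

/-- Modulo the powers of the other parameters z k is a non-zero-divisor, so z k ^ p cancels from a
relation involving z k ^ (p + 1). -/
lemma mem_of_pow_mul_mem [DecidableEq σ] (hz : IsRegularSystem z) {a : σ → ℕ} (ha : ∀ i, 1 ≤ a i)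
    (k : σ) (p : ℕ) {b : R}
    (hb : z k ^ p * b ∈ Ideal.span (Set.range fun i => z i ^ Function.update a k (p + 1) i)) :
    b ∈ Ideal.span (Set.range fun i => z i ^ Function.update a k 1 i) := by
  have := Fintype.ofFinite σ
  let T : Finset σ := Finset.univ.erase k
  let I' := Ideal.span ((fun i => z i ^ a i) '' (T : Set σ))
  have hspan (e : ℕ) (c : R) :
      c ∈ Ideal.span (Set.range fun i => z i ^ Function.update a k e i) ↔
        ∃ d, c - d * z k ^ e ∈ I' := by
    have h1 : (Set.range fun i => z i ^ Function.update a k e i) =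
        insert (z k ^ e) ((fun i => z i ^ a i) '' (T : Set σ)) := by
      rw [← Set.image_univ, ← Finset.coe_univ, ← Finset.insert_erase (Finset.mem_univ k),
        Finset.coe_insert, Set.image_insert_eq]
      congr 1
      · simp
      · refine Set.image_congr fun i hi => ?_
        have : i ≠ k := by rintro rfl; exact Finset.notMem_erase _ _ hi
        simp [this]
    rw [h1, Ideal.mem_span_insert']
    constructor
    · rintro ⟨d, hd⟩
      exact ⟨-d, by simpa [sub_eq_add_neg] using hd⟩
    · rintro ⟨d, hd⟩
      exact ⟨-d, by simpa [sub_eq_add_neg] using hd⟩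
  obtain ⟨d, hd⟩ := (hspan _ _).mp hb
  refine (hspan _ _).mpr ⟨d, ?_⟩
  have h1 : z k ^ p * (b - d * z k ^ 1) ∈ I' := by
    have h2 : z k ^ p * (b - d * z k ^ 1) = z k ^ p * b - d * z k ^ (p + 1) := by ring
    rwa [h2]
  have hcancel (p : ℕ) (b : R) : z k ^ p * b ∈ I' → b ∈ I' := by
    induction p with
    | zero => intro h; simpa using h
    | succ p ihp =>
      intro h
      rw [pow_succ', mul_assoc] at h
      exact ihp (hz.mem_span_pow_of_mul_mem (Finset.notMem_erase k _) (fun i _ => ha i) le_rfl _ h)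
  exact hcancel p _ h1

/-- The monomial `z ^ m` is not in the ideal generated by the `z i ^ (m i + 1)`. -/
theorem prod_pow_notMem [Fintype σ] (hz : IsRegularSystem z) (m : σ → ℕ) :
    ∏ i, z i ^ m i ∉ Ideal.span (Set.range fun i => z i ^ (m i + 1)) := by
  classical
  -- The factors of the monomial are cancelled one parameter at a time, the exponent of the
  -- cancelled parameter in the ideal dropping to 1. At the end 1 would lie in an ideal contained in
  -- the maximal one.
  have key : ∀ (S : Finset σ) (a : σ → ℕ), (∀ i, 1 ≤ a i) → (∀ i ∈ S, a i = m i + 1) →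
      ∏ i ∈ S, z i ^ m i ∉ Ideal.span (Set.range fun i => z i ^ a i) := by
    intro S
    induction S using Finset.induction_on with
    | empty =>
      intro a ha _ h
      rw [Finset.prod_empty] at h
      refine (Ideal.ne_top_iff_one _).mp (maximalIdeal.isMaximal R).ne_top
        (Ideal.span_le.mpr ?_ h)
      rintro _ ⟨i, rfl⟩
      exact Ideal.pow_mem_of_mem _ (hz.mem i) _ (ha i)
    | insert k S hk ih =>
      intro a ha hS h
      rw [Finset.prod_insert hk] at h
      have h1 : a = Function.update a k (m k + 1) := by
        rw [← hS k (Finset.mem_insert_self _ _), Function.update_eq_self]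
      rw [h1] at h
      refine ih (Function.update a k 1) (fun i => ?_) (fun i hi => ?_)
        (hz.mem_of_pow_mul_mem ha k (m k) h)
      · by_cases hik : i = k
        · subst hik; simp
        · simpa [hik] using ha i
      · have : i ≠ k := by rintro rfl; exact hk hi
        simpa [this] using hS i (Finset.mem_insert_of_mem hi)
  exact key Finset.univ _ (fun i => Nat.succ_pos _) fun i _ => rfl

end IsRegularSystem

end Monomials

end RegularSystem

/-! ### Leading monomials with respect to real weights. -/

section Lead

open IsLocalRing

variable {R : Type*} [CommRing R] {σ : Type*}

/-- The monomial `z ^ k`. -/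
def mon (z : σ → R) (k : σ →₀ ℕ) : R := k.prod fun i n => z i ^ n

lemma mon_zero (z : σ → R) : mon z 0 = 1 := Finsupp.prod_zero_index

lemma mon_add (z : σ → R) (k l : σ →₀ ℕ) : mon z (k + l) = mon z k * mon z l := by
  classical
  exact Finsupp.prod_add_index' (fun _ => pow_zero _) fun _ _ _ => pow_add _ _ _

lemma mon_single_pow (z : σ → R) (i : σ) (n : ℕ) : mon z (Finsupp.single i n) = z i ^ n :=
  Finsupp.prod_single_index (h := fun i n => z i ^ n) (pow_zero _)

lemma mon_single (z : σ → R) (i : σ) : mon z (Finsupp.single i 1) = z i := by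
  rw [mon_single_pow, pow_one]

lemma map_mon {S F : Type*} [CommRing S] [FunLike F R S] [RingHomClass F R S] (φ : F) (z : σ → R)
    (k : σ →₀ ℕ) : φ (mon z k) = mon (fun i => φ (z i)) k := by
  rw [mon, mon, map_finsuppProd]
  simp only [map_pow]

/-- The ideal generated by the monomials of weight more than `t`. -/
def weightIdeal (w : σ → ℝ) (z : σ → R) (t : ℝ) : Ideal R :=
  Ideal.span (mon z '' {k | t < Finsupp.weight w k})

/-- The ideal generated by the monomials of weight at least `t`. -/
def weightIdealGe (w : σ → ℝ) (z : σ → R) (t : ℝ) : Ideal R :=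
  Ideal.span (mon z '' {k | t ≤ Finsupp.weight w k})

variable {w : σ → ℝ} {z : σ → R}

lemma mon_mem_weightIdeal {t : ℝ} {k : σ →₀ ℕ} (h : t < Finsupp.weight w k) :
    mon z k ∈ weightIdeal w z t := Ideal.subset_span ⟨k, h, rfl⟩

lemma mon_mem_weightIdealGe (k : σ →₀ ℕ) :
    mon z k ∈ weightIdealGe w z (Finsupp.weight w k) := Ideal.subset_span ⟨k, le_refl (Finsupp.weight w k), rfl⟩

lemma weightIdeal_anti {s t : ℝ} (h : s ≤ t) : weightIdeal w z t ≤ weightIdeal w z s :=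
  Ideal.span_mono (Set.image_mono fun _ hk => h.trans_lt hk)

lemma weightIdeal_le_ge (t : ℝ) : weightIdeal w z t ≤ weightIdealGe w z t :=
  Ideal.span_mono (Set.image_mono fun k (hk : t < Finsupp.weight w k) => hk.le)

lemma mul_mem_weightIdeal {s t : ℝ} {a b : R} (ha : a ∈ weightIdeal w z s)
    (hb : b ∈ weightIdealGe w z t) : a * b ∈ weightIdeal w z (s + t) := by
  have h := Ideal.mul_mem_mul ha hb
  rw [weightIdeal, weightIdealGe, Ideal.span_mul_span'] at h
  refine Ideal.span_mono ?_ h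
  rintro _ ⟨_, ⟨k, hk, rfl⟩, _, ⟨l, hl, rfl⟩, rfl⟩
  refine ⟨k + l, ?_, mon_add z k l⟩
  change s + t < Finsupp.weight w (k + l)
  rw [map_add]
  exact add_lt_add_of_lt_of_le hk hl

lemma mul_mem_weightIdealGe {s t : ℝ} {a b : R} (ha : a ∈ weightIdealGe w z s)
    (hb : b ∈ weightIdealGe w z t) : a * b ∈ weightIdealGe w z (s + t) := by
  have h := Ideal.mul_mem_mul ha hb
  rw [weightIdealGe, weightIdealGe, Ideal.span_mul_span'] at h
  refine Ideal.span_mono ?_ h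
  rintro _ ⟨_, ⟨k, hk, rfl⟩, _, ⟨l, hl, rfl⟩, rfl⟩
  refine ⟨k + l, ?_, mon_add z k l⟩
  change s + t ≤ Finsupp.weight w (k + l)
  rw [map_add]
  exact add_le_add hk hl

variable {K : Type*} [Field K] [Algebra K R]

/-- `b` has leading term a non-zero multiple of the monomial `z ^ k`. -/
def Lead (K : Type*) [Field K] [Algebra K R] (w : σ → ℝ) (z : σ → R) (b : R) (k : σ →₀ ℕ) : Prop :=
  ∃ c : K, c ≠ 0 ∧ b - c • mon z k ∈ weightIdeal w z (Finsupp.weight w k)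

lemma smul_mem_ideal (I : Ideal R) (c : K) {a : R} (ha : a ∈ I) : c • a ∈ I := by
  rw [Algebra.smul_def]
  exact I.mul_mem_left _ ha

lemma Lead.mem_ge {b : R} {k : σ →₀ ℕ} (h : Lead K w z b k) :
    b ∈ weightIdealGe w z (Finsupp.weight w k) := by
  obtain ⟨c, -, hc⟩ := h
  rw [← sub_add_cancel b (c • mon z k)]
  exact Ideal.add_mem _ (weightIdeal_le_ge _ hc) (smul_mem_ideal _ c (mon_mem_weightIdealGe k))

lemma lead_mon (k : σ →₀ ℕ) : Lead K w z (mon z k) k :=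
  ⟨1, one_ne_zero, by rw [one_smul, sub_self]; exact Ideal.zero_mem _⟩

/-- Leading exponents behave like a valuation: every cross term involves a remainder of strictly
larger weight. -/
lemma Lead.mul {a b : R} {k l : σ →₀ ℕ} (ha : Lead K w z a k) (hb : Lead K w z b l) :
    Lead K w z (a * b) (k + l) := by
  have hb' := hb.mem_ge
  obtain ⟨c, hc0, hc⟩ := ha
  obtain ⟨d, hd0, hd⟩ := hb
  refine ⟨c * d, mul_ne_zero hc0 hd0, ?_⟩
  have h1 : a * b - (c * d) • mon z (k + l) =
      (a - c • mon z k) * b + c • ((b - d • mon z l) * mon z k) := by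
    rw [mon_add]
    simp only [Algebra.smul_def, map_mul]
    ring
  rw [h1, map_add]
  refine Ideal.add_mem _ (mul_mem_weightIdeal hc hb') (smul_mem_ideal _ c ?_)
  rw [add_comm]
  exact mul_mem_weightIdeal hd (mon_mem_weightIdealGe k)

lemma lead_mon_of {τ : Type*} {a : τ → R} {q : τ → σ →₀ ℕ} (ha : ∀ j, Lead K w z (a j) (q j))
    (k : τ →₀ ℕ) : Lead K w z (mon a k) (k.sum fun j n => n • q j) := by
  classical
  have hpow (j : τ) (n : ℕ) : Lead K w z (a j ^ n) (n • q j) := by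
    induction n with
    | zero => rw [pow_zero, zero_smul, ← mon_zero z]; exact lead_mon 0
    | succ n ih => rw [pow_succ, succ_nsmul]; exact ih.mul (ha j)
  induction k using Finsupp.induction with
  | zero => rw [mon_zero, Finsupp.sum_zero_index, ← mon_zero z]; exact lead_mon 0
  | single_add j n k hj hn ih =>
    rw [mon_add, Finsupp.sum_add_index' (h := fun j n => n • q j) (fun _ => zero_smul _ _)
      (fun _ _ _ => add_smul _ _ _),
      Finsupp.sum_single_index (h := fun j n => n • q j) (zero_smul _ _), mon_single_pow]
    exact (hpow j n).mul ih

/-- A homomorphism under which the weight of every parameter does not drop. -/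
lemma map_mem_weightIdeal {S τ : Type*} [CommRing S] {a : τ → S} {v : τ → ℝ} (φ : S →+* R)
    (h : ∀ j, φ (a j) ∈ weightIdealGe w z (v j)) {t : ℝ} {b : S} (hb : b ∈ weightIdeal v a t) :
    φ b ∈ weightIdeal w z t := by
  classical
  have hone : (1 : R) ∈ weightIdealGe w z 0 := by
    have := mon_mem_weightIdealGe (w := w) (z := z) 0
    rwa [map_zero, mon_zero] at this
  have hpow (j : τ) (n : ℕ) : φ (a j) ^ n ∈ weightIdealGe w z (n • v j) := by
    induction n with
    | zero => rwa [pow_zero, zero_smul]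
    | succ n ih => rw [pow_succ, succ_nsmul]; exact mul_mem_weightIdealGe ih (h j)
  have hmon (k : τ →₀ ℕ) : mon (fun j => φ (a j)) k ∈ weightIdealGe w z (Finsupp.weight v k) := by
    induction k using Finsupp.induction with
    | zero => rwa [mon_zero, map_zero]
    | single_add j n k hj hn ih =>
      rw [mon_add, map_add]
      refine mul_mem_weightIdealGe ?_ ih
      rw [Finsupp.weight_single, mon_single_pow]
      exact hpow j n
  have h1 : weightIdeal v a t ≤ (weightIdeal w z t).comap φ := by
    refine Ideal.span_le.mpr ?_
    rintro _ ⟨k, hk, rfl⟩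
    rw [SetLike.mem_coe, Ideal.mem_comap, map_mon]
    have h2 : weightIdealGe w z (Finsupp.weight v k) ≤ weightIdeal w z t :=
      Ideal.span_mono (Set.image_mono fun l hl => lt_of_lt_of_le (b := Finsupp.weight v k) hk hl)
    exact h2 (hmon k)
  exact h1 hb

section Local

variable [IsLocalRing R] (hres : ∀ r : R, ∃ c : K, r - algebraMap K R c ∈ maximalIdeal R)
  (hspan : Ideal.span (Set.range z) = maximalIdeal R)

include hres hspan in
-- The residue field is K and z generates m, so an element of m ^ N agrees modulo m ^ (N + 1) with a
-- polynomial in z; these corrections are added degree by degree.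
lemma exists_mvPolynomial (N : ℕ) (b : R) :
    ∃ p : MvPolynomial σ K, b - MvPolynomial.aeval z p ∈ maximalIdeal R ^ N := by
  have h1 : ∀ u ∈ maximalIdeal R,
      ∃ p : MvPolynomial σ K, u - MvPolynomial.aeval z p ∈ maximalIdeal R ^ 2 := by
    intro u hu
    rw [← hspan] at hu
    refine Submodule.span_induction (p := fun u _ => ∃ p : MvPolynomial σ K,
      u - MvPolynomial.aeval z p ∈ maximalIdeal R ^ 2) ?_ ?_ ?_ ?_ hu
    · rintro _ ⟨i, rfl⟩
      exact ⟨MvPolynomial.X i, by rw [MvPolynomial.aeval_X, sub_self]; exact Ideal.zero_mem _⟩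
    · exact ⟨0, by rw [map_zero, sub_zero]; exact Ideal.zero_mem _⟩
    · rintro x y - - ⟨p, hp⟩ ⟨q, hq⟩
      exact ⟨p + q, by rw [map_add, add_sub_add_comm]; exact Ideal.add_mem _ hp hq⟩
    · rintro r x hx ⟨p, hp⟩
      obtain ⟨c, hc⟩ := hres r
      refine ⟨MvPolynomial.C c * p, ?_⟩
      have hx' : x ∈ maximalIdeal R := by rw [← hspan]; exact hx
      have h3 : r • x - MvPolynomial.aeval z (MvPolynomial.C c * p) =
          (r - algebraMap K R c) * x + algebraMap K R c * (x - MvPolynomial.aeval z p) := by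
        rw [map_mul, MvPolynomial.aeval_C, smul_eq_mul]
        ring
      rw [h3]
      refine Ideal.add_mem _ ?_ (Ideal.mul_mem_left _ _ hp)
      rw [pow_two]
      exact Ideal.mul_mem_mul hc hx'
  have h2 : ∀ N : ℕ, ∀ u ∈ maximalIdeal R ^ N,
      ∃ p : MvPolynomial σ K, u - MvPolynomial.aeval z p ∈ maximalIdeal R ^ (N + 1) := by
    intro N
    induction N with
    | zero =>
      intro u _
      obtain ⟨c, hc⟩ := hres u
      exact ⟨MvPolynomial.C c, by rwa [MvPolynomial.aeval_C, zero_add, pow_one]⟩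
    | succ N ih =>
      intro u hu
      rw [pow_succ'] at hu
      refine Submodule.mul_induction_on hu ?_ ?_
      · intro x hx y hy
        obtain ⟨p, hp⟩ := h1 x hx
        obtain ⟨q, hq⟩ := ih y hy
        refine ⟨p * q, ?_⟩
        have h3 : x * y - MvPolynomial.aeval z (p * q) =
            x * (y - MvPolynomial.aeval z q) +
              (x - MvPolynomial.aeval z p) * MvPolynomial.aeval z q := by
          rw [map_mul]
          ring
        have h4 : MvPolynomial.aeval z q ∈ maximalIdeal R ^ N := by
          have := Ideal.sub_mem _ hy (Ideal.pow_le_pow_right (Nat.le_succ N) hq)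
          rwa [sub_sub_cancel] at this
        rw [h3]
        refine Ideal.add_mem _ ?_ ?_
        · rw [pow_succ' _ (N + 1)]
          exact Ideal.mul_mem_mul hx hq
        · rw [show N + 1 + 1 = 2 + N by omega, pow_add]
          exact Ideal.mul_mem_mul hp h4
      · rintro x y ⟨p, hp⟩ ⟨q, hq⟩
        exact ⟨p + q, by rw [map_add, add_sub_add_comm]; exact Ideal.add_mem _ hp hq⟩
  induction N with
  | zero => exact ⟨0, by rw [pow_zero, Ideal.one_eq_top]; exact Submodule.mem_top⟩
  | succ N ih =>
    obtain ⟨p, hp⟩ := ih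
    obtain ⟨q, hq⟩ := h2 N _ hp
    exact ⟨p + q, by rwa [map_add, ← sub_sub]⟩

variable [Fintype σ]

lemma weight_eq_sum (w : σ → ℝ) (k : σ →₀ ℕ) : Finsupp.weight w k = ∑ i, (k i : ℝ) * w i := by
  rw [Finsupp.weight_apply, Finsupp.sum_fintype k (fun i c => c • w i) fun _ => zero_smul _ _]
  simp only [nsmul_eq_mul]

lemma weight_nonneg (hw : ∀ i, 0 < w i) (k : σ →₀ ℕ) : 0 ≤ Finsupp.weight w k := by
  rw [weight_eq_sum]
  exact Finset.sum_nonneg fun i _ => mul_nonneg (Nat.cast_nonneg _) (hw i).le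

/-- Independence over ℚ makes the weight a total order on monomials without ties, so that there is a
single leading monomial. -/
lemma weight_injective (hw : LinearIndependent ℚ w) : Function.Injective (Finsupp.weight (R := ℕ) w) := by
  intro k l h
  rw [weight_eq_sum, weight_eq_sum, ← sub_eq_zero, ← Finset.sum_sub_distrib] at h
  have h1 := Fintype.linearIndependent_iff.mp hw (fun i => (k i : ℚ) - (l i : ℚ)) (by
    rw [← h]
    refine Finset.sum_congr rfl fun i _ => ?_
    rw [Rat.smul_def]
    push_cast
    ring)
  ext i
  exact_mod_cast sub_eq_zero.mp (h1 i)

include hspan in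
-- For positive weights the weight filtration and the m-adic filtration are cofinal;
-- `weightIdeal_le_pow` is the other direction.
lemma pow_le_weightIdeal (hw : ∀ i, 0 < w i) (t : ℝ) :
    ∃ N : ℕ, maximalIdeal R ^ N ≤ weightIdeal w z t := by
  obtain ⟨c, hc, hcw⟩ : ∃ c : ℝ, 0 < c ∧ ∀ i, c ≤ w i := by
    rcases isEmpty_or_nonempty σ with h | h
    · exact ⟨1, one_pos, fun i => h.elim i⟩
    · obtain ⟨i, hi⟩ := Finite.exists_min w
      exact ⟨w i, hw i, hi⟩
  have h1 : maximalIdeal R ≤ weightIdealGe w z c := by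
    rw [← hspan, Ideal.span_le]
    rintro _ ⟨i, rfl⟩
    refine Ideal.subset_span ⟨Finsupp.single i 1, ?_, mon_single z i⟩
    change c ≤ Finsupp.weight w (Finsupp.single i 1)
    rw [Finsupp.weight_single, one_smul]
    exact hcw i
  have h2 (n : ℕ) : maximalIdeal R ^ n ≤ weightIdealGe w z (n * c) := by
    induction n with
    | zero =>
      intro a _
      rw [← mul_one a]
      refine Ideal.mul_mem_left _ _ (Ideal.subset_span ⟨0, ?_, mon_zero z⟩)
      change ((0 : ℕ) : ℝ) * c ≤ Finsupp.weight w 0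
      rw [map_zero, Nat.cast_zero, zero_mul]
    | succ n ih =>
      rw [pow_succ, Ideal.mul_le]
      intro a ha b hb
      rw [Nat.cast_succ, add_mul, one_mul]
      exact mul_mem_weightIdealGe (ih ha) (h1 hb)
  obtain ⟨n, hn⟩ := exists_nat_gt (t / c)
  refine ⟨n, (h2 n).trans (Ideal.span_mono (Set.image_mono fun k hk => ?_))⟩
  exact ((div_lt_iff₀ hc).mp hn).trans_le hk

omit [Fintype σ] in
include hspan in
lemma mem_maximalIdeal_of_span_eq (i : σ) : z i ∈ maximalIdeal R :=
  hspan ▸ Ideal.subset_span ⟨i, rfl⟩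

lemma exists_lt_of_weight_lt (hw : ∀ i, 0 < w i) {k l : σ →₀ ℕ}
    (h : Finsupp.weight w k < Finsupp.weight w l) : ∃ i, k i < l i := by
  by_contra! hle
  rw [weight_eq_sum, weight_eq_sum] at h
  refine absurd h (not_lt.mpr (Finset.sum_le_sum fun i _ => ?_))
  exact mul_le_mul_of_nonneg_right (by exact_mod_cast hle i) (hw i).le

omit [Fintype σ] [IsLocalRing R] in
lemma pow_dvd_mon (k : σ →₀ ℕ) (i : σ) {n : ℕ} (hn : n ≤ k i) : z i ^ n ∣ mon z k := by
  classical
  rw [← Finsupp.single_add_erase i k, mon_add, mon_single_pow]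
  exact (pow_dvd_pow _ hn).mul_right _

include hspan in
lemma weightIdeal_le_pow (hw : ∀ i, 0 < w i) (N : ℕ) :
    ∃ t : ℝ, weightIdeal w z t ≤ maximalIdeal R ^ N := by
  -- A monomial heavier than the one with all exponents N has some exponent above N.
  refine ⟨Finsupp.weight w (Finsupp.equivFunOnFinite.symm fun _ => N), Ideal.span_le.mpr ?_⟩
  rintro _ ⟨k, hk, rfl⟩
  obtain ⟨i, hi⟩ := exists_lt_of_weight_lt hw hk
  exact Ideal.mem_of_dvd _ (pow_dvd_mon k i (le_of_lt hi))
    (Ideal.pow_mem_pow (mem_maximalIdeal_of_span_eq hspan i) N)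

include hres hspan in
/-- Non-zero elements have leading terms. -/
theorem exists_lead [IsNoetherianRing R] (hw : ∀ i, 0 < w i) (hwi : LinearIndependent ℚ w) {b : R}
    (hb : b ≠ 0) : ∃ k, Lead K w z b k := by
  -- Krull's intersection theorem bounds the order of b, hence the weight at which its leading term
  -- can appear.
  obtain ⟨N₀, hN₀⟩ : ∃ N, b ∉ maximalIdeal R ^ N := by
    by_contra! h
    have h1 : b ∈ ⨅ N : ℕ, maximalIdeal R ^ N := (Ideal.mem_iInf).mpr h
    rw [Ideal.iInf_pow_eq_bot_of_isLocalRing _ (maximalIdeal.isMaximal R).ne_top] at h1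
    exact hb h1
  obtain ⟨t, ht⟩ := weightIdeal_le_pow hspan hw N₀
  have hbt : b ∉ weightIdeal w z t := fun h => hN₀ (ht h)
  -- Modulo terms heavier than t, b is a polynomial in z. Since b is not among those terms, some
  -- monomial of the polynomial has weight at most t, and the lightest one leads.
  obtain ⟨N, hN⟩ := pow_le_weightIdeal hspan hw t
  obtain ⟨p, hp⟩ := exists_mvPolynomial hres hspan N b
  have hsum : MvPolynomial.aeval z p = ∑ k ∈ p.support, p.coeff k • mon z k := by
    rw [MvPolynomial.aeval_def, MvPolynomial.eval₂_eq]
    refine Finset.sum_congr rfl fun k _ => ?_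
    rw [Algebra.smul_def]
    rfl
  obtain ⟨k₀, hk₀, hk₀t⟩ : ∃ k ∈ p.support, Finsupp.weight w k ≤ t := by
    by_contra! h
    refine hbt ?_
    rw [← sub_add_cancel b (MvPolynomial.aeval z p)]
    refine Ideal.add_mem _ (hN hp) ?_
    rw [hsum]
    exact Ideal.sum_mem _ fun k hk => smul_mem_ideal _ _ (mon_mem_weightIdeal (h k hk))
  obtain ⟨k, hk, hmin⟩ := p.support.exists_min_image (Finsupp.weight w) ⟨k₀, hk₀⟩
  refine ⟨k, p.coeff k, MvPolynomial.mem_support_iff.mp hk, ?_⟩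
  classical
  have h1 : b - p.coeff k • mon z k =
      (b - MvPolynomial.aeval z p) + ∑ l ∈ p.support.erase k, p.coeff l • mon z l := by
    rw [hsum, ← Finset.add_sum_erase _ _ hk]
    ring
  rw [h1]
  refine Ideal.add_mem _ (weightIdeal_anti ((hmin k₀ hk₀).trans hk₀t) (hN hp))
    (Ideal.sum_mem _ fun l hl => smul_mem_ideal _ _ (mon_mem_weightIdeal ?_))
  refine lt_of_le_of_ne (hmin l (Finset.mem_of_mem_erase hl)) fun h => ?_
  exact Finset.ne_of_mem_erase hl (weight_injective hwi h).symm

end Local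

section Unique

variable {R : Type u} [CommRing R] [IsLocalRing R] [IsNoetherianRing R] [Algebra K R]
  {σ : Type} [Fintype σ] {z : σ → R} {w : σ → ℝ}

/-- A heavier monomial exceeds k in some exponent, so the weight ideal lies in the ideal of the z i
^ (k i + 1), to which `prod_pow_notMem` applies. -/
lemma mon_notMem_weightIdeal (hz : IsRegularSystem z) (hw : ∀ i, 0 < w i) (k : σ →₀ ℕ) :
    mon z k ∉ weightIdeal w z (Finsupp.weight w k) := by
  intro h
  have h1 := hz.prod_pow_notMem k
  rw [mon, Finsupp.prod_fintype k (fun i n => z i ^ n) fun _ => pow_zero _] at h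
  refine h1 (Ideal.span_le.mpr ?_ h)
  rintro _ ⟨l, hl, rfl⟩
  obtain ⟨i, hi⟩ := exists_lt_of_weight_lt hw hl
  exact Ideal.mem_of_dvd _ (pow_dvd_mon l i hi) (Ideal.subset_span ⟨i, rfl⟩)

lemma smul_mon_notMem (hz : IsRegularSystem z) (hw : ∀ i, 0 < w i) (k : σ →₀ ℕ) {c : K}
    (hc : c ≠ 0) : c • mon z k ∉ weightIdeal w z (Finsupp.weight w k) := by
  intro h
  have := smul_mem_ideal (K := K) _ c⁻¹ h
  rw [smul_smul, inv_mul_cancel₀ hc, one_smul] at this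
  exact mon_notMem_weightIdeal hz hw k this

lemma Lead.unique (hz : IsRegularSystem z) (hw : ∀ i, 0 < w i) (hwi : LinearIndependent ℚ w) {b : R}
    {k l : σ →₀ ℕ} (hk : Lead K w z b k) (hl : Lead K w z b l) : k = l := by
  have key : ∀ {k l : σ →₀ ℕ}, Lead K w z b k → Lead K w z b l →
      ¬ Finsupp.weight w k < Finsupp.weight w l := by
    rintro k l ⟨c, hc0, hc⟩ hl h
    refine smul_mon_notMem hz hw k hc0 ?_
    have h1 : b ∈ weightIdeal w z (Finsupp.weight w k) := by
      refine Ideal.span_mono (Set.image_mono fun m hm => ?_) hl.mem_ge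
      exact lt_of_lt_of_le h hm
    have := Ideal.sub_mem _ h1 hc
    rwa [sub_sub_cancel] at this
  exact weight_injective hwi (le_antisymm (not_lt.mp (key hl hk)) (not_lt.mp (key hk hl)))

/-- An eigenvector for an endomorphism which is diagonal on the parameters has the eigenvalue of
its leading monomial. -/
lemma Lead.eigenvalue_eq (hz : IsRegularSystem z) (hw : ∀ i, 0 < w i) {b : R}
    {k : σ →₀ ℕ} (hk : Lead K w z b k) (τ : R →ₐ[K] R) (χ : σ → K) (hτ : ∀ i, τ (z i) = χ i • z i)
    {c : K} (hc : τ b = c • b) : c = ∏ i, χ i ^ k i := by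
  obtain ⟨d, hd0, hd⟩ := hk
  have h1 := map_mem_weightIdeal (w := w) (z := z) (v := w) (τ : R →+* R) (fun j => by
    change τ (z j) ∈ _
    rw [hτ]
    have := mon_mem_weightIdealGe (w := w) (z := z) (Finsupp.single j 1)
    rw [mon_single, Finsupp.weight_single, one_smul] at this
    exact smul_mem_ideal _ _ this) hd
  have h2 : τ (mon z k) = (∏ i, χ i ^ k i) • mon z k := by
    rw [map_mon, mon, mon, Finsupp.prod_fintype k (fun i n => z i ^ n) fun _ => pow_zero _,
      Finsupp.prod_fintype k (fun i n => τ (z i) ^ n) fun _ => pow_zero _, Algebra.smul_def,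
      map_prod, ← Finset.prod_mul_distrib]
    refine Finset.prod_congr rfl fun i _ => ?_
    rw [hτ, Algebra.smul_def, mul_pow, map_pow]
  -- Applying τ to the remainder of b and subtracting c times that remainder removes b and leaves
  -- only a multiple of the leading monomial.
  have h3 : (c * d - d * ∏ i, χ i ^ k i) • mon z k ∈ weightIdeal w z (Finsupp.weight w k) := by
    have h4 := Ideal.sub_mem _ h1 (smul_mem_ideal (K := K) _ c hd)
    have h5 : (τ : R →+* R) (b - d • mon z k) - c • (b - d • mon z k) =
        (c * d - d * ∏ i, χ i ^ k i) • mon z k := by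
      change τ (b - d • mon z k) - _ = _
      rw [map_sub, map_smul, h2, hc, smul_sub, smul_smul, smul_smul, sub_smul]
      abel
    rwa [h5] at h4
  by_contra hne
  refine smul_mon_notMem hz hw k ?_ h3
  rw [mul_comm c d, ← mul_sub]
  exact mul_ne_zero hd0 (sub_ne_zero.mpr hne)

end Unique

section Map

variable {A R : Type*} [CommRing A] [IsLocalRing A] [IsNoetherianRing A] [Algebra K A]
  [CommRing R] [Algebra K R] {σ τ : Type*} [Fintype σ] [Fintype τ]
  {z : σ → R} {w : σ → ℝ} {a : τ → A}

/-- If the images of a system of generators of the maximal ideal have independent leading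
exponents, then the leading exponents of images are combinations of these. -/
lemma exists_lead_map (hres : ∀ r : A, ∃ c : K, r - algebraMap K A c ∈ maximalIdeal A)
    (hspan : Ideal.span (Set.range a) = maximalIdeal A) (hw : ∀ i, 0 < w i) (φ : A →ₐ[K] R)
    {q : τ → σ →₀ ℕ} (hq : ∀ j, Lead K w z (φ (a j)) (q j)) (hq0 : ∀ j, q j ≠ 0)
    (hqi : LinearIndependent ℚ fun j => Finsupp.weight w (q j)) {b : A} (hb : b ≠ 0) :
    ∃ k : τ →₀ ℕ, Lead K w z (φ b) (k.sum fun j n => n • q j) := by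
  have hpos (j : τ) : 0 < Finsupp.weight w (q j) := by
    obtain ⟨i, hi⟩ := Finsupp.ne_iff.mp (hq0 j)
    rw [weight_eq_sum]
    refine Finset.sum_pos' (fun i _ => mul_nonneg (Nat.cast_nonneg _) (hw i).le)
      ⟨i, Finset.mem_univ _, mul_pos ?_ (hw i)⟩
    exact_mod_cast Nat.pos_of_ne_zero hi
  -- The generators of the source get the weights of the leading exponents of their images; with
  -- these weights the map does not lower weights and preserves the leading term.
  obtain ⟨k, c, hc0, hc⟩ := exists_lead hres hspan hpos hqi hb
  have h1 := map_mem_weightIdeal (w := w) (z := z) (φ : A →+* R) (fun j => (hq j).mem_ge) hc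
  obtain ⟨d, hd0, hd⟩ := lead_mon_of hq k
  have hwt : Finsupp.weight w (k.sum fun j n => n • q j) =
      Finsupp.weight (fun j => Finsupp.weight w (q j)) k := by
    rw [Finsupp.weight_apply _ k, map_finsuppSum]
    simp only [map_nsmul]
  refine ⟨k, c * d, mul_ne_zero hc0 hd0, ?_⟩
  have h2 : φ b - (c * d) • mon z (k.sum fun j n => n • q j) =
      (φ : A →+* R) (b - c • mon a k) +
        c • (mon (fun j => φ (a j)) k - d • mon z (k.sum fun j n => n • q j)) := by
    change _ = φ (b - c • mon a k) + _
    rw [map_sub, map_smul, map_mon, smul_sub, smul_smul]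
    abel
  rw [h2]
  refine Ideal.add_mem _ ?_ (smul_mem_ideal _ _ hd)
  rw [hwt]
  exact h1

end Map

end Lead

/-! ### Wedges and integral combinations of characters. -/

section CharacterLattice

section Lattice

variable {A : Type*} [AddCommGroup A] {r : ℕ}

/-- Pulled back along the map from ℤ^r given by β, the wedge is an alternating form in r variables,
hence a multiple of the determinant fixed by its value on the standard basis. -/
lemma wedge_eq_det_smul {α β : Fin r → A} {M : Matrix (Fin r) (Fin r) ℤ}
    (h : ∀ j, α j = ∑ l, M j l • β l) :
    exteriorPower.ιMulti ℤ r α = M.det • exteriorPower.ιMulti ℤ r β := by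
  let f : (Fin r → ℤ) →ₗ[ℤ] A := Fintype.linearCombination ℤ β
  let ω := (exteriorPower.ιMulti ℤ r (M := A)).compLinearMap f
  let e := Pi.basisFun ℤ (Fin r)
  have h1 : ω = (LinearMap.toSpanSingleton ℤ _ (ω e)).compAlternatingMap e.det := by
    refine e.ext_alternating fun v hv => ?_
    let s : Equiv.Perm (Fin r) := Equiv.ofBijective v (Finite.injective_iff_bijective.mp hv)
    change ω (e ∘ s) = _
    have h2 : ((LinearMap.toSpanSingleton ℤ _ (ω e)).compAlternatingMap e.det) (e ∘ s) =
        Equiv.Perm.sign s • ω e := by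
      rw [AlternatingMap.map_perm]
      change _ • (e.det e • ω e) = _
      rw [Module.Basis.det_self, one_smul]
    exact (AlternatingMap.map_perm _ _ _).trans h2.symm
  have hα : exteriorPower.ιMulti ℤ r α = ω M := by
    change _ = exteriorPower.ιMulti ℤ r fun j => f (M j)
    congr 1
    funext j
    rw [h]
    exact (Fintype.linearCombination_apply ℤ β (M j)).symm
  have hβ : exteriorPower.ιMulti ℤ r β = ω e := by
    change _ = exteriorPower.ιMulti ℤ r fun j => f (e j)
    congr 1
    funext j
    rw [Pi.basisFun_apply, Fintype.linearCombination_apply_single, one_smul]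
  have h3 : ω M = M.det • ω e := by
    conv_lhs => rw [h1]
    exact congrArg (· • ω e) (Pi.basisFun_det_apply M)
  rw [hα, hβ, h3]

/-- The row lattice of a singular matrix is free of rank less than r, and the image of a basis of it
serves as generating family. -/
lemma exists_generators_of_det_eq_zero {α β : Fin r → A} {M : Matrix (Fin r) (Fin r) ℤ}
    (h : ∀ j, α j = ∑ l, M j l • β l) (hdet : M.det = 0) :
    ∃ (n : ℕ) (g : Fin n → A), n < r ∧ ∀ j, α j ∈ AddSubgroup.closure (Set.range g) := by
  obtain ⟨v, hv0, hv⟩ := Matrix.exists_vecMul_eq_zero_iff.mpr hdet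
  let f : (Fin r → ℤ) →ₗ[ℤ] A := Fintype.linearCombination ℤ β
  let L := LinearMap.range M.vecMulLinear
  have hker : LinearMap.ker M.vecMulLinear ≠ ⊥ := fun hb =>
    hv0 ((Submodule.mem_bot ℤ).mp (hb ▸ LinearMap.mem_ker.mpr hv))
  have hLr : Module.finrank ℤ L < r := by
    have h1 := LinearMap.rank_range_add_rank_ker M.vecMulLinear
    rw [← Module.finrank_eq_rank, ← Module.finrank_eq_rank, ← Module.finrank_eq_rank,
      Module.finrank_fin_fun] at h1
    have h2 : 0 < Module.finrank ℤ (LinearMap.ker M.vecMulLinear) := by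
      have : Nontrivial (LinearMap.ker M.vecMulLinear) := Submodule.nontrivial_iff_ne_bot.mpr hker
      exact Module.finrank_pos
    have h3 : Module.finrank ℤ L + Module.finrank ℤ (LinearMap.ker M.vecMulLinear) = r := by
      exact_mod_cast h1
    omega
  let b := Module.finBasis ℤ L
  refine ⟨_, fun i => f (b i), hLr, fun j => ?_⟩
  have h1 : α j = f (Matrix.vecMul (Pi.single j 1) M) := by
    rw [h, Matrix.single_one_vecMul]
    exact (Fintype.linearCombination_apply ℤ β (M j)).symm
  have hmem (x : L) : f x ∈ AddSubgroup.closure (Set.range fun i => f (b i)) := by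
    rw [← b.sum_repr x]
    simp only [Submodule.coe_sum, map_sum, Submodule.coe_smul, map_smul]
    exact sum_mem fun i _ => zsmul_mem (AddSubgroup.subset_closure (Set.mem_range_self i)) _
  rw [h1]
  exact hmem ⟨_, ⟨Pi.single j 1, rfl⟩⟩

end Lattice

variable {H K : Type*} [Field K] {r : ℕ}

/-- A unimodular integral change of characters does not change their wedge up to sign. -/
lemma wedge_eq_of_matrix [Group H] {α β : Fin r → CharGroup H K} {M : Matrix (Fin r) (Fin r) ℤ}
    (hM : IsUnit M.det) (h : ∀ j, α j = ∑ l, M j l • β l) : wedge α = wedge β := by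
  refine Quotient.sound ?_
  change _ = _ ∨ _ = _
  rw [wedge_eq_det_smul h]
  rcases Int.isUnit_iff.mp hM with h4 | h4
  · exact Or.inl (by rw [h4, one_smul])
  · exact Or.inr (by rw [h4, neg_smul, one_smul])

variable [CommGroup H] [Finite H] [IsAlgClosed K] [CharZero K]

omit [IsAlgClosed K] in
lemma neZero_exponent : NeZero ((Monoid.exponent H : ℕ) : K) :=
  ⟨Nat.cast_ne_zero.mpr Monoid.exponent_ne_zero_of_finite⟩

/-- Characters without common kernel generate the dual group. -/
lemma closure_eq_top_of_forall_eq_one {α : Fin r → CharGroup H K}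
    (h : ∀ g : H, (∀ j, (α j).toMul g = 1) → g = 1) :
    Subgroup.closure (Set.range fun j => (α j).toMul) = ⊤ := by
  have := neZero_exponent (H := H) (K := K)
  -- Annihilators give an order-reversing bijection between subgroups of H and of its dual, so a
  -- subgroup of the dual with trivial annihilator is everything.
  let e := CommGroup.subgroupOrderIsoSubgroupMonoidHom H K
  let Φ := Subgroup.closure (Set.range fun j => (α j).toMul)
  have h1 : e.symm (OrderDual.toDual Φ) = ⊥ := by
    rw [eq_bot_iff]
    intro g hg
    rw [CommGroup.mem_subgroupOrderIsoSubgroupMonoidHom_symm_iff] at hg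
    exact Subgroup.mem_bot.mpr (h g fun j => hg _ (Subgroup.subset_closure ⟨j, rfl⟩))
  have h2 : OrderDual.toDual Φ = e ⊥ := by rw [← h1, OrderIso.apply_symm_apply]
  rw [eq_top_iff]
  intro φ _
  have h3 : φ ∈ (e ⊥).ofDual :=
    (CommGroup.mem_subgroupOrderIsoSubgroupMonoidHom_iff (G := H) (M := K) ⊥ φ).mpr fun g hg => by
      rw [Subgroup.mem_bot.mp hg, map_one]
  rw [← h2] at h3
  exact h3

/-- If `r = rank H` and `H*` is generated by integral combinations of `r` characters, then the
matrix of these combinations is non-singular. -/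
lemma det_ne_zero_of_closure_eq_top {α β : Fin r → CharGroup H K} {M : Matrix (Fin r) (Fin r) ℤ}
    (h : ∀ j, α j = ∑ l, M j l • β l)
    (hα : Subgroup.closure (Set.range fun j => (α j).toMul) = ⊤) (hr : Group.rank H = r) :
    M.det ≠ 0 := by
  intro hdet
  have := neZero_exponent (H := H) (K := K)
  obtain ⟨n, g, hn, hg⟩ := exists_generators_of_det_eq_zero (A := CharGroup H K) h hdet
  have htop : Subgroup.closure (Set.range fun i => (g i).toMul) = ⊤ := by
    rw [eq_top_iff, ← hα, Subgroup.closure_le]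
    rintro _ ⟨j, rfl⟩
    have h1 : AddSubgroup.closure (Set.range g) ≤
        (Subgroup.closure (Set.range fun i => (g i).toMul)).toAddSubgroup := by
      rw [AddSubgroup.closure_le]
      rintro _ ⟨i, rfl⟩
      have h2 : (g i).toMul ∈ Subgroup.closure (Set.range fun i => (g i).toMul) :=
        Subgroup.subset_closure (Set.mem_range_self i)
      exact h2
    exact h1 (hg j)
  -- H and its dual are isomorphic, so the dual also has rank r and fewer than r characters cannot
  -- generate it.
  obtain ⟨e⟩ := CommGroup.monoidHom_mulEquiv_of_hasEnoughRootsOfUnity H K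
  have h5 : Group.rank (H →* Kˣ) = r := by rw [Group.rank_congr e, hr]
  classical
  have h6 := Group.rank_le (S := Finset.univ.image fun i => (g i).toMul) (by
    rw [Finset.coe_image, Finset.coe_univ, Set.image_univ, htop])
  have h7 := Finset.card_image_le (s := Finset.univ) (f := fun i => (g i).toMul)
  rw [Finset.card_univ, Fintype.card_fin] at h7
  omega

end CharacterLattice

/-- The reals have infinite rank over ℚ, and changing signs preserves independence. -/
lemma exists_linearIndependent_real (σ : Type*) [Finite σ] :
    ∃ w : σ → ℝ, (∀ i, 0 < w i) ∧ LinearIndependent ℚ w := by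
  obtain ⟨n, ⟨e⟩⟩ := Finite.exists_equiv_fin σ
  obtain ⟨v, hv⟩ : ∃ v : Fin n → ℝ, LinearIndependent ℚ v := by
    have h1 : (n : Cardinal) < Module.rank ℚ ℝ := by
      rw [Real.rank_rat_real]
      exact Cardinal.nat_lt_continuum n
    obtain ⟨s, hs, hsi⟩ := Module.exists_set_linearIndependent_of_lt_rank h1
    obtain ⟨e'⟩ := Cardinal.eq.mp (hs.trans (Cardinal.mk_fin n).symm)
    exact ⟨_, hsi.comp e'.symm e'.symm.injective⟩
  refine ⟨fun i => |v (e i)|, fun i => abs_pos.mpr (hv.ne_zero _), ?_⟩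
  have h2 : ∀ i, ∃ u : ℚˣ, |v (e i)| = u • v (e i) := by
    intro i
    rcases abs_choice (v (e i)) with h | h
    · exact ⟨1, by rw [h, one_smul]⟩
    · exact ⟨-1, by rw [h, Units.neg_smul, one_smul]⟩
  choose u hu using h2
  have h3 := (hv.comp e e.injective).units_smul u
  convert h3 using 1
  funext i
  exact hu i

/-! ### Unimodularity of the exponent matrix of a birational local homomorphism. -/

section MainAlgebra

open IsLocalRing

variable {K : Type u} [Field K] {A B : Type u} [CommRing A] [CommRing B] [IsLocalRing A]
  [IsLocalRing B] [IsNoetherianRing A] [IsNoetherianRing B] [Algebra K A] [Algebra K B]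
  {r d : ℕ}

/-- If `b` is not in the ideal of the parameters `z (inr i)`, and these have large weights, the
leading monomial of `b` only involves the other parameters. -/
lemma exists_lead_of_notMem (hres : ∀ b : B, ∃ c : K, b - algebraMap K B c ∈ maximalIdeal B)
    {z : Fin r ⊕ Fin d → B} (hz : IsRegularSystem z) {v : Fin r → ℝ} (hv : ∀ l, 0 < v l)
    (hvi : LinearIndependent ℚ v) {b : B} (hb : b ∉ Ideal.span (z '' Set.range Sum.inr)) :
    ∃ m : Fin r →₀ ℕ, ∀ w : Fin r ⊕ Fin d → ℝ, (∀ l, w (Sum.inl l) = v l) →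
      (∀ i, Finsupp.weight v m < w (Sum.inr i)) →
        Lead K w z b (m.mapDomain Sum.inl) := by
  let T : Set (Fin r ⊕ Fin d) := Set.range Sum.inr
  let I := Ideal.span (z '' T)
  have : IsLocalRing (B ⧸ I) := hz.isLocalRing_quotient T
  have hmap := IsLocalRing.map_maximalIdeal_of_surjective (Ideal.Quotient.mk I)
      Ideal.Quotient.mk_surjective
  have hspan : Ideal.span (Set.range fun l => Ideal.Quotient.mk I (z (Sum.inl l))) =
      maximalIdeal (B ⧸ I) := by
    rw [← hmap, ← hz.span_range, Ideal.map_span]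
    refine le_antisymm (Ideal.span_mono ?_) (Ideal.span_le.mpr ?_)
    · rintro _ ⟨l, rfl⟩
      exact ⟨z (Sum.inl l), ⟨_, rfl⟩, rfl⟩
    · rintro _ ⟨_, ⟨l | i, rfl⟩, rfl⟩
      · exact Ideal.subset_span ⟨l, rfl⟩
      · rw [Ideal.Quotient.eq_zero_iff_mem.mpr
          (Ideal.subset_span (Set.mem_image_of_mem z (Set.mem_range_self i)))]
        exact Ideal.zero_mem _
  have hres' (b : B ⧸ I) : ∃ c : K, b - algebraMap K (B ⧸ I) c ∈ maximalIdeal (B ⧸ I) := by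
    obtain ⟨b, rfl⟩ := Ideal.Quotient.mk_surjective b
    obtain ⟨c, hc⟩ := hres b
    exact ⟨c, hmap ▸ Ideal.mem_map_of_mem (Ideal.Quotient.mk I) hc⟩
  have hb0 : Ideal.Quotient.mk I b ≠ 0 := fun h => hb (Ideal.Quotient.eq_zero_iff_mem.mp h)
  -- The exponent m is found in B/I, so it depends on v alone; the weights of the other parameters
  -- can be chosen afterwards.
  obtain ⟨m, c, hc0, hc⟩ := exists_lead hres' hspan hv hvi hb0
  refine ⟨m, fun w hwl hwr => ⟨c, hc0, ?_⟩⟩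
  have hwt (k : Fin r →₀ ℕ) : Finsupp.weight w (k.mapDomain Sum.inl) = Finsupp.weight v k := by
    rw [Finsupp.weight_apply, Finsupp.weight_apply,
      Finsupp.sum_mapDomain_index (h := fun i c => c • w i) (fun _ => zero_smul _ _) (fun _ _ _ => add_smul _ _ _)]
    simp only [hwl]
  have hmon (k : Fin r →₀ ℕ) : Ideal.Quotient.mk I (mon z (k.mapDomain Sum.inl)) =
      mon (fun l => Ideal.Quotient.mk I (z (Sum.inl l))) k := by
    rw [map_mon, mon, mon, Finsupp.prod_mapDomain_index
        (h := fun i n => Ideal.Quotient.mk I (z i) ^ n) (fun _ => pow_zero _)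
      (fun _ _ _ => pow_add _ _ _)]
  -- The generators of I are heavier than m, so they lie in the weight ideal and membership can be
  -- tested modulo I.
  have hcomap : (weightIdeal v (fun l => Ideal.Quotient.mk I (z (Sum.inl l)))
      (Finsupp.weight v m)).comap (Ideal.Quotient.mk I) ≤
        weightIdeal w z (Finsupp.weight v m) := by
    have h1 : weightIdeal v (fun l => Ideal.Quotient.mk I (z (Sum.inl l))) (Finsupp.weight v m) ≤
        (weightIdeal w z (Finsupp.weight v m)).map (Ideal.Quotient.mk I) := by
      refine Ideal.span_le.mpr ?_
      rintro _ ⟨k, hk, rfl⟩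
      rw [← hmon]
      refine Ideal.mem_map_of_mem _ (mon_mem_weightIdeal ?_)
      rw [hwt]
      exact hk
    refine (Ideal.comap_mono h1).trans ?_
    rw [Ideal.comap_map_of_surjective' _ Ideal.Quotient.mk_surjective, Ideal.mk_ker,
      sup_le_iff]
    refine ⟨le_rfl, Ideal.span_le.mpr ?_⟩
    rintro _ ⟨_, ⟨i, rfl⟩, rfl⟩
    rw [← mon_single z]
    refine mon_mem_weightIdeal ?_
    rw [Finsupp.weight_single, one_smul]
    exact hwr i
  rw [hwt]
  refine hcomap (Ideal.mem_comap.mpr ?_)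
  have h2 : Ideal.Quotient.mk I (b - c • mon z (m.mapDomain Sum.inl)) =
      Ideal.Quotient.mk I b - c • mon (fun l => Ideal.Quotient.mk I (z (Sum.inl l))) m := by
    rw [map_sub, ← hmon]
    rfl
  rw [h2]
  exact hc

/-- Existence of independent weights with large values on the second block. -/
lemma exists_weights (r d : ℕ) : ∃ v : Fin r → ℝ, (∀ l, 0 < v l) ∧ LinearIndependent ℚ v ∧
    ∀ N : ℝ, ∃ w : Fin r ⊕ Fin d → ℝ, (∀ i, 0 < w i) ∧ LinearIndependent ℚ w ∧
      (∀ l, w (Sum.inl l) = v l) ∧ ∀ i, N < w (Sum.inr i) := by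
  obtain ⟨w, hw, hwi⟩ := exists_linearIndependent_real (Fin r ⊕ Fin d)
  refine ⟨w ∘ Sum.inl, fun l => hw _, hwi.comp _ Sum.inl_injective, fun N => ?_⟩
  -- Multiplying the second block of an independent family by a large positive integer keeps it
  -- independent over ℚ.
  obtain ⟨n, hn⟩ : ∃ n : ℕ, 0 < n ∧ ∀ i, N < n * w (Sum.inr i) := by
    have h1 : ∀ i : Fin d, ∀ᶠ n : ℕ in Filter.atTop, N < n * w (Sum.inr i) := fun i =>
      (tendsto_natCast_atTop_atTop.atTop_mul_const (hw (Sum.inr i))).eventually_gt_atTop N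
    exact ((Filter.eventually_gt_atTop 0).and (Filter.eventually_all.mpr h1)).exists
  have hu : (n : ℚ) ≠ 0 := Nat.cast_ne_zero.mpr hn.1.ne'
  let u : Fin r ⊕ Fin d → ℚˣ := Sum.elim (fun _ => 1) fun _ => Units.mk0 (n : ℚ) hu
  have hinl (l : Fin r) : (u • w) (Sum.inl l) = w (Sum.inl l) := one_smul ℚˣ (w (Sum.inl l))
  have hinr (i : Fin d) : (u • w) (Sum.inr i) = n * w (Sum.inr i) := by
    change ((n : ℚ) : ℚ) • w (Sum.inr i) = _
    rw [Rat.smul_def, Rat.cast_natCast]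
  refine ⟨u • w, ?_, hwi.units_smul u, hinl, fun i => ?_⟩
  · rintro (l | i)
    · rw [hinl]; exact hw _
    · rw [hinr]; exact mul_pos (Nat.cast_pos.mpr hn.1) (hw _)
  · rw [hinr]
    exact hn.2 i

variable {H : Type*} [Group H] [IsMulCommutative H] [Finite H] [IsAlgClosed K] [CharZero K]

/-- The comparison of the characters of two systems of parameters adapted to an orbit: a
birational local homomorphism changes them by a unimodular matrix. -/
theorem wedge_eq_of_birational
    (hresA : ∀ a : A, ∃ c : K, a - algebraMap K A c ∈ maximalIdeal A)
    (hresB : ∀ b : B, ∃ c : K, b - algebraMap K B c ∈ maximalIdeal B)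
    (φ : A →ₐ[K] B) (hφ : Function.Injective φ)
    {za : Fin r ⊕ Fin d → A} (hza : IsRegularSystem za)
    {zb : Fin r ⊕ Fin d → B} (hzb : IsRegularSystem zb)
    (hs : ∀ i, φ (za (Sum.inr i)) = zb (Sum.inr i))
    (τA : H → A →ₐ[K] A) (τB : H → B →ₐ[K] B) (hτ : ∀ h a, φ (τA h a) = τB h (φ a))
    {α β : Fin r → CharGroup H K} {δ : Fin d → CharGroup H K}
    (hα : ∀ h j, τA h (za (Sum.inl j)) = ((α j).toMul h : K) • za (Sum.inl j))
    (hβ : ∀ h j, τB h (zb (Sum.inl j)) = ((β j).toMul h : K) • zb (Sum.inl j))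
    (hδ : ∀ h j, τB h (zb (Sum.inr j)) = ((δ j).toMul h : K) • zb (Sum.inr j))
    (hfrac : ∀ b : B, ∃ a q : A, φ q ∉ Ideal.span (zb '' Set.range Sum.inr) ∧ φ q * b = φ a)
    (hfaith : ∀ h : H, (∀ j, (α j).toMul h = 1) → h = 1) (hr : Group.rank H = r) :
    wedge α = wedge β := by
  let : CommGroup H := { (inferInstance : Group H) with mul_comm := mul_comm' }
  have : IsDomain A := hza.isDomain rfl
  have : IsDomain B := hzb.isDomain rfl
  let T : Set (Fin r ⊕ Fin d) := Set.range Sum.inr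
  have hmapspan : (Ideal.span (za '' T)).map φ ≤ Ideal.span (zb '' T) := by
    rw [Ideal.map_span, Ideal.span_le]
    rintro _ ⟨_, ⟨_, ⟨i, rfl⟩, rfl⟩, rfl⟩
    exact Ideal.subset_span ⟨_, ⟨i, rfl⟩, (hs i).symm⟩
  -- contraction of the ideal of the `s`-parameters
  have hcontr (a : A) (ha : φ a ∈ Ideal.span (zb '' T)) : a ∈ Ideal.span (za '' T) := by
    -- Each element of the ideal upstairs is a fraction with numerator in the ideal downstairs. This
    -- holds for the generators, and multiplication by an arbitrary coefficient is covered by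
    -- `hfrac`.
    have key : ∀ b ∈ Ideal.span (zb '' T), ∃ a q : A, φ q ∉ Ideal.span (zb '' T) ∧
        φ q * b = φ a ∧ a ∈ Ideal.span (za '' T) := by
      have hprime := hzb.isPrime_span T
      intro b hb
      refine Submodule.span_induction (p := fun b _ => ∃ a q : A, φ q ∉ Ideal.span (zb '' T) ∧
        φ q * b = φ a ∧ a ∈ Ideal.span (za '' T)) ?_ ?_ ?_ ?_ hb
      · rintro _ ⟨_, ⟨i, rfl⟩, rfl⟩
        refine ⟨za (Sum.inr i), 1, ?_, ?_, Ideal.subset_span ⟨_, ⟨i, rfl⟩, rfl⟩⟩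
        · rw [map_one]; exact (Ideal.ne_top_iff_one _).mp hprime.ne_top
        · rw [map_one, one_mul, hs]
      · refine ⟨0, 1, ?_, by rw [mul_zero, map_zero], Ideal.zero_mem _⟩
        rw [map_one]; exact (Ideal.ne_top_iff_one _).mp hprime.ne_top
      · rintro b₁ b₂ - - ⟨a₁, q₁, hq₁, h₁, ha₁⟩ ⟨a₂, q₂, hq₂, h₂, ha₂⟩
        refine ⟨q₂ * a₁ + q₁ * a₂, q₁ * q₂, ?_, ?_, Ideal.add_mem _ (Ideal.mul_mem_left _ _ ha₁)
          (Ideal.mul_mem_left _ _ ha₂)⟩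
        · rw [map_mul]; exact fun h => (hprime.mem_or_mem h).elim hq₁ hq₂
        · simp only [map_mul, map_add]
          linear_combination φ q₂ * h₁ + φ q₁ * h₂
      · rintro c b₁ - ⟨a₁, q₁, hq₁, h₁, ha₁⟩
        obtain ⟨a₂, q₂, hq₂, h₂⟩ := hfrac c
        refine ⟨a₂ * a₁, q₂ * q₁, ?_, ?_, Ideal.mul_mem_left _ _ ha₁⟩
        · rw [map_mul]; exact fun h => (hprime.mem_or_mem h).elim hq₂ hq₁
        · rw [map_mul, map_mul, smul_eq_mul, ← h₁, ← h₂]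
          ring
    obtain ⟨a', q, hq, h1, ha'⟩ := key _ ha
    rw [← map_mul] at h1
    rw [← hφ h1] at ha'
    exact ((hza.isPrime_span T).mem_or_mem ha').resolve_left fun h =>
      hq (hmapspan (Ideal.mem_map_of_mem φ h))
  obtain ⟨v, hv, hvi, hvw⟩ := exists_weights r d
  -- By the contraction just proved, the image of za (inl j) is outside the ideal of the second
  -- block, so its leading monomial involves the first block only.
  have hlead (j : Fin r) := exists_lead_of_notMem (K := K) hresB hzb hv hvi
    (b := φ (za (Sum.inl j))) fun h =>
      hza.notMem_span (T := T) (by rintro ⟨i, hi⟩; exact Sum.inr_ne_inl hi) (hcontr _ h)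
  choose m hm using hlead
  -- The sum of the weights of all leading monomials is a bound that serves every j at once.
  obtain ⟨w, hw, hwi, hwv, hwN⟩ := hvw (∑ j, Finsupp.weight v (m j))
  have hm' (j : Fin r) : Lead K w zb (φ (za (Sum.inl j))) ((m j).mapDomain Sum.inl) := by
    refine hm j w hwv fun i => lt_of_le_of_lt ?_ (hwN i)
    exact Finset.single_le_sum (f := fun j => Finsupp.weight v (m j))
      (fun j _ => weight_nonneg hv (m j)) (Finset.mem_univ j)
  have hinl (k : Fin r →₀ ℕ) (l : Fin r) : (k.mapDomain (Sum.inl : Fin r → Fin r ⊕ Fin d))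
      (Sum.inl l) = k l := Finsupp.mapDomain_apply Sum.inl_injective _ _
  have hinr (k : Fin r →₀ ℕ) (i : Fin d) : (k.mapDomain (Sum.inl : Fin r → Fin r ⊕ Fin d))
      (Sum.inr i) = 0 := Finsupp.mapDomain_of_notMem_range _ _ (by rintro ⟨l, hl⟩; exact Sum.inl_ne_inr hl)
  let M : Matrix (Fin r) (Fin r) ℤ := Matrix.of fun j l => (m j l : ℤ)
  have hαβ (j : Fin r) : α j = ∑ l, M j l • β l := by
    refine Additive.toMul.injective (MonoidHom.ext fun h => Units.ext ?_)
    have h1 := (hm' j).eigenvalue_eq hzb hw (τB h)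
      (Sum.elim (fun l => ((β l).toMul h : K)) fun i => ((δ i).toMul h : K))
      (by rintro (l | i); exacts [hβ h l, hδ h i]) (c := ((α j).toMul h : K))
      (by rw [← hτ, hα, map_smul])
    rw [h1, Fintype.prod_sum_type]
    simp only [hinl, hinr, Sum.elim_inl, Sum.elim_inr, pow_zero, Finset.prod_const_one, mul_one]
    rw [toMul_sum, MonoidHom.finsetProd_apply, Units.coe_prod]
    refine Finset.prod_congr rfl fun l _ => ?_
    change _ = (((β l).toMul h ^ (m j l : ℤ) : Kˣ) : K)
    rw [zpow_natCast, Units.val_pow_eq_pow_val]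
  have hdet : M.det ≠ 0 :=
    det_ne_zero_of_closure_eq_top hαβ (closure_eq_top_of_forall_eq_one hfaith) hr
  refine wedge_eq_of_matrix (M := M) ?_ hαβ
  -- The exponent matrix of the whole system is block diagonal with blocks M and the identity, so
  -- det M ≠ 0 carries the independence of the weights over to its rows.
  let q : Fin r ⊕ Fin d → (Fin r ⊕ Fin d →₀ ℕ) :=
    Sum.elim (fun j => (m j).mapDomain Sum.inl) fun i => Finsupp.single (Sum.inr i) 1
  have hq (j) : Lead K w zb (φ (za j)) (q j) := by
    rcases j with j | i
    · exact hm' j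
    · rw [hs, ← mon_single zb]
      exact lead_mon _
  have hql (k : Fin r ⊕ Fin d →₀ ℕ) (l : Fin r) :
      (k.sum fun j n => n • q j) (Sum.inl l) = ∑ j, k (Sum.inl j) * m j l := by
    rw [Finsupp.sum_fintype k (fun j n => n • q j) fun _ => zero_smul _ _, Finsupp.finsetSum_apply,
      Fintype.sum_sum_type]
    simp [q, hinl]
  have hqi : LinearIndependent ℚ fun j => Finsupp.weight w (q j) := by
    rw [Fintype.linearIndependent_iff]
    intro g hg
    have h1 := Fintype.linearIndependent_iff.mp hwi (fun i => ∑ j, g j * (q j i : ℚ)) (by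
      rw [← hg]
      simp only [weight_eq_sum, Finset.smul_sum, Finset.sum_smul]
      rw [Finset.sum_comm]
      refine Finset.sum_congr rfl fun j _ => Finset.sum_congr rfl fun i _ => ?_
      rw [mul_smul]
      congr 1)
    have h2 (i : Fin d) : g (Sum.inr i) = 0 := by
      have := h1 (Sum.inr i)
      rw [Fintype.sum_sum_type] at this
      simpa [q, hinr, Finsupp.single_apply] using this
    have h3 : Matrix.vecMul (fun j => g (Sum.inl j)) (M.map (Int.cast : ℤ → ℚ)) = 0 := by
      funext l
      have := h1 (Sum.inl l)
      rw [Fintype.sum_sum_type] at this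
      simpa [q, hinl, h2, Matrix.vecMul, dotProduct, M] using this
    have h4 : (M.map (Int.cast : ℤ → ℚ)).det ≠ 0 := by
      have := Int.cast_det (R := ℚ) M
      rw [← this]
      exact Int.cast_ne_zero.mpr hdet
    have h5 := Matrix.eq_zero_of_vecMul_eq_zero h4 h3
    rintro (j | i)
    · exact congrFun h5 j
    · exact h2 i
  have hq0 (j) : q j ≠ 0 := by
    intro h0
    have := hqi.ne_zero j
    simp [h0] at this
  have hleadA {a : A} (ha : a ≠ 0) := exists_lead_map hresA hza.span_range hw φ hq hq0 hqi ha
  -- Write the l-th parameter upstairs as φ a / φ p. The leading exponents of φ a and φ p are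
  -- combinations of the rows of the exponent matrix, and their difference is the l-th unit vector.
  have hN (l : Fin r) : ∃ n : Fin r → ℤ, ∀ l', ∑ j, n j * M j l' = if l = l' then 1 else 0 := by
    obtain ⟨a, p, hp, hpa⟩ := hfrac (zb (Sum.inl l))
    have hp0 : p ≠ 0 := by
      rintro rfl
      exact hp (by rw [map_zero]; exact Ideal.zero_mem _)
    have ha0 : a ≠ 0 := by
      rintro rfl
      rw [map_zero] at hpa
      rcases mul_eq_zero.mp hpa with h | h
      · exact hp (by rw [h]; exact Ideal.zero_mem _)
      · exact hzb.notMem_span (T := ∅) (k := Sum.inl l) (Set.notMem_empty _)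
          (by rw [h]; exact Ideal.zero_mem _)
    obtain ⟨k, hk⟩ := hleadA hp0
    obtain ⟨k', hk'⟩ := hleadA ha0
    have h1 := hk.mul (lead_mon (K := K) (w := w) (z := zb) (Finsupp.single (Sum.inl l) 1))
    rw [mon_single, hpa] at h1
    have h2 := h1.unique hzb hw hwi hk'
    refine ⟨fun j => (k' (Sum.inl j) : ℤ) - k (Sum.inl j), fun l' => ?_⟩
    have h3 := DFunLike.congr_fun h2 (Sum.inl l')
    rw [Finsupp.add_apply, hql, hql, Finsupp.single_apply] at h3
    simp only [Sum.inl.injEq] at h3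
    have h4 := congrArg (Nat.cast : ℕ → ℤ) h3
    push_cast at h4
    simp only [sub_mul, Finset.sum_sub_distrib, M, Matrix.of_apply]
    linarith
  choose N hN using hN
  have hNM : Matrix.of N * M = 1 := by
    ext l l'
    rw [Matrix.mul_apply, Matrix.one_apply]
    exact hN l l'
  exact IsUnit.of_mul_eq_one_right _ (by rw [← Matrix.det_mul, hNM, Matrix.det_one])

end MainAlgebra

/-! ### Local rings as functors of points, and tangent vectors as K[ε]-points. -/

section FunctorOfPoints

variable {K : Type u} [Field K] {X Y Z : Over (Spec (.of K))}
  {R S T : Type u} [CommRing R] [Algebra K R] [CommRing S] [Algebra K S] [CommRing T] [Algebra K T]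

/-- `Spec R` as a scheme over `K`. -/
def specOver (K : Type u) [Field K] (R : Type u) [CommRing R] [Algebra K R] :
    Over (Spec (.of K)) :=
  Over.mk (Spec.map (CommRingCat.ofHom (algebraMap K R)))

/-- The morphism `Spec S ⟶ Spec R` over `K` given by a `K`-algebra homomorphism `R → S`. -/
def specOverMap (φ : R →ₐ[K] S) : specOver K S ⟶ specOver K R :=
  Over.homMk (Spec.map (CommRingCat.ofHom φ.toRingHom)) (by
    change Spec.map _ ≫ Spec.map _ = Spec.map _
    rw [← Spec.map_comp, ← CommRingCat.ofHom_comp]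
    congr 2
    exact φ.comp_algebraMap)

lemma specOverMap_left (φ : R →ₐ[K] S) :
    (specOverMap φ).left = Spec.map (CommRingCat.ofHom φ.toRingHom) := rfl

lemma specOverMap_comp (φ : R →ₐ[K] S) (ψ : S →ₐ[K] T) :
    specOverMap (ψ.comp φ) = specOverMap ψ ≫ specOverMap φ := by
  ext1
  exact Spec.map_comp (CommRingCat.ofHom φ.toRingHom) (CommRingCat.ofHom ψ.toRingHom)

lemma specOverMap_id : specOverMap (AlgHom.id K R) = 𝟙 _ := by
  ext1
  exact Spec.map_id _

lemma specOverMap_injective {φ ψ : R →ₐ[K] S} (h : specOverMap φ = specOverMap ψ) : φ = ψ := by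
  have h1 := congr(($h).left)
  rw [specOverMap_left, specOverMap_left] at h1
  have h2 := Spec.map_injective h1
  ext a
  exact congr(($h2).hom a)

lemma exists_specOverMap (p : specOver K S ⟶ specOver K R) :
    ∃ φ : R →ₐ[K] S, specOverMap φ = p := by
  let q : Spec (.of S) ⟶ Spec (.of R) := p.left
  have hw : q ≫ Spec.map (CommRingCat.ofHom (algebraMap K R)) =
    Spec.map (CommRingCat.ofHom (algebraMap K S)) := Over.w p
  have h1 : CommRingCat.ofHom (algebraMap K R) ≫ Spec.preimage q =
      CommRingCat.ofHom (algebraMap K S) := by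
    apply Spec.map_injective
    rw [Spec.map_comp, Spec.map_preimage, hw]
  refine ⟨{ (Spec.preimage q).hom with commutes' := fun c => congr($(h1).hom c) }, ?_⟩
  ext1
  exact Spec.map_preimage q

/-- The canonical morphism `Spec O_{X,x} ⟶ X`. -/
def fromStalk (x : Point X) : specOver K (LocalRing x) ⟶ X :=
  Over.homMk (X.left.fromSpecStalk (pt x)) (by
    have h : X.hom = X.left.toSpecΓ ≫ Spec.map ((Scheme.ΓSpecIso (.of K)).inv ≫ X.hom.appTop) := by
      rw [Spec.map_comp, ← Scheme.toSpecΓ_naturality_assoc, toSpecΓ_SpecMap_ΓSpecIso_inv,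
        Category.comp_id]
    change X.left.fromSpecStalk (pt x) ≫ X.hom = Spec.map _
    rw [h, Scheme.fromSpecStalk_toSpecΓ_assoc, ← Spec.map_comp]
    rfl)

instance (x : Point X) : Mono (fromStalk x) := by
  have : Mono (fromStalk x).left := inferInstanceAs (Mono (X.left.fromSpecStalk (pt x)))
  exact Over.mono_of_mono_left _

lemma fromStalk_comp {x : Point X} {y : Point Y} (φ : X ⟶ Y) (h : x ≫ φ = y) :
    fromStalk x ≫ φ = specOverMap (pullback φ h) ≫ fromStalk y := by
  ext1
  change X.left.fromSpecStalk (pt x) ≫ φ.left = Spec.map (_ ≫ _) ≫ Y.left.fromSpecStalk (pt y)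
  rw [Spec.map_comp, Category.assoc, Scheme.SpecMap_stalkSpecializes_fromSpecStalk,
    Scheme.SpecMap_stalkMap_fromSpecStalk]

lemma toUnit_specOver_closedPoint [IsLocalRing R] :
    (toUnit (specOver K R)).left (IsLocalRing.closedPoint R) = IsLocalRing.closedPoint K :=
  Subsingleton.elim (α := PrimeSpectrum K) _ _

/-- A morphism from the spectrum of a local ring factors through `Spec O_{X,x} ⟶ X`, where `x` is
the image of the closed point. -/
lemma exists_comp_fromStalk [IsLocalRing R] {x : Point X} (p : specOver K R ⟶ X)
    (h : p.left (IsLocalRing.closedPoint R) = pt x) :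
    ∃ φ : LocalRing x →ₐ[K] R, specOverMap φ ≫ fromStalk x = p := by
  let q : Spec (.of R) ⟶ X.left := p.left
  replace h : q (IsLocalRing.closedPoint R) = pt x := h
  let ψ : X.left.presheaf.stalk (pt x) ⟶ .of R :=
    X.left.presheaf.stalkSpecializes (specializes_of_eq h) ≫ Scheme.stalkClosedPointTo q
  have h1 : Spec.map ψ ≫ X.left.fromSpecStalk (pt x) = q := by
    rw [Spec.map_comp, Category.assoc, Scheme.SpecMap_stalkSpecializes_fromSpecStalk,
      Scheme.Spec_stalkClosedPointTo_fromSpecStalk]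
  have h2 : CommRingCat.ofHom (algebraMap K (LocalRing x)) ≫ ψ =
      CommRingCat.ofHom (algebraMap K R) := by
    apply Spec.map_injective
    refine (Spec.map_comp (CommRingCat.ofHom (algebraMap K (LocalRing x))) ψ).trans ?_
    refine Eq.trans ?_ (Over.w p)
    refine Eq.trans ?_ congr($h1 ≫ X.hom)
    rw [Category.assoc]
    have h3 : X.left.fromSpecStalk (pt x) ≫ X.hom =
      Spec.map (CommRingCat.ofHom (algebraMap K (LocalRing x))) := Over.w (fromStalk x)
    exact congr(Spec.map ψ ≫ $h3).symm
  refine ⟨{ ψ.hom with commutes' := fun c => congr($(h2).hom c) }, ?_⟩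
  ext1
  exact h1

lemma toUnit_comp_closedPoint [IsLocalRing R] (x : Point X) :
    (toUnit (specOver K R) ≫ x).left (IsLocalRing.closedPoint R) = pt x := by
  change x.left ((toUnit (specOver K R)).left (IsLocalRing.closedPoint R)) = _
  rw [toUnit_specOver_closedPoint]
  rfl

/-- Evaluation of germs at a `K`-point. -/
def evalAt (x : Point X) : LocalRing x →ₐ[K] K :=
  (exists_comp_fromStalk _ (toUnit_comp_closedPoint x)).choose

lemma specOverMap_evalAt (x : Point X) :
    specOverMap (evalAt x) ≫ fromStalk x = toUnit (specOver K K) ≫ x :=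
  (exists_comp_fromStalk _ (toUnit_comp_closedPoint x)).choose_spec

lemma specOverMap_const (x : Point X) :
    specOverMap ((Algebra.ofId K R).comp (evalAt x)) ≫ fromStalk x = toUnit (specOver K R) ≫ x := by
  rw [specOverMap_comp, Category.assoc, specOverMap_evalAt, ← Category.assoc]
  congr 1
  exact toUnit_unique _ _

lemma mem_maxIdeal_iff {x : Point X} (φ : LocalRing x →ₐ[K] K) {a : LocalRing x} :
    a ∈ maxIdeal x ↔ φ a = 0 := by
  have h1 : Function.Surjective φ := fun c => ⟨algebraMap K _ c, φ.commutes c⟩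
  have h2 : (RingHom.ker φ).IsMaximal := RingHom.ker_isMaximal_of_surjective _ h1
  have h3 : RingHom.ker φ = maxIdeal x := IsLocalRing.eq_maximalIdeal h2
  rw [← h3]
  rfl

lemma sub_algebraMap_mem {x : Point X} (a : LocalRing x) :
    a - algebraMap K _ (evalAt x a) ∈ maxIdeal x := by
  rw [mem_maxIdeal_iff (evalAt x), map_sub, AlgHom.commutes]
  exact sub_self _

/-- The kernel of such a homomorphism must be the maximal ideal, and it is determined on constants.
-/
lemma eq_evalAt {x : Point X} (φ : LocalRing x →ₐ[K] K) : φ = evalAt x := by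
  ext a
  have h := (mem_maxIdeal_iff φ).mp (sub_algebraMap_mem a)
  rw [map_sub, AlgHom.commutes, sub_eq_zero] at h
  exact h

lemma evalAt_pullback {x : Point X} {y : Point Y} (φ : X ⟶ Y) (h : x ≫ φ = y) (a : LocalRing y) :
    evalAt x (pullback φ h a) = evalAt y a :=
  DFunLike.congr_fun (eq_evalAt ((evalAt x).comp (pullback φ h))) a

/-! ### Tangent vectors and dual numbers -/

/-- The point derivation `O_{X,x} → K` given by a tangent vector. -/
def pointDer {x : Point X} (t : TangentSpaceAt x) : LocalRing x →ₗ[K] K :=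
  t ∘ₗ ((maxIdeal x).toCotangent.restrictScalars K) ∘ₗ
    (LinearMap.codRestrict ((maxIdeal x).restrictScalars K)
      (LinearMap.id - Algebra.linearMap K (LocalRing x) ∘ₗ (evalAt x).toLinearMap)
      sub_algebraMap_mem)

lemma pointDer_apply {x : Point X} (t : TangentSpaceAt x) (a : LocalRing x) :
    pointDer t a = t ((maxIdeal x).toCotangent ⟨_, sub_algebraMap_mem a⟩) := rfl

lemma pointDer_of_mem {x : Point X} (t : TangentSpaceAt x) (m : maxIdeal x) :
    pointDer t m = t ((maxIdeal x).toCotangent m) := by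
  rw [pointDer_apply]
  congr 2
  ext
  simp [(mem_maxIdeal_iff (evalAt x)).mp m.2]

lemma pointDer_algebraMap {x : Point X} (t : TangentSpaceAt x) (c : K) :
    pointDer t (algebraMap K _ c) = 0 := by
  rw [pointDer_apply]
  have : (⟨_, sub_algebraMap_mem (algebraMap K _ c)⟩ : maxIdeal x) = 0 := by ext; simp
  rw [this, map_zero, map_zero]

lemma pointDer_mul_of_mem {x : Point X} (t : TangentSpaceAt x) {a b : LocalRing x}
    (ha : a ∈ maxIdeal x) (hb : b ∈ maxIdeal x) : pointDer t (a * b) = 0 := by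
  rw [pointDer_of_mem t ⟨a * b, Ideal.mul_mem_left _ _ hb⟩]
  have h2 : (maxIdeal x).toCotangent ⟨a * b, Ideal.mul_mem_left _ _ hb⟩ = 0 := by
    rw [Ideal.toCotangent_eq_zero, pow_two]
    exact Ideal.mul_mem_mul ha hb
  rw [h2, map_zero]

lemma pointDer_mul {x : Point X} (t : TangentSpaceAt x) (a b : LocalRing x) :
    pointDer t (a * b) = evalAt x a * pointDer t b + pointDer t a * evalAt x b := by
  have h := pointDer_mul_of_mem t (sub_algebraMap_mem a) (sub_algebraMap_mem b)
  have e : (a - algebraMap K _ (evalAt x a)) * (b - algebraMap K _ (evalAt x b)) =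
      a * b - evalAt x a • b - evalAt x b • a + algebraMap K _ (evalAt x a * evalAt x b) := by
    rw [Algebra.smul_def, Algebra.smul_def, map_mul]
    ring
  rw [e, map_add, map_sub, map_sub, map_smul, map_smul, pointDer_algebraMap, smul_eq_mul,
    smul_eq_mul] at h
  linear_combination h

open DualNumber in
/-- The homomorphism `O_{X,x} → K[ε]` given by a tangent vector. -/
def tangentHom {x : Point X} (t : TangentSpaceAt x) : LocalRing x →ₐ[K] K[ε] :=
  AlgHom.ofLinearMap
    ((TrivSqZeroExt.inlAlgHom K K K).toLinearMap ∘ₗ (evalAt x).toLinearMap +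
      TrivSqZeroExt.inrHom K K ∘ₗ pointDer t)
    (by
      have h := pointDer_algebraMap t 1
      rw [map_one] at h
      simp [h])
    (fun a b => by
      ext
      · simp
      · simp [pointDer_mul, mul_comm])

lemma fst_tangentHom {x : Point X} (t : TangentSpaceAt x) (a : LocalRing x) :
    (tangentHom t a).fst = evalAt x a := by
  simp [tangentHom]

lemma snd_tangentHom {x : Point X} (t : TangentSpaceAt x) (a : LocalRing x) :
    (tangentHom t a).snd = pointDer t a := by
  simp [tangentHom]

open DualNumber in
-- The ε-part of θ kills products of two elements of the maximal ideal, so it descends to the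
-- cotangent space.
lemma exists_tangentHom {x : Point X} (θ : LocalRing x →ₐ[K] K[ε]) :
    ∃ t : TangentSpaceAt x, tangentHom t = θ := by
  have hfst : (TrivSqZeroExt.fstHom K K K).comp θ = evalAt x := eq_evalAt _
  have hfst' (a : LocalRing x) : (θ a).fst = evalAt x a := DFunLike.congr_fun hfst a
  let δ : LocalRing x →ₗ[K] K := TrivSqZeroExt.sndHom K K ∘ₗ θ.toLinearMap
  have hδ (a b : LocalRing x) (ha : a ∈ maxIdeal x) (hb : b ∈ maxIdeal x) : δ (a * b) = 0 := by
    have ha' := (mem_maxIdeal_iff (evalAt x)).mp ha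
    have hb' := (mem_maxIdeal_iff (evalAt x)).mp hb
    simp [δ, hfst', ha', hb']
  let δ' : maxIdeal x →ₗ[K] K := δ ∘ₗ ((maxIdeal x).restrictScalars K).subtype
  have hker : ((maxIdeal x • (⊤ : Submodule (LocalRing x) (maxIdeal x))).restrictScalars K) ≤
      LinearMap.ker δ' := by
    intro m hm
    rw [Submodule.restrictScalars_mem] at hm
    induction hm using Submodule.smul_induction_on' with
    | smul r hr n hn => exact hδ r n hr n.2
    | add a ha b hb h1 h2 => exact Submodule.add_mem _ h1 h2
  let t : TangentSpaceAt x :=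
    Submodule.liftQ ((maxIdeal x • (⊤ : Submodule (LocalRing x) (maxIdeal x))).restrictScalars K)
      δ' hker
  have ht (m : maxIdeal x) : t ((maxIdeal x).toCotangent m) = δ m := rfl
  refine ⟨t, AlgHom.ext fun a => TrivSqZeroExt.ext ?_ ?_⟩
  · rw [fst_tangentHom, hfst']
  · rw [snd_tangentHom, pointDer_apply, ht]
    have h1 : δ (algebraMap K _ (evalAt x a)) = 0 := by
      simp only [δ, LinearMap.comp_apply, AlgHom.toLinearMap_apply, AlgHom.commutes]
      rfl
    rw [map_sub, h1, sub_zero]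
    rfl

lemma pointDer_differential {x : Point X} {y : Point Y} (φ : X ⟶ Y) (h : x ≫ φ = y)
    (t : TangentSpaceAt x) (a : LocalRing y) :
    pointDer (differential φ h t) a = pointDer t (pullback φ h a) := by
  rw [pointDer_apply, differential_apply, pointDer_apply]
  congr 2
  ext
  simp [evalAt_pullback]

lemma tangentHom_differential {x : Point X} {y : Point Y} (φ : X ⟶ Y) (h : x ≫ φ = y)
    (t : TangentSpaceAt x) :
    tangentHom (differential φ h t) = (tangentHom t).comp (pullback φ h) := by
  refine AlgHom.ext fun a => TrivSqZeroExt.ext ?_ ?_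
  · rw [AlgHom.comp_apply, fst_tangentHom, fst_tangentHom, evalAt_pullback]
  · rw [AlgHom.comp_apply, snd_tangentHom, snd_tangentHom, pointDer_differential]

end FunctorOfPoints

/-! ### Functoriality of dual numbers, and derivations as deformations. -/

section DualNumbers

open DualNumber

variable {K : Type u} [Field K]
  {R S T : Type u} [CommRing R] [Algebra K R] [CommRing S] [Algebra K S] [CommRing T] [Algebra K T]

/-- The homomorphism `R[ε] → S[ε]` induced by `R → S`. -/
def dualMap (φ : R →ₐ[K] S) : R[ε] →ₐ[K] S[ε] where
  toFun a := TrivSqZeroExt.inl (φ a.fst) + TrivSqZeroExt.inr (φ a.snd)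
  map_one' := by ext <;> simp
  map_zero' := by ext <;> simp
  map_add' a b := by ext <;> simp
  map_mul' a b := by ext <;> simp
  commutes' c := by
    rw [TrivSqZeroExt.algebraMap_eq_inl', TrivSqZeroExt.algebraMap_eq_inl']
    ext <;> simp

lemma fst_dualMap (φ : R →ₐ[K] S) (a : R[ε]) : (dualMap φ a).fst = φ a.fst := by simp [dualMap]

lemma snd_dualMap (φ : R →ₐ[K] S) (a : R[ε]) : (dualMap φ a).snd = φ a.snd := by simp [dualMap]

lemma dualMap_comp (φ : R →ₐ[K] S) (ψ : S →ₐ[K] T) :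
    dualMap (ψ.comp φ) = (dualMap ψ).comp (dualMap φ) := by
  refine AlgHom.ext fun a => TrivSqZeroExt.ext ?_ ?_ <;> simp [fst_dualMap, snd_dualMap]

lemma dualMap_id : dualMap (AlgHom.id K R) = AlgHom.id K R[ε] := by
  refine AlgHom.ext fun a => TrivSqZeroExt.ext ?_ ?_ <;> simp [fst_dualMap, snd_dualMap]

lemma dualMap_comp_inl (φ : R →ₐ[K] S) :
    (dualMap φ).comp (TrivSqZeroExt.inlAlgHom K R R) = (TrivSqZeroExt.inlAlgHom K S S).comp φ := by
  refine AlgHom.ext fun a => TrivSqZeroExt.ext ?_ ?_ <;> simp [fst_dualMap, snd_dualMap]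

lemma fst_comp_dualMap (φ : R →ₐ[K] S) :
    (TrivSqZeroExt.fstHom K S S).comp (dualMap φ) = φ.comp (TrivSqZeroExt.fstHom K R R) := by
  refine AlgHom.ext fun a => ?_
  simp [fst_dualMap]

lemma fst_comp_inl : (TrivSqZeroExt.fstHom K R R).comp (TrivSqZeroExt.inlAlgHom K R R) =
    AlgHom.id K R := by
  refine AlgHom.ext fun a => ?_
  simp

instance [IsLocalRing R] : IsLocalRing R[ε] :=
  .of_isUnit_or_isUnit_one_sub_self fun a => by
    rw [TrivSqZeroExt.isUnit_iff_isUnit_fst, TrivSqZeroExt.isUnit_iff_isUnit_fst]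
    exact IsLocalRing.isUnit_or_isUnit_one_sub_self a.fst

lemma specOverMap_fst_closedPoint [IsLocalRing R] :
    (specOverMap (TrivSqZeroExt.fstHom K R R)).left (IsLocalRing.closedPoint R) =
      IsLocalRing.closedPoint R[ε] := by
  have : IsLocalHom (TrivSqZeroExt.fstHom K R R).toRingHom :=
    ⟨fun a ha => TrivSqZeroExt.isUnit_iff_isUnit_fst.mpr ha⟩
  exact IsLocalRing.comap_closedPoint (TrivSqZeroExt.fstHom K R R).toRingHom

/-- A deformation over `A[ε]` of the canonical morphism `Spec A ⟶ X`, where `A = O_{X,x}`,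
is a derivation of `A`. -/
lemma exists_derivation {X : Over (Spec (.of K))} {x : Point X}
    (q : specOver K (LocalRing x)[ε] ⟶ X)
    (hq : specOverMap (TrivSqZeroExt.fstHom K _ _) ≫ q = fromStalk x) :
    ∃ (D : Derivation K (LocalRing x) (LocalRing x)) (φ : LocalRing x →ₐ[K] (LocalRing x)[ε]),
      (∀ a, (φ a).fst = a) ∧ (∀ a, (φ a).snd = D a) ∧ specOverMap φ ≫ fromStalk x = q := by
  obtain ⟨φ, hφ⟩ := exists_comp_fromStalk (x := x) q (by
    rw [← specOverMap_fst_closedPoint (K := K)]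
    change (specOverMap (TrivSqZeroExt.fstHom K _ _) ≫ q).left _ = _
    rw [hq]
    exact Scheme.fromSpecStalk_closedPoint)
  have h1 : (TrivSqZeroExt.fstHom K _ _).comp φ = AlgHom.id K _ := by
    apply specOverMap_injective
    rw [← cancel_mono (fromStalk x), specOverMap_comp, Category.assoc, hφ, hq, specOverMap_id,
      Category.id_comp]
  have h2 (a : LocalRing x) : (φ a).fst = a := DFunLike.congr_fun h1 a
  refine ⟨Derivation.mk' (TrivSqZeroExt.sndHom (LocalRing x) (LocalRing x) |>.restrictScalars K
    |>.comp φ.toLinearMap) fun a b => ?_, φ, h2, fun a => rfl, hφ⟩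
  simp [h2, mul_comm]

end DualNumbers

/-! ### Infinitesimal action of the Lie algebra. -/

section Flow

open DualNumber

variable {K : Type u} [Field K] {G : Over (Spec (.of K))} [GrpObj G]
  {X Y : Over (Spec (.of K))} [ModObj G X] [ModObj G Y]
  {R S : Type u} [CommRing R] [Algebra K R] [CommRing S] [Algebra K S]

/-- The orbit map `g ↦ g x`. -/
def orbitMap (G : Over (Spec (.of K))) [GrpObj G] {X : Over (Spec (.of K))} [ModObj G X]
    (x : Point X) : G ⟶ X := 𝟙 G • (toUnit G ≫ x)

lemma comp_orbitMap {T : Over (Spec (.of K))} (p : T ⟶ G) (x : Point X) :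
    p ≫ orbitMap G x = p • (toUnit T ≫ x) := by
  rw [orbitMap, ModObj.comp_smul, Category.comp_id, ← Category.assoc,
    toUnit_unique (p ≫ toUnit G) (toUnit T)]

lemma point_comp_orbitMap (g : Point G) (x : Point X) : g ≫ orbitMap G x = g • x := by
  rw [comp_orbitMap, toUnit_unique (toUnit (𝟙_ (Over (Spec (.of K))))) (𝟙 _), Category.id_comp]

lemma one_comp_orbitMap (x : Point X) : (1 : Point G) ≫ orbitMap G x = x := by
  rw [point_comp_orbitMap, one_smul]

lemma orbitMap_comp (f : X ⟶ Y) [IsModHom G f] (x : Point X) :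
    orbitMap G x ≫ f = orbitMap G (x ≫ f) := by
  rw [orbitMap, IsModHom.map_smul, Category.assoc, orbitMap]

/-- The `R[ε]`-point of `G` given by a tangent vector at the identity. -/
def tangentPoint (R : Type u) [CommRing R] [Algebra K R] (ξ : TangentSpaceAt (1 : Point G)) :
    specOver K R[ε] ⟶ G :=
  specOverMap (dualMap (Algebra.ofId K R)) ≫ specOverMap (tangentHom ξ) ≫ fromStalk _

lemma dualMap_comp_tangentPoint (φ : R →ₐ[K] S) (ξ : TangentSpaceAt (1 : Point G)) :
    specOverMap (dualMap φ) ≫ tangentPoint R ξ = tangentPoint S ξ := by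
  rw [tangentPoint, ← Category.assoc, ← specOverMap_comp, ← dualMap_comp, tangentPoint,
    Subsingleton.elim (φ.comp (Algebra.ofId K R)) (Algebra.ofId K S)]

lemma tangentPoint_self (ξ : TangentSpaceAt (1 : Point G)) :
    tangentPoint K ξ = specOverMap (tangentHom ξ) ≫ fromStalk _ := by
  rw [tangentPoint, Subsingleton.elim (Algebra.ofId K K) (AlgHom.id K K), dualMap_id,
    specOverMap_id, Category.id_comp]

lemma fst_comp_tangentPoint (ξ : TangentSpaceAt (1 : Point G)) :
    specOverMap (TrivSqZeroExt.fstHom K R R) ≫ tangentPoint R ξ = 1 := by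
  have h : (TrivSqZeroExt.fstHom K K K).comp (tangentHom ξ) = evalAt (1 : Point G) :=
    eq_evalAt _
  rw [tangentPoint, ← Category.assoc, ← specOverMap_comp, fst_comp_dualMap, specOverMap_comp,
    Category.assoc, ← Category.assoc (specOverMap (TrivSqZeroExt.fstHom K K K)),
    ← specOverMap_comp, h, specOverMap_evalAt, ← Category.assoc, MonObj.comp_one]

/-- The deformation over `R[ε]` of an `R`-point of `X` in the direction of a tangent vector
of `G` at the identity. -/
def flow (ξ : TangentSpaceAt (1 : Point G)) (p : specOver K R ⟶ X) : specOver K R[ε] ⟶ X :=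
  tangentPoint R ξ • (specOverMap (TrivSqZeroExt.inlAlgHom K R R) ≫ p)

lemma fst_comp_flow (ξ : TangentSpaceAt (1 : Point G)) (p : specOver K R ⟶ X) :
    specOverMap (TrivSqZeroExt.fstHom K R R) ≫ flow ξ p = p := by
  rw [flow, ModObj.comp_smul, fst_comp_tangentPoint, one_smul, ← Category.assoc,
    ← specOverMap_comp, fst_comp_inl, specOverMap_id, Category.id_comp]

lemma dualMap_comp_flow (ξ : TangentSpaceAt (1 : Point G)) (φ : R →ₐ[K] S)
    (p : specOver K R ⟶ X) :
    specOverMap (dualMap φ) ≫ flow ξ p = flow ξ (specOverMap φ ≫ p) := by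
  rw [flow, ModObj.comp_smul, dualMap_comp_tangentPoint, flow, ← Category.assoc,
    ← specOverMap_comp, dualMap_comp_inl, specOverMap_comp, Category.assoc]

/-- This computes the value at x of the derivation induced by ξ: moving the constant point x
infinitesimally gives the image of ξ under the orbit map. -/
lemma flow_const (ξ : TangentSpaceAt (1 : Point G)) (x : Point X) :
    flow ξ (toUnit (specOver K K) ≫ x) =
      specOverMap (tangentHom (differential (orbitMap G x) (one_comp_orbitMap x) ξ)) ≫
        fromStalk x := by
  rw [tangentHom_differential, specOverMap_comp, Category.assoc, ← fromStalk_comp,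
    ← Category.assoc, ← tangentPoint_self, comp_orbitMap, flow, ← Category.assoc,
    toUnit_unique (_ ≫ toUnit (specOver K K)) (toUnit _)]

/-- A tangent vector of `G` at the identity induces a derivation of the local ring at every point
of a `G`-variety. -/
lemma exists_derivation_of_tangent (ξ : TangentSpaceAt (1 : Point G)) (x : Point X) :
    ∃ (D : Derivation K (LocalRing x) (LocalRing x)) (φ : LocalRing x →ₐ[K] (LocalRing x)[ε]),
      (∀ a, (φ a).snd = D a) ∧ specOverMap φ ≫ fromStalk x = flow ξ (fromStalk x) ∧
      ∀ a, evalAt x (D a) =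
        pointDer (differential (orbitMap G x) (one_comp_orbitMap x) ξ) a := by
  obtain ⟨D, φ, h1, h2, h3⟩ := exists_derivation (flow ξ (fromStalk x)) (fst_comp_flow _ _)
  refine ⟨D, φ, h2, h3, fun a => ?_⟩
  -- Specializing the flow of the generic germ to the closed point gives the flow of the constant
  -- point.
  have h4 : (dualMap (evalAt x)).comp φ =
      tangentHom (differential (orbitMap G x) (one_comp_orbitMap x) ξ) := by
    apply specOverMap_injective
    rw [← cancel_mono (fromStalk x), specOverMap_comp, Category.assoc, h3, dualMap_comp_flow,
      specOverMap_evalAt, flow_const]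
  rw [← snd_tangentHom, ← h4, AlgHom.comp_apply, snd_dualMap, h2]

end Flow

/-! ### Closed points are K-points. -/

section ClosedPoints

variable {K : Type u} [Field K] {X Y : Over (Spec (.of K))}

instance [IsVariety X] : LocallyOfFiniteType X.hom := IsVariety.locallyOfFiniteType

instance [IsVariety X] : QuasiCompact X.hom := IsVariety.quasiCompact

instance [IsVariety X] : IsReduced X.left := IsVariety.isReduced

instance [IsVariety X] : IsSeparated X.hom := IsVariety.isSeparated

instance [IsVariety X] : CompactSpace X.left :=
  QuasiCompact.compactSpace_of_compactSpace X.hom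

instance [IsVariety X] : IsNoetherian X.left :=
  { __ := LocallyOfFiniteType.isLocallyNoetherian X.hom
    __ := (inferInstance : CompactSpace X.left) }

lemma jacobsonSpace (X : Over (Spec (.of K))) [LocallyOfFiniteType X.hom] : JacobsonSpace X.left :=
  LocallyOfFiniteType.jacobsonSpace X.hom

lemma point_w (x : Point X) : x.left ≫ X.hom = 𝟙 (Spec (.of K)) := Over.w x

variable [IsAlgClosed K] [LocallyOfFiniteType X.hom]

lemma isClosed_pt (x : Point X) : IsClosed {pt x} :=
  (pointEquivClosedPoint X.hom ⟨x.left, point_w x⟩).2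

lemma exists_point {z : X.left} (hz : IsClosed {z}) : ∃ x : Point X, pt x = z := by
  refine ⟨Over.homMk (pointOfClosedPoint X.hom z hz) (pointOfClosedPoint_comp X.hom z hz), ?_⟩
  exact pointOfClosedPoint_apply X.hom z hz _

lemma pt_injective : Function.Injective (pt : Point X → X.left) := by
  intro x x' h
  ext1
  exact ext_of_apply_closedPoint_eq X.hom (point_w x) (point_w x') h

/-- A nonempty locally closed subset of a scheme locally of finite type contains a `K`-point. -/
lemma exists_point_mem {Z : Set X.left} (hZ : IsLocallyClosed Z) (h : Z.Nonempty) :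
    ∃ x : Point X, pt x ∈ Z := by
  have := jacobsonSpace X
  obtain ⟨z, hz, hzc⟩ := nonempty_inter_closedPoints h hZ
  obtain ⟨x, rfl⟩ := exists_point hzc
  exact ⟨x, hz⟩

end ClosedPoints

/-! ### Injectivity of the differential of an orbit map with finite stabilizer. -/

section OrbitMap

open DualNumber

variable {K : Type u} [Field K] {G : Over (Spec (.of K))} [GrpObj G]
  {X : Over (Spec (.of K))} [ModObj G X]

lemma tangentHom_zero (x : Point X) :
    tangentHom (0 : TangentSpaceAt x) = (Algebra.ofId K K[ε]).comp (evalAt x) := by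
  refine AlgHom.ext fun a => TrivSqZeroExt.ext ?_ ?_
  · rw [fst_tangentHom, AlgHom.comp_apply, Algebra.ofId_apply, TrivSqZeroExt.algebraMap_eq_inl]
    simp
  · rw [snd_tangentHom, AlgHom.comp_apply, Algebra.ofId_apply, TrivSqZeroExt.algebraMap_eq_inl]
    simp [pointDer_apply]

/-- A tangent vector at the identity which is killed by the orbit map of `x` induces a derivation
of `O_{G,1}` which kills the functions pulled back from `O_{X,x}`. -/
lemma exists_derivation_of_differential_eq_zero (x : Point X) (ξ : TangentSpaceAt (1 : Point G))
    (hξ : differential (orbitMap G x) (one_comp_orbitMap x) ξ = 0) :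
    ∃ D : Derivation K (LocalRing (1 : Point G)) (LocalRing (1 : Point G)),
      (∀ a, evalAt _ (D a) = pointDer ξ a) ∧
        ∀ a, D (pullback (orbitMap G x) (one_comp_orbitMap x) a) = 0 := by
  let p : specOver K (LocalRing (1 : Point G))[ε] ⟶ G :=
    specOverMap (TrivSqZeroExt.inlAlgHom K (LocalRing (1 : Point G)) (LocalRing (1 : Point G))) ≫ fromStalk (1 : Point G)
  -- The derivation comes from right translation by the infinitesimal element ξ. Since ξ fixes x to
  -- first order, the orbit map does not see this translation.
  let q : specOver K (LocalRing (1 : Point G))[ε] ⟶ G := p * tangentPoint _ ξ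
  obtain ⟨D, φ, h1, h2, h3⟩ := exists_derivation (x := (1 : Point G)) q (by
    rw [MonObj.comp_mul, fst_comp_tangentPoint, mul_one, ← Category.assoc, ← specOverMap_comp,
      fst_comp_inl, specOverMap_id, Category.id_comp])
  refine ⟨D, fun a => ?_, fun a => ?_⟩
  · have h4 : (dualMap (evalAt (1 : Point G))).comp φ = tangentHom ξ := by
      apply specOverMap_injective
      rw [← cancel_mono (fromStalk (1 : Point G)), specOverMap_comp, Category.assoc, h3, MonObj.comp_mul,
        dualMap_comp_tangentPoint, ← tangentPoint_self, ← Category.assoc, ← specOverMap_comp,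
        dualMap_comp_inl, specOverMap_comp, Category.assoc, specOverMap_evalAt, MonObj.comp_one,
        MonObj.comp_one, one_mul]
    rw [← snd_tangentHom, ← h4, AlgHom.comp_apply, snd_dualMap, h2]
  · have h5 : q ≫ orbitMap G x = p ≫ orbitMap G x := by
      have h6 : tangentPoint (LocalRing (1 : Point G)) ξ • (toUnit (specOver K (LocalRing (1 : Point G))[ε]) ≫ x) = toUnit (specOver K (LocalRing (1 : Point G))[ε]) ≫ x := by
        rw [← comp_orbitMap, tangentPoint, Category.assoc, Category.assoc,
          fromStalk_comp _ (one_comp_orbitMap x), ← Category.assoc (specOverMap (tangentHom ξ)),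
          ← specOverMap_comp, ← tangentHom_differential, hξ, tangentHom_zero, specOverMap_const,
          ← Category.assoc]
        congr 1
        exact toUnit_unique _ _
      rw [comp_orbitMap, mul_smul, h6, comp_orbitMap]
    have h7 : φ.comp (pullback (orbitMap G x) (one_comp_orbitMap x)) =
        (TrivSqZeroExt.inlAlgHom K (LocalRing (1 : Point G)) (LocalRing (1 : Point G))).comp
          (pullback (orbitMap G x) (one_comp_orbitMap x)) := by
      apply specOverMap_injective
      rw [← cancel_mono (fromStalk x), specOverMap_comp, specOverMap_comp, Category.assoc,
        Category.assoc, ← fromStalk_comp, ← Category.assoc, ← Category.assoc, h3, h5]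
    have h8 := congr(TrivSqZeroExt.snd $(DFunLike.congr_fun h7 a))
    rw [AlgHom.comp_apply, h2] at h8
    simpa using h8

lemma orbitMap_left_pt (g : Point G) (x : Point X) : (orbitMap G x).left (pt g) = pt (g • x) :=
  pt_comp (point_comp_orbitMap g x)

lemma fromStalk_left_injective {Y : Over (Spec (.of K))} (y : Point Y) :
    Function.Injective (fromStalk y).left :=
  (Y.left.fromSpecStalk (pt y)).isEmbedding.injective

lemma fromStalk_left_closedPoint {Y : Over (Spec (.of K))} (y : Point Y) :
    (fromStalk y).left (IsLocalRing.closedPoint (LocalRing y)) = pt y :=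
  Scheme.fromSpecStalk_closedPoint

lemma fromStalk_left_specializes {Y : Over (Spec (.of K))} (y : Point Y)
    (P : PrimeSpectrum (LocalRing y)) : (fromStalk y).left P ⤳ pt y := by
  have : (Y.left.fromSpecStalk (pt y)) P ∈ Set.range (Y.left.fromSpecStalk (pt y)) := ⟨P, rfl⟩
  rw [Scheme.range_fromSpecStalk] at this
  exact this

variable [IsAlgClosed K] [IsVariety G] [IsVariety X]

/-- If `Stab(x)` is finite, the fibre of the orbit map through the identity is a finite set
of closed points. -/
lemma isClosed_singleton_of_orbitMap_eq (x : Point X)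
    (hx : Finite (MulAction.stabilizer (Point G) x)) {z : G.left}
    (hz : (orbitMap G x).left z = pt x) : IsClosed {z} := by
  have := jacobsonSpace G
  let Z : Set G.left := (orbitMap G x).left ⁻¹' {pt x}
  have hZ : IsClosed Z := (isClosed_pt x).preimage (orbitMap G x).left.continuous
  have hfin : (Z ∩ closedPoints G.left).Finite := by
    refine ((Set.toFinite (MulAction.stabilizer (Point G) x : Set (Point G))).image pt).subset ?_
    rintro w ⟨hw, hwc⟩
    obtain ⟨g, rfl⟩ := exists_point hwc
    refine ⟨g, ?_, rfl⟩
    apply pt_injective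
    rw [← orbitMap_left_pt]
    exact hw
  -- The closed points of the fibre form a finite, hence closed, set; in a Jacobson space they are
  -- dense in the fibre, so they exhaust it.
  have hcl : IsClosed (Z ∩ closedPoints G.left) := by
    rw [← Set.biUnion_of_singleton (Z ∩ closedPoints G.left)]
    exact hfin.isClosed_biUnion fun w hw => hw.2
  have h := JacobsonSpace.closure_inter_closedPoints_eq_closure hZ.isLocallyClosed
  rw [hcl.closure_eq, hZ.closure_eq] at h
  have hz' : z ∈ Z := hz
  rw [← h] at hz'
  exact hz'.2

/-- A prime of the local ring of G at 1 containing the extended ideal is a point of the fibre over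
x. Such points are closed and this one specializes to 1, so the prime is the maximal ideal. -/
lemma pow_mem_map_maxIdeal (x : Point X) (hx : Finite (MulAction.stabilizer (Point G) x))
    {a : LocalRing (1 : Point G)} (ha : a ∈ maxIdeal (1 : Point G)) :
    a ∈ ((maxIdeal x).map (pullback (orbitMap G x) (one_comp_orbitMap x))).radical := by
  rw [Ideal.radical_eq_sInf, Ideal.mem_sInf]
  rintro P ⟨hP, hPp⟩
  have hcomap : P.comap (pullback (orbitMap G x) (one_comp_orbitMap x)) = maxIdeal x := by
    refine (IsLocalRing.eq_maximalIdeal ?_)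
    have h1 : maxIdeal x ≤ P.comap (pullback (orbitMap G x) (one_comp_orbitMap x)) :=
      Ideal.map_le_iff_le_comap.mp hP
    have h2 := (IsLocalRing.maximalIdeal.isMaximal (LocalRing x)).eq_of_le
      (Ideal.IsPrime.ne_top (Ideal.comap_isPrime _ P)) h1
    rw [← h2]
    exact IsLocalRing.maximalIdeal.isMaximal _
  let P' : PrimeSpectrum (LocalRing (1 : Point G)) := ⟨P, hPp⟩
  have hz : (orbitMap G x).left ((fromStalk (1 : Point G)).left P') = pt x := by
    change (fromStalk (1 : Point G) ≫ orbitMap G x).left P' = _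
    rw [fromStalk_comp _ (one_comp_orbitMap x), ← fromStalk_left_closedPoint x]
    change (fromStalk x).left _ = _
    congr 1
    exact PrimeSpectrum.ext hcomap
  have hc := isClosed_singleton_of_orbitMap_eq x hx hz
  have h3 : pt (1 : Point G) = (fromStalk (1 : Point G)).left P' :=
    ((fromStalk_left_specializes _ P').mem_closed hc rfl)
  rw [← fromStalk_left_closedPoint] at h3
  have h4 := fromStalk_left_injective _ h3
  have h5 : maxIdeal (1 : Point G) = P := congr(PrimeSpectrum.asIdeal $h4)
  exact h5 ▸ ha

/-- In characteristic zero, the differential of an orbit map with finite stabilizer is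
injective. -/
lemma differential_orbitMap_injective [CharZero K] (x : Point X)
    (hx : Finite (MulAction.stabilizer (Point G) x)) :
    Function.Injective (differential (orbitMap G x) (one_comp_orbitMap x)) := by
  rw [injective_iff_map_eq_zero]
  intro ξ hξ
  obtain ⟨D, hD1, hD2⟩ := exists_derivation_of_differential_eq_zero x ξ hξ
  set I := (maxIdeal x).map (pullback (orbitMap G x) (one_comp_orbitMap x)) with hI
  -- D kills the functions pulled back from X, which generate I.
  have hDI : ∀ a ∈ I, D a ∈ I := by
    intro a ha
    refine Submodule.span_induction ?_ ?_ ?_ ?_ ha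
    · rintro _ ⟨b, -, rfl⟩
      have := hD2 b
      exact this.symm ▸ I.zero_mem
    · rw [map_zero]
      exact I.zero_mem
    · intro b c _ _ hb hc
      rw [map_add]
      exact I.add_mem hb hc
    · intro r b hb' hb
      rw [smul_eq_mul, Derivation.leibniz, smul_eq_mul, smul_eq_mul]
      exact I.add_mem (I.mul_mem_left _ hb) (I.mul_mem_right _ hb')
  refine LinearMap.ext fun m => ?_
  obtain ⟨m, rfl⟩ := (maxIdeal (1 : Point G)).toCotangent_surjective m
  by_contra hm
  rw [LinearMap.zero_apply, ← pointDer_of_mem, ← hD1] at hm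
  have hu : IsUnit (D (m : LocalRing (1 : Point G))) := by
    by_contra h
    exact hm ((mem_maxIdeal_iff _).mp ((IsLocalRing.mem_maximalIdeal _).mpr h))
  -- Differentiating m ^ (n + 1) gives (n + 1) m ^ n D m. Here D m is a unit by assumption and n + 1
  -- is one in characteristic zero, so the exponent descends to 0.
  have key : ∀ n : ℕ, (m : LocalRing (1 : Point G)) ^ n ∈ I → (1 : LocalRing (1 : Point G)) ∈ I := by
    intro n
    induction n with
    | zero => intro h; simpa using h
    | succ n ih =>
      intro h
      apply ih
      have h1 := hDI _ h
      rw [Derivation.leibniz_pow, Nat.add_sub_cancel, smul_eq_mul, nsmul_eq_mul, ← mul_assoc] at h1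
      have h2 := (I.mul_unit_mem_iff_mem hu).mp h1
      have h3 : ((n + 1 : ℕ) : LocalRing (1 : Point G)) =
        algebraMap K _ ((n + 1 : ℕ) : K) := (map_natCast _ _).symm
      have h4 : IsUnit ((n + 1 : ℕ) : LocalRing (1 : Point G)) := by
        rw [h3]
        exact (isUnit_iff_ne_zero.mpr (Nat.cast_ne_zero.mpr n.succ_ne_zero)).map _
      exact (I.unit_mul_mem_iff_mem h4).mp h2
  obtain ⟨n, hn⟩ := pow_mem_map_maxIdeal x hx m.2
  have h1 := key n hn
  have h2 : I ≤ maxIdeal (1 : Point G) := Ideal.map_le_iff_le_comap.mpr (maxIdeal_le _ _)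
  exact (Ideal.ne_top_iff_one _).mp (IsLocalRing.maximalIdeal.isMaximal _).ne_top (h2 h1)

end OrbitMap

/-! ### An irreducible open set that locally dominates the image. -/

section Topology

open TopologicalSpace

/-- A continuous map from a Noetherian space restricts to an irreducible open subset in such a way
that, locally on the target, its whole image lies in the closure of the image of this subset. -/
lemma exists_irreducible_open {α β : Type*} [TopologicalSpace α] [TopologicalSpace β]
    [NoetherianSpace α] [Nonempty α] {o : α → β} (ho : Continuous o) :
    ∃ N : Set α, IsOpen N ∧ IsIrreducible N ∧ ∃ U : Set β, IsOpen U ∧ N ⊆ o ⁻¹' U ∧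
      Set.range o ∩ U ⊆ closure (o '' N) := by
  have hfin : (irreducibleComponents α).Finite := NoetherianSpace.finite_irreducibleComponents
  have hne : (irreducibleComponents α).Nonempty :=
    ⟨_, irreducibleComponent_mem_irreducibleComponents (Classical.arbitrary α)⟩
  -- Take a component whose image has maximal closure, then remove the other components and whatever
  -- maps into the closures not contained in this one.
  obtain ⟨Z, hZ, hmax⟩ := hfin.exists_maximalFor (fun Z => closure (o '' Z)) _ hne
  let bad : Set (Set α) := {Z' ∈ irreducibleComponents α | ¬ closure (o '' Z') ⊆ closure (o '' Z)}
  have hbadfin : bad.Finite := hfin.subset fun _ h => h.1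
  let B : Set β := ⋃ Z' ∈ bad, closure (o '' Z')
  have hB : IsClosed B := hbadfin.isClosed_biUnion fun _ _ => isClosed_closure
  let W : Set α := ⋃ Z' ∈ irreducibleComponents α \ {Z}, Z'
  have hW : IsClosed W := (hfin.subset Set.sdiff_subset).isClosed_biUnion
    fun Z' h => isClosed_of_mem_irreducibleComponents Z' h.1
  let N : Set α := Wᶜ ∩ o ⁻¹' Bᶜ
  have hNo : IsOpen N := hW.isOpen_compl.inter (hB.isOpen_compl.preimage ho)
  have hNZ : N ⊆ Z := by
    intro a ha
    obtain ⟨Z', hZ', haZ'⟩ := (Set.mem_sUnion (S := irreducibleComponents α)).mp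
      (sUnion_irreducibleComponents (X := α) ▸ Set.mem_univ a)
    by_cases h : Z' = Z
    · exact h ▸ haZ'
    · exact absurd (Set.mem_iUnion₂.mpr ⟨Z', ⟨hZ', h⟩, haZ'⟩) ha.1
  have hZirr : IsIrreducible Z := hZ.1
  have hNne : N.Nonempty := by
    by_contra hN
    rw [Set.not_nonempty_iff_eq_empty] at hN
    -- If nothing were left, finitely many closed sets would cover the irreducible Z, so one of them
    -- would contain it. Another component contradicts the maximality of Z, the preimage of a bad
    -- closure the maximality of its image.
    let S : Set (Set α) := (irreducibleComponents α \ {Z}) ∪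
      (fun Z' => o ⁻¹' closure (o '' Z')) '' bad
    have hS : S.Finite := (hfin.subset Set.sdiff_subset).union (hbadfin.image _)
    obtain ⟨T, hT, hZT⟩ := isIrreducible_iff_sUnion_isClosed.mp hZirr hS.toFinset (by
      intro T hT
      rw [Set.Finite.mem_toFinset] at hT
      rcases hT with hT | ⟨Z', -, rfl⟩
      · exact isClosed_of_mem_irreducibleComponents T hT.1
      · exact isClosed_closure.preimage ho) (by
      intro a ha
      have haN : a ∉ N := by simp [hN]
      rw [Set.mem_sUnion]
      by_cases haW : a ∈ W
      · obtain ⟨Z', hZ', haZ'⟩ := Set.mem_iUnion₂.mp haW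
        exact ⟨Z', by rw [Set.Finite.coe_toFinset]; exact Or.inl hZ', haZ'⟩
      · have haB : o a ∈ B := by
          by_contra h
          exact haN ⟨haW, h⟩
        obtain ⟨Z', hZ', haZ'⟩ := Set.mem_iUnion₂.mp haB
        exact ⟨_, by rw [Set.Finite.coe_toFinset]; exact Or.inr ⟨Z', hZ', rfl⟩, haZ'⟩)
    rw [Set.Finite.mem_toFinset] at hT
    rcases hT with hT | ⟨Z', hZ', rfl⟩
    · exact hT.2 (Set.Subset.antisymm (hZ.2 hT.1.1 hZT) hZT)
    · have h1 : closure (o '' Z) ⊆ closure (o '' Z') :=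
        closure_minimal (Set.image_subset_iff.mpr hZT) isClosed_closure
      exact hZ'.2 (hmax hZ'.1 h1)
  have hNirr : IsIrreducible N :=
    ⟨hNne, (hZirr.2.open_subset hNo hNZ)⟩
  refine ⟨N, hNo, hNirr, Bᶜ, hB.isOpen_compl, Set.inter_subset_right, ?_⟩
  rintro _ ⟨⟨a, rfl⟩, ha⟩
  obtain ⟨Z', hZ', haZ'⟩ := (Set.mem_sUnion (S := irreducibleComponents α)).mp
    (sUnion_irreducibleComponents (X := α) ▸ Set.mem_univ a)
  have h1 : closure (o '' Z') ⊆ closure (o '' Z) := by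
    by_contra h
    exact ha (Set.mem_biUnion (⟨hZ', h⟩ : Z' ∈ bad) (subset_closure ⟨a, haZ', rfl⟩))
  have h2 : Z ⊆ closure N := subset_closure_inter_of_isPreirreducible_of_isOpen hZirr.2 hNo
    (by rwa [Set.inter_eq_self_of_subset_right hNZ]) |>.trans
      (closure_mono Set.inter_subset_right)
  have h3 : closure (o '' Z) ⊆ closure (o '' N) := closure_minimal
    ((Set.image_mono h2).trans (image_closure_subset_closure_image ho)) isClosed_closure
  exact h3 (h1 (subset_closure ⟨a, haZ', rfl⟩))

end Topology

/-! ### Generic smoothness in characteristic zero. -/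

section GenericSmoothness

open DualNumber

variable {K : Type u} [Field K] [CharZero K] {R S : Type u} [CommRing R] [Algebra K R]
  [CommRing S] [IsDomain S] [Algebra K S]

/-- The fraction field of R is a localization of R, and that of S is a field extension of it in
characteristic zero; both steps are formally smooth. So S is smooth over R at its generic point, and
smoothness is an open condition. -/
lemma exists_smooth_localization_away [Algebra R S] [FaithfulSMul R S] [IsScalarTower K R S]
    [Algebra.FiniteType K R] [Algebra.FiniteType K S] :
    ∃ f : S, f ≠ 0 ∧ Algebra.FormallySmooth R (Localization.Away f) := by
  have : IsNoetherianRing R := Algebra.FiniteType.isNoetherianRing K R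
  have : IsDomain R := (FaithfulSMul.algebraMap_injective R S).isDomain
  have : Algebra.FiniteType R S := .of_restrictScalars_finiteType K R S
  have : Algebra.FinitePresentation R S := Algebra.FinitePresentation.of_finiteType.mp inferInstance
  have hinj := FaithfulSMul.algebraMap_injective R (FractionRing S)
  let : Algebra (FractionRing R) (FractionRing S) := FractionRing.liftAlgebra R (FractionRing S)
  have : IsScalarTower R (FractionRing R) (FractionRing S) :=
    FractionRing.isScalarTower_liftAlgebra R (FractionRing S)
  have : CharZero R := charZero_of_injective_algebraMap (algebraMap K R).injective
  have : Algebra.EssFiniteType R (FractionRing S) := .comp R S (FractionRing S)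
  have : Algebra.EssFiniteType (FractionRing R) (FractionRing S) := .of_comp R _ _
  have h1 : Algebra.FormallySmooth R (FractionRing R) := .of_isLocalization (nonZeroDivisors R)
  have h2 : Algebra.FormallySmooth R (FractionRing S) := .comp R (FractionRing R) _
  have : IsLocalization (⊥ : Ideal S).primeCompl (FractionRing S) := by
    have h : (⊥ : Ideal S).primeCompl = nonZeroDivisors S := by
      ext; simp [Ideal.primeCompl]
    rw [h]
    infer_instance
  have : Algebra.IsSmoothAt R (⊥ : Ideal S) := Algebra.FormallySmooth.of_equiv
    ((IsLocalization.algEquiv (⊥ : Ideal S).primeCompl (FractionRing S)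
      (Localization.AtPrime (⊥ : Ideal S))).restrictScalars R)
  obtain ⟨f, hf, h⟩ := Algebra.IsSmoothAt.exists_notMem_smooth R (⊥ : Ideal S)
  exact ⟨f, hf, h.1⟩

omit [CharZero K] [IsDomain S] in
-- The infinitesimal lifting property applied to K[ε] → K, whose kernel has square zero.
lemma exists_lift_of_formallySmooth [Algebra R S] [IsScalarTower K R S] {f : S}
    [Algebra.FormallySmooth R (Localization.Away f)] (p : S →ₐ[K] K) (hp : p f ≠ 0)
    (θ : R →ₐ[K] K[ε]) (hθ : ∀ a, (θ a).fst = p (algebraMap R S a)) :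
    ∃ ψ : S →ₐ[K] K[ε], (∀ a, ψ (algebraMap R S a) = θ a) ∧ ∀ a, (ψ a).fst = p a := by
  let : Algebra R K[ε] := θ.toAlgebra
  let : Algebra R K := (p.toRingHom.comp (algebraMap R S)).toAlgebra
  let g : K[ε] →ₐ[R] K := { TrivSqZeroExt.fstHom K K K with commutes' := hθ }
  have hu : IsUnit (p.toRingHom f) := isUnit_iff_ne_zero.mpr hp
  let p' : Localization.Away f →ₐ[R] K :=
    { IsLocalization.Away.lift (S := Localization.Away f) f hu with
      commutes' := fun a => by
        rw [IsScalarTower.algebraMap_apply R S (Localization.Away f)]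
        exact IsLocalization.Away.lift_eq f hu _ }
  have hg : Function.Surjective g := fun c => ⟨TrivSqZeroExt.inl c, rfl⟩
  have hg' : IsNilpotent (RingHom.ker (g : K[ε] →+* K)) := by
    refine ⟨2, (pow_two (RingHom.ker (g : K[ε] →+* K))).trans ?_⟩
    rw [Ideal.zero_eq_bot, eq_bot_iff, Ideal.mul_le]
    intro a ha b hb
    have ha' : a.fst = 0 := ha
    have hb' : b.fst = 0 := hb
    rw [Ideal.mem_bot]
    ext <;> simp [ha', hb']
  let ψ := Algebra.FormallySmooth.liftOfSurjective p' g hg hg'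
  have hψ (a : S) : (ψ (algebraMap S _ a)).fst = p a :=
    (Algebra.FormallySmooth.liftOfSurjective_apply p' g hg hg' _).trans
      (IsLocalization.Away.lift_eq f hu a)
  have hψ' (a : R) : ψ (algebraMap S _ (algebraMap R S a)) = θ a := by
    rw [← IsScalarTower.algebraMap_apply R S (Localization.Away f)]
    exact ψ.commutes a
  refine ⟨{ ψ.toRingHom.comp (algebraMap S (Localization.Away f)) with
    commutes' := fun c => ?_ }, hψ', hψ⟩
  have := hψ' (algebraMap K R c)
  rw [AlgHom.commutes, ← IsScalarTower.algebraMap_apply K R S] at this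
  exact this

/-- Generic smoothness: for a homomorphism of finitely generated algebras over a field of
characteristic zero, tangent vectors can be lifted at all points of a nonempty open set. -/
lemma exists_lift_dualNumber [Algebra.FiniteType K R] [Algebra.FiniteType K S] (φ : R →ₐ[K] S) :
    ∃ f : S, f ≠ 0 ∧ ∀ (p : S →ₐ[K] K) (_ : p f ≠ 0) (θ : R →ₐ[K] K[ε])
      (_ : ∀ a, (θ a).fst = p (φ a)) (_ : ∀ a, φ a = 0 → θ a = 0),
      ∃ ψ : S →ₐ[K] K[ε], (∀ a, ψ (φ a) = θ a) ∧ ∀ a, (ψ a).fst = p a := by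
  -- Passing to the image of φ makes the ring extension injective; θ descends to it because it
  -- vanishes on the kernel.
  have : Algebra.FiniteType K φ.range := .of_surjective φ.rangeRestrict φ.rangeRestrict_surjective
  obtain ⟨f, hf, hsm⟩ := exists_smooth_localization_away (K := K) (R := φ.range) (S := S)
  refine ⟨f, hf, fun p hp θ hθ hker => ?_⟩
  let θ' : φ.range →ₐ[K] K[ε] := AlgHom.liftOfSurjective φ.rangeRestrict
    φ.rangeRestrict_surjective θ (by
      intro a ha
      exact hker a congr(Subtype.val $ha))
  have hθ' (a : R) : θ' ⟨φ a, a, rfl⟩ = θ a := AlgHom.liftOfSurjective_apply _ _ _ _ _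
  obtain ⟨ψ, h1, h2⟩ := exists_lift_of_formallySmooth (R := φ.range) (f := f) p hp θ' (by
    rintro ⟨_, a, rfl⟩
    exact (congr(TrivSqZeroExt.fst $(hθ' a))).trans (hθ a))
  exact ⟨ψ, fun a => (h1 ⟨φ a, a, rfl⟩).trans (hθ' a), h2⟩

end GenericSmoothness

/-! ### Affine charts and their germs. -/

section Charts

variable {K : Type u} [Field K] {X Y : Over (Spec (.of K))}

/-- The ring of regular functions on an open subset. -/
def Sec (X : Over (Spec (.of K))) (U : X.left.Opens) : Type u := Γ(X.left, U)

instance (U : X.left.Opens) : CommRing (Sec X U) := inferInstanceAs (CommRing Γ(X.left, U))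

instance (U : X.left.Opens) : Algebra K (Sec X U) :=
  ((X.left.presheaf.map (homOfLE le_top).op).hom.comp (const X)).toAlgebra

lemma le_preimage_top (U : X.left.Opens) : U ≤ X.hom ⁻¹ᵁ ⊤ :=
  le_top.trans X.hom.preimage_top.ge

lemma algebraMap_sec (U : X.left.Opens) :
    CommRingCat.ofHom (algebraMap K (Sec X U)) =
      (Scheme.ΓSpecIso (.of K)).inv ≫ X.hom.appLE ⊤ U (le_preimage_top U) := rfl

/-- Germs of regular functions. -/
def germAlg (x : Point X) (U : X.left.Opens) (hx : pt x ∈ U) : Sec X U →ₐ[K] LocalRing x :=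
  { germ x U hx with
    commutes' := fun c =>
      congr(($(X.left.presheaf.germ_res (homOfLE le_top : U ⟶ ⊤) (pt x) hx)).hom (const X c)) }

lemma mem_basicOpen_iff (x : Point X) (U : X.left.Opens) (hx : pt x ∈ U) (s : Γ(X.left, U)) :
    pt x ∈ X.left.basicOpen s ↔ evalAt x (germ x U hx s) ≠ 0 := by
  rw [Scheme.mem_basicOpen _ _ _ hx, ne_eq, ← mem_maxIdeal_iff, IsLocalRing.mem_maximalIdeal,
    mem_nonunits_iff, not_not]
  rfl

/-- The open immersion `Spec Γ(U) ⟶ X` for an affine open `U`. -/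
def chart {U : X.left.Opens} (hU : IsAffineOpen U) : specOver K (Sec X U) ⟶ X :=
  Over.homMk hU.fromSpec (by
    change hU.fromSpec ≫ X.hom = Spec.map _
    rw [algebraMap_sec, Spec.map_comp,
      ← IsAffineOpen.SpecMap_appLE_fromSpec X.hom (isAffineOpen_top (Spec (.of K))) hU
        (le_preimage_top U),
      IsAffineOpen.fromSpec_top, Scheme.isoSpec_Spec_inv])

instance {U : X.left.Opens} (hU : IsAffineOpen U) : IsOpenImmersion (chart hU).left :=
  hU.isOpenImmersion_fromSpec

instance {U : X.left.Opens} (hU : IsAffineOpen U) : Mono (chart hU) := by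
  have : Mono (chart hU).left := inferInstance
  exact Over.mono_of_mono_left _

lemma range_chart {U : X.left.Opens} (hU : IsAffineOpen U) :
    Set.range (chart hU).left = U := hU.range_fromSpec

lemma germAlg_comp_chart (x : Point X) {U : X.left.Opens} (hU : IsAffineOpen U) (hx : pt x ∈ U) :
    specOverMap (germAlg x U hx) ≫ chart hU = fromStalk x := by
  ext1
  exact hU.fromSpecStalk_eq_fromSpecStalk hx

/-- Pullback of regular functions. -/
def secMap (φ : X ⟶ Y) (V : Y.left.Opens) (U : X.left.Opens) (h : U ≤ φ.left ⁻¹ᵁ V) :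
    Sec Y V →ₐ[K] Sec X U :=
  { (φ.left.appLE V U h).hom with
    commutes' := fun c => by
      have h0 (ψ : X.left ⟶ Spec (.of K)) (hψ : ψ = X.hom) (e : U ≤ ψ ⁻¹ᵁ ⊤) :
          ψ.appLE ⊤ U e = X.hom.appLE ⊤ U (le_preimage_top U) := by
        subst hψ
        rfl
      have h1 : ((Scheme.ΓSpecIso (.of K)).inv ≫ Y.hom.appLE ⊤ V (le_preimage_top V)) ≫
          φ.left.appLE V U h =
            (Scheme.ΓSpecIso (.of K)).inv ≫ X.hom.appLE ⊤ U (le_preimage_top U) := by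
        rw [Category.assoc, Scheme.Hom.appLE_comp_appLE, h0 _ (Over.w φ)]
      exact congr($(h1).hom c) }

lemma secMap_comp_chart (φ : X ⟶ Y) {V : Y.left.Opens} {U : X.left.Opens}
    (hV : IsAffineOpen V) (hU : IsAffineOpen U) (h : U ≤ φ.left ⁻¹ᵁ V) :
    specOverMap (secMap φ V U h) ≫ chart hV = chart hU ≫ φ := by
  ext1
  exact IsAffineOpen.SpecMap_appLE_fromSpec φ.left hV hU h

lemma pullback_germAlg {x : Point X} {y : Point Y} (φ : X ⟶ Y) (hφ : x ≫ φ = y)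
    {V : Y.left.Opens} {U : X.left.Opens} (hV : IsAffineOpen V) (hU : IsAffineOpen U)
    (h : U ≤ φ.left ⁻¹ᵁ V) (hx : pt x ∈ U) (hy : pt y ∈ V) :
    (pullback φ hφ).comp (germAlg y V hy) = (germAlg x U hx).comp (secMap φ V U h) := by
  apply specOverMap_injective
  rw [← cancel_mono (chart hV), specOverMap_comp, Category.assoc, germAlg_comp_chart,
    ← fromStalk_comp, specOverMap_comp, Category.assoc, secMap_comp_chart φ hV hU h,
    ← Category.assoc, germAlg_comp_chart]

/-- A morphism from an affine scheme into an affine open `U` is given by a homomorphism. -/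
lemma exists_comp_chart {R : Type u} [CommRing R] [Algebra K R] {U : X.left.Opens}
    (hU : IsAffineOpen U) (p : specOver K R ⟶ X) (hp : Set.range p.left ⊆ U) :
    ∃ φ : Sec X U →ₐ[K] R, specOverMap φ ≫ chart hU = p := by
  have hp' : Set.range p.left ⊆ Set.range (chart hU).left := by rwa [range_chart]
  let q : specOver K R ⟶ specOver K (Sec X U) :=
    Over.homMk (IsOpenImmersion.lift (chart hU).left p.left hp') (by
      rw [← Over.w (chart hU), IsOpenImmersion.lift_fac_assoc, Over.w p])
  obtain ⟨φ, hφ⟩ := exists_specOverMap q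
  refine ⟨φ, ?_⟩
  rw [hφ]
  ext1
  exact IsOpenImmersion.lift_fac _ _ _

lemma finiteType_sec [LocallyOfFiniteType X.hom] {U : X.left.Opens} (hU : IsAffineOpen U) :
    Algebra.FiniteType K (Sec X U) := by
  have h1 : (X.hom.appLE ⊤ U (le_preimage_top U)).hom.FiniteType :=
    X.hom.finiteType_appLE (isAffineOpen_top (Spec (.of K))) hU _
  have h2 : ((Scheme.ΓSpecIso (.of K)).inv ≫ X.hom.appLE ⊤ U (le_preimage_top U)).hom.FiniteType := by
    rw [CommRingCat.hom_comp]
    exact h1.comp (RingHom.FiniteType.of_surjective _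
      (Scheme.ΓSpecIso (.of K)).symm.commRingCatIsoToRingEquiv.surjective)
  rw [← algebraMap_sec] at h2
  exact h2

lemma germAlg_injective [IsIntegral X.left] (x : Point X) (U : X.left.Opens) (hx : pt x ∈ U) :
    Function.Injective (germAlg x U hx) :=
  germ_injective_of_isIntegral X.left (pt x) hx

end Charts

/-! ### The tangent space of an orbit is the image of the Lie algebra. -/

section OrbitTangent

open DualNumber

variable {K : Type u} [Field K] {G : Over (Spec (.of K))} [GrpObj G]
  {X : Over (Spec (.of K))}

lemma isDomain_sec [IsReduced X.left] {U : X.left.Opens} (hU : IsIrreducible (U : Set X.left)) :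
    IsDomain (Sec X U) := by
  have : IrreducibleSpace U := isIrreducible_iff_irreducibleSpace.mp hU
  have : IrreducibleSpace U.toScheme := this
  have : IsIntegral U.toScheme := isIntegral_of_irreducibleSpace_of_isReduced _
  exact U.topIso.symm.commRingCatIsoToRingEquiv.toMulEquiv.isDomain _

/-- The canonical morphism from the spectrum of the stalk is a monomorphism and factors through the
chart. -/
lemma germAlg_hom_ext {R : Type u} [CommRing R] [Algebra K R] {x : Point X} {U : X.left.Opens}
    (hU : IsAffineOpen U) (hx : pt x ∈ U) {φ ψ : LocalRing x →ₐ[K] R}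
    (h : ∀ a, φ (germAlg x U hx a) = ψ (germAlg x U hx a)) : φ = ψ := by
  apply specOverMap_injective
  rw [← cancel_mono (fromStalk x), ← germAlg_comp_chart x hU hx, ← Category.assoc,
    ← specOverMap_comp, ← Category.assoc, ← specOverMap_comp]
  congr 2
  exact AlgHom.ext h

lemma tangentHom_injective {x : Point X} {t t' : TangentSpaceAt x}
    (h : tangentHom t = tangentHom t') : t = t' := by
  refine LinearMap.ext fun m => ?_
  obtain ⟨m, rfl⟩ := (maxIdeal x).toCotangent_surjective m
  rw [← pointDer_of_mem, ← pointDer_of_mem, ← snd_tangentHom, h, snd_tangentHom]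

lemma exists_affineOpen_mem {V : Set X.left} (hV : IsOpen V) {z : X.left} (hz : z ∈ V) :
    ∃ U : X.left.Opens, IsAffineOpen U ∧ z ∈ U ∧ (U : Set X.left) ⊆ V := by
  obtain ⟨_, ⟨U, hU, rfl⟩, hzU, hUV⟩ := X.left.isBasis_affineOpens.exists_subset_of_mem_open hz hV
  exact ⟨U, hU, hzU, hUV⟩

variable [ModObj G X] [IsAlgClosed K] [CharZero K] [IsVariety G] [IsVariety X]

/-- At some point of `G`, the differential of the orbit map is onto the tangent space of the
orbit. -/
lemma exists_point_forall_exists_differential_eq (x : Point X) :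
    ∃ g : Point G, ∀ t ∈ tangentSubspace (orbitPoints G x) (g • x),
      ∃ ξ : TangentSpaceAt g, differential (orbitMap G x) (point_comp_orbitMap g x) ξ = t := by
  have : Nonempty G.left := ⟨pt (1 : Point G)⟩
  obtain ⟨N, hNo, hN, U, hU, hNU, hcl⟩ :=
    exists_irreducible_open (o := (orbitMap G x).left) (orbitMap G x).left.continuous
  obtain ⟨p, hp⟩ := hN.1
  obtain ⟨V, hV, hpV, hVU⟩ := exists_affineOpen_mem hU (hNU hp)
  obtain ⟨W, hW, hpW, hWN⟩ := exists_affineOpen_mem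
    (hNo.inter (V.isOpen.preimage (orbitMap G x).left.continuous)) ⟨hp, hpV⟩
  have hWV : W ≤ (orbitMap G x).left ⁻¹ᵁ V := fun z hz => (hWN hz).2
  have hWirr : IsIrreducible (W : Set G.left) :=
    ⟨⟨p, hpW⟩, hN.2.open_subset W.isOpen fun z hz => (hWN hz).1⟩
  have := isDomain_sec hWirr
  have := finiteType_sec hV
  have := finiteType_sec hW
  let φ : Sec X V →ₐ[K] Sec G W := secMap (orbitMap G x) V W hWV
  obtain ⟨f, hf, hlift⟩ := exists_lift_dualNumber φ
  obtain ⟨g, hg⟩ : ∃ g : Point G, pt g ∈ (G.left.basicOpen (U := W) f : Set G.left) := by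
    refine exists_point_mem (G.left.basicOpen (U := W) f).isOpen.isLocallyClosed ?_
    by_contra h
    rw [Set.not_nonempty_iff_eq_empty] at h
    exact hf ((basicOpen_eq_bot_iff (X := G.left) (U := W) f).mp (TopologicalSpace.Opens.ext h))
  have hgW : pt g ∈ W := G.left.basicOpen_le _ hg
  have hgV : pt (g • x) ∈ V := by
    rw [← orbitMap_left_pt]
    exact hWV hgW
  refine ⟨g, fun t ht => ?_⟩
  have hcomm (a : Sec X V) : pullback (orbitMap G x) (point_comp_orbitMap g x)
      (germAlg (g • x) V hgV a) = germAlg g W hgW (φ a) :=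
    DFunLike.congr_fun (pullback_germAlg _ (point_comp_orbitMap g x) hV hW hWV hgW hgV) a
  have hfst (a : Sec X V) :
      evalAt (g • x) (germAlg (g • x) V hgV a) = evalAt g (germAlg g W hgW (φ a)) := by
    rw [← hcomm, evalAt_pullback]
  obtain ⟨ψ, hψ1, hψ2⟩ := hlift ((evalAt g).comp (germAlg g W hgW))
    ((mem_basicOpen_iff g W hgW f).mp hg) ((tangentHom t).comp (germAlg (g • x) V hgV))
    (fun a => by rw [AlgHom.comp_apply, fst_tangentHom, hfst]; rfl) (by
    intro a ha
    have hmem : germAlg (g • x) V hgV a ∈ maxIdeal (g • x) := by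
      rw [mem_maxIdeal_iff (evalAt _), hfst, ha, map_zero, map_zero]
    refine TrivSqZeroExt.ext ?_ ?_
    · rw [AlgHom.comp_apply, fst_tangentHom, hfst, ha, map_zero, map_zero]
      rfl
    · rw [AlgHom.comp_apply, snd_tangentHom, pointDer_of_mem t ⟨_, hmem⟩]
      -- It remains to see that a vanishes at the orbit points in V. If not, the choice of N and U
      -- gives a point of N, and by irreducibility a point of W, where its pullback is non-zero.
      refine ht _ ⟨V, hgV, a, rfl, ?_⟩
      rintro _ ⟨_, ⟨g', rfl⟩, rfl⟩ hz
      have hz' : pt (g' • x) ∈ V := X.left.basicOpen_le _ hz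
      have h1 : pt (g' • x) ∈ closure ((orbitMap G x).left '' N) :=
        hcl ⟨⟨pt g', orbitMap_left_pt g' x⟩, hVU hz'⟩
      obtain ⟨_, hw, w, hwN, rfl⟩ := mem_closure_iff.mp h1 _ (X.left.basicOpen (U := V) a).isOpen hz
      obtain ⟨w', hw'N, hw'W, hw'⟩ := hN.2 W ((orbitMap G x).left ⁻¹ᵁ X.left.basicOpen (U := V) a)
        W.isOpen (TopologicalSpace.Opens.isOpen _) ⟨p, hp, hpW⟩ ⟨w, hwN, hw⟩
      have h2 : w' ∈ G.left.basicOpen (U := W) (φ a) := by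
        have := Scheme.basicOpen_appLE (orbitMap G x).left W V hWV a
        change w' ∈ G.left.basicOpen ((orbitMap G x).left.appLE V W hWV a)
        rw [this]
        exact ⟨hw'W, hw'⟩
      rw [ha] at h2
      have h3 : G.left.basicOpen (U := W) (0 : Γ(G.left, W)) = ⊥ := Scheme.basicOpen_zero _ _
      exact (h3.le h2 : w' ∈ (⊥ : G.left.Opens)))
  -- The lifted K[ε]-point is centred at g, so it factors through the stalk there and is a tangent
  -- vector.
  have hq : specOverMap (TrivSqZeroExt.fstHom K K K) ≫ specOverMap ψ ≫ chart hW =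
      toUnit (specOver K K) ≫ g := by
    rw [← Category.assoc, ← specOverMap_comp, ← specOverMap_evalAt, ← germAlg_comp_chart g hW hgW,
      ← Category.assoc, ← specOverMap_comp]
    congr 2
    exact AlgHom.ext hψ2
  obtain ⟨Θ, hΘ⟩ := exists_comp_fromStalk (x := g) (specOverMap ψ ≫ chart hW) (by
    rw [← specOverMap_fst_closedPoint (K := K)]
    change (specOverMap (TrivSqZeroExt.fstHom K K K) ≫ specOverMap ψ ≫ chart hW).left _ = _
    rw [hq, toUnit_comp_closedPoint])
  have hΘψ : Θ.comp (germAlg g W hgW) = ψ := by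
    apply specOverMap_injective
    rw [← cancel_mono (chart hW), specOverMap_comp, Category.assoc, germAlg_comp_chart, hΘ]
  obtain ⟨ξ, rfl⟩ := exists_tangentHom Θ
  refine ⟨ξ, tangentHom_injective (germAlg_hom_ext hV hgV fun a => ?_)⟩
  rw [tangentHom_differential, AlgHom.comp_apply, hcomm, ← AlgHom.comp_apply, hΘψ, hψ1,
    AlgHom.comp_apply]

/-- Left multiplication by a point of `G`. -/
def leftMul (g : Point G) : G ⟶ G := (toUnit G ≫ g) * 𝟙 G

omit [IsAlgClosed K] [CharZero K] [IsVariety G] in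
lemma comp_leftMul (g h : Point G) : h ≫ leftMul g = g * h := by
  rw [leftMul, MonObj.comp_mul, Category.comp_id, ← Category.assoc,
    toUnit_unique (h ≫ toUnit G) (𝟙 _), Category.id_comp]

omit [IsAlgClosed K] [CharZero K] [IsVariety G] [IsVariety X] in
lemma leftMul_comp_orbitMap (g : Point G) (x : Point X) :
    leftMul g ≫ orbitMap G x = orbitMap G x ≫ translation X g := by
  have h1 : translation X g = (toUnit X ≫ g) • 𝟙 X := rfl
  rw [comp_orbitMap, leftMul, mul_smul, h1, ModObj.comp_smul, Category.comp_id, ← Category.assoc,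
    toUnit_unique (orbitMap G x ≫ toUnit X) (toUnit G)]
  rfl

/-- In characteristic zero, every tangent vector to the orbit of `x` is the image of a tangent
vector of `G` at the identity. -/
lemma exists_differential_orbitMap_eq (x : Point X) {t : TangentSpaceAt x}
    (ht : t ∈ orbitTangentSpace G x) :
    ∃ ξ : TangentSpaceAt (1 : Point G),
      differential (orbitMap G x) (one_comp_orbitMap x) ξ = t := by
  obtain ⟨g, hg⟩ := exists_point_forall_exists_differential_eq (G := G) x
  have hmaps : Set.MapsTo (translation X g).left (orbitPoints G x) (orbitPoints G x) := by
    rintro _ ⟨z, ⟨g', rfl⟩, rfl⟩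
    exact ⟨g • g' • x, ⟨g * g', mul_smul _ _ _⟩, (pt_comp (comp_translation _ _)).symm⟩
  obtain ⟨ξ, hξ⟩ := hg _ (differential_mem (translation X g) (comp_translation x g) hmaps ht)
  have hl : g ≫ leftMul g⁻¹ = 1 := by rw [comp_leftMul, inv_mul_cancel]
  have hr : (g • x) ≫ translation X g⁻¹ = x := by rw [comp_translation, inv_smul_smul]
  have hc : g ≫ leftMul g⁻¹ ≫ orbitMap G x = x := by
    rw [← Category.assoc, hl, one_comp_orbitMap]
  -- Surjectivity is known only at g; equivariance of the orbit map transports it back to the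
  -- identity.
  refine ⟨differential (leftMul g⁻¹) hl ξ, ?_⟩
  have h1 := differential_comp (leftMul g⁻¹) (orbitMap G x) _ rfl hl (one_comp_orbitMap x) hc
  have h2 := differential_comp (orbitMap G x) (translation X g⁻¹) _ (leftMul_comp_orbitMap g⁻¹ x)
    (point_comp_orbitMap g x) hr hc
  have h3 : x ≫ translation X (g⁻¹ * g) = x := by rw [comp_translation, inv_mul_cancel, one_smul]
  have h4 := differential_comp (translation X g) (translation X g⁻¹) _ (translation_mul g⁻¹ g)
    (comp_translation x g) hr h3
  have h5 := differential_id x (translation X (g⁻¹ * g))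
    (by rw [inv_mul_cancel, translation_one]) h3
  have h6 := (LinearMap.congr_fun h1 ξ).symm.trans (LinearMap.congr_fun h2 ξ)
  rw [LinearMap.comp_apply, LinearMap.comp_apply, hξ] at h6
  rw [h6, ← LinearMap.comp_apply, ← h4, h5, LinearMap.id_apply]

omit [CharZero K] in
/-- A germ vanishing at all points vanishes. -/
lemma eq_zero_of_vanishesOn {y : Point X} {a : LocalRing y}
    (h : VanishesOn (Set.range (pt : Point X → X.left)) a) : a = 0 := by
  obtain ⟨U, hy, s, rfl, hs⟩ := h
  have : s = 0 := by
    rw [← basicOpen_eq_bot_iff]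
    by_contra hne
    obtain ⟨z, hz⟩ := exists_point_mem (X.left.basicOpen s).isOpen.isLocallyClosed
      (Set.nonempty_iff_ne_empty.mpr fun h0 => hne (TopologicalSpace.Opens.ext h0))
    exact hs _ ⟨z, rfl⟩ hz
  rw [this, map_zero]

omit [CharZero K] [IsVariety X] in
-- Because G is reduced, a germ vanishing at all its K-points is zero, so every tangent vector at 1
-- is tangent to the set of K-points, which maps into the orbit.
lemma differential_orbitMap_mem (x : Point X) (ξ : TangentSpaceAt (1 : Point G)) :
    differential (orbitMap G x) (one_comp_orbitMap x) ξ ∈ orbitTangentSpace G x := by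
  refine differential_mem (S := Set.range pt) _ _ ?_ ?_
  · rintro _ ⟨g, rfl⟩
    rw [orbitMap_left_pt]
    exact ⟨g • x, ⟨g, rfl⟩, rfl⟩
  · intro m hm
    have : m = 0 := Subtype.ext (eq_zero_of_vanishesOn hm)
    rw [this, map_zero, map_zero]

end OrbitTangent

/-! ### Ideals stable under derivations transversal to a slice. -/

section EulerDerivation

open IsLocalRing

variable {K A : Type*} [Field K] [CharZero K] [CommRing A] [Algebra K A] {d : ℕ}
  {D : Fin d → Derivation K A A} {s : Fin d → A}

omit [CharZero K] in
/-- The Euler derivation multiplies homogeneous elements by their degree. -/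
lemma euler_sub_smul_mem (hD : ∀ i j, D i (s j) = if i = j then 1 else 0) (n : ℕ) {g : A}
    (hg : g ∈ Ideal.span (Set.range s) ^ n) :
    ∑ i, s i * D i g - n * g ∈ Ideal.span (Set.range s) ^ (n + 1) := by
  have hs (i) : s i ∈ Ideal.span (Set.range s) := Ideal.subset_span ⟨i, rfl⟩
  have h0 (g : A) : ∑ i, s i * D i g ∈ Ideal.span (Set.range s) :=
    Ideal.sum_mem _ fun i _ => Ideal.mul_mem_right _ _ (hs i)
  have hmul (u v : A) : ∑ i, s i * D i (u * v) =
      u * ∑ i, s i * D i v + v * ∑ i, s i * D i u := by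
    rw [Finset.mul_sum, Finset.mul_sum, ← Finset.sum_add_distrib]
    refine Finset.sum_congr rfl fun i _ => ?_
    rw [Derivation.leibniz, smul_eq_mul, smul_eq_mul]
    ring
  have hadd (u v : A) : ∑ i, s i * D i (u + v) = ∑ i, s i * D i u + ∑ i, s i * D i v := by
    rw [← Finset.sum_add_distrib]
    exact Finset.sum_congr rfl fun i _ => by rw [map_add, mul_add]
  have h1 : ∀ u ∈ Ideal.span (Set.range s),
      ∑ i, s i * D i u - u ∈ Ideal.span (Set.range s) ^ 2 := by
    intro u hu
    refine Submodule.span_induction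
      (p := fun u _ => ∑ i, s i * D i u - u ∈ Ideal.span (Set.range s) ^ 2) ?_ ?_ ?_ ?_ hu
    · rintro _ ⟨j, rfl⟩
      simp [hD]
    · simp
    · intro x y _ _ hx hy
      rw [hadd, add_sub_add_comm]
      exact Ideal.add_mem _ hx hy
    · intro a x hx hy
      rw [smul_eq_mul, hmul]
      have h2 : a * ∑ i, s i * D i x + x * ∑ i, s i * D i a - a * x =
          a * (∑ i, s i * D i x - x) + x * ∑ i, s i * D i a := by ring
      rw [h2]
      refine Ideal.add_mem _ (Ideal.mul_mem_left _ _ hy) ?_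
      rw [pow_two]
      exact Ideal.mul_mem_mul hx (h0 a)
  induction n generalizing g with
  | zero => simpa using h0 g
  | succ n ih =>
    rw [pow_succ'] at hg
    refine Submodule.mul_induction_on hg ?_ ?_
    · intro u hu v hv
      have h2 : ∑ i, s i * D i (u * v) - ((n + 1 : ℕ) : A) * (u * v) =
          u * (∑ i, s i * D i v - n * v) + (∑ i, s i * D i u - u) * v := by
        rw [hmul]
        push_cast
        ring
      rw [h2]
      refine Ideal.add_mem _ ?_ ?_
      · rw [pow_succ' _ (n + 1)]
        exact Ideal.mul_mem_mul hu (ih hv)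
      · rw [show n + 1 + 1 = 2 + n by omega, pow_add]
        exact Ideal.mul_mem_mul (h1 u hu) hv
    · intro x y hx hy
      rw [hadd, mul_add, add_sub_add_comm]
      exact Ideal.add_mem _ hx hy

/-- An ideal stable under derivations dual to `s` modulo the maximal ideal, and contained in `(s)`,
vanishes. -/
theorem eq_bot_of_derivation_mem [IsLocalRing A] [IsNoetherianRing A]
    (hsm : ∀ j, s j ∈ maximalIdeal A)
    (hD : ∀ i j, D i (s j) - (if i = j then 1 else 0) ∈ maximalIdeal A) {J : Ideal A}
    (hJ : ∀ i, ∀ g ∈ J, D i g ∈ J) (hJs : J ≤ Ideal.span (Set.range s)) : J = ⊥ := by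
  -- This matrix is the identity modulo the maximal ideal, hence invertible; its inverse turns D
  -- into derivations E exactly dual to s.
  let C : Matrix (Fin d) (Fin d) A := Matrix.of fun i j => D i (s j)
  have hC : IsUnit C.det := by
    rw [← isUnit_map_iff (residue A), RingHom.map_det]
    have : (residue A).mapMatrix C = 1 := by
      ext i j
      have h1 := (residue_eq_zero_iff _).mpr (hD i j)
      rw [map_sub, sub_eq_zero] at h1
      change residue A (D i (s j)) = _
      rw [h1, Matrix.one_apply]
      split_ifs <;> simp
    rw [this, Matrix.det_one]
    exact isUnit_one
  let E : Fin d → Derivation K A A := fun i => ∑ k, C⁻¹ i k • D k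
  have hEapp (i : Fin d) (g : A) : E i g = ∑ k, C⁻¹ i k * D k g := by
    change Derivation.coeFnAddMonoidHom (∑ k, C⁻¹ i k • D k) g = _
    rw [map_sum, Finset.sum_apply]
    rfl
  have hE (i j) : E i (s j) = if i = j then 1 else 0 := by
    have h1 : (C⁻¹ * C) i j = (1 : Matrix (Fin d) (Fin d) A) i j := by
      rw [Matrix.nonsing_inv_mul _ hC]
    rw [Matrix.mul_apply, Matrix.one_apply] at h1
    rw [hEapp]
    exact h1
  have hEJ (i) (g) (hg : g ∈ J) : E i g ∈ J := by
    rw [hEapp]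
    exact Ideal.sum_mem _ fun k _ => Ideal.mul_mem_left _ _ (hJ k g hg)
  -- For g in J the Euler sum lies one power of (s) deeper than J is known to lie, and it is (n + 1)
  -- g up to such terms; dividing by n + 1 moves g itself one power deeper.
  have key (n : ℕ) : J ≤ Ideal.span (Set.range s) ^ (n + 1) := by
    induction n with
    | zero => rwa [zero_add, pow_one]
    | succ n ih =>
      intro g hg
      have h1 := euler_sub_smul_mem hE (n + 1) (ih hg)
      have h2 : ∑ i, s i * E i g ∈ Ideal.span (Set.range s) ^ (n + 1 + 1) :=
        Ideal.sum_mem _ fun i _ => by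
          rw [pow_succ' _ (n + 1)]
          exact Ideal.mul_mem_mul (Ideal.subset_span ⟨i, rfl⟩) (ih (hEJ i g hg))
      have h3 := Ideal.sub_mem _ h2 h1
      rw [sub_sub_cancel] at h3
      have h4 : g = algebraMap K A ((n + 1 : ℕ) : K)⁻¹ * (((n + 1 : ℕ) : A) * g) := by
        rw [← mul_assoc, ← map_natCast (algebraMap K A), ← map_mul,
          inv_mul_cancel₀ (Nat.cast_ne_zero.mpr n.succ_ne_zero), map_one, one_mul]
      rw [h4]
      exact Ideal.mul_mem_left _ _ h3
  rw [eq_bot_iff]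
  intro g hg
  have hle : Ideal.span (Set.range s) ≤ maximalIdeal A := by
    rw [Ideal.span_le]
    rintro _ ⟨i, rfl⟩
    exact hsm i
  rw [← Ideal.iInf_pow_eq_bot_of_isLocalRing (Ideal.span (Set.range s))
    (ne_top_of_le_ne_top (maximalIdeal.isMaximal A).ne_top hle), Ideal.mem_iInf]
  exact fun n => Ideal.pow_le_pow_right (Nat.le_succ n) (key n hg)

end EulerDerivation

/-! ### The generic point of a slice meets every invariant open set. -/

section InvariantOpen

open DualNumber

variable {K : Type u} [Field K] {G : Over (Spec (.of K))} [GrpObj G]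
  {Y : Over (Spec (.of K))}

instance (y : Point Y) [IsVariety Y] : IsNoetherianRing (LocalRing y) :=
  inferInstanceAs (IsNoetherianRing (Y.left.presheaf.stalk (pt y)))

lemma isIntegral_left (Y : Over (Spec (.of K))) [IsVariety Y] [IrreducibleSpace Y.left] :
    IsIntegral Y.left := isIntegral_of_irreducibleSpace_of_isReduced _

/-- The point of `Y` corresponding to a prime of a local ring lies in the basic open of `s` iff
the germ of `s` is not in the prime. -/
lemma fromStalk_mem_basicOpen_iff (y : Point Y) {U : Y.left.Opens} (hU : IsAffineOpen U)
    (hy : pt y ∈ U) (P : PrimeSpectrum (LocalRing y)) (s : Sec Y U) :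
    (fromStalk y).left P ∈ Y.left.basicOpen (U := U) s ↔ germAlg y U hy s ∉ P.asIdeal := by
  rw [← germAlg_comp_chart y hU hy]
  let q : PrimeSpectrum Γ(Y.left, U) := (specOverMap (germAlg y U hy)).left P
  have h : q ∈ hU.fromSpec ⁻¹ᵁ Y.left.basicOpen (U := U) s ↔ q ∈ PrimeSpectrum.basicOpen s :=
    (hU.fromSpec_preimage_basicOpen (f := s)) ▸ Iff.rfl
  exact h

variable [ModObj G Y]

/-- The flow of a tangent vector at the identity preserves an affine open subset. -/
lemma exists_flow_chart (ξ : TangentSpaceAt (1 : Point G)) {U : Y.left.Opens}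
    (hU : IsAffineOpen U) :
    ∃ ψ : Sec Y U →ₐ[K] (Sec Y U)[ε], specOverMap ψ ≫ chart hU = flow ξ (chart hU) := by
  refine exists_comp_chart hU _ ?_
  rintro _ ⟨p, rfl⟩
  let p' : PrimeSpectrum (Sec Y U)[ε] := p
  -- Adjoining ε does not change the underlying space, so the flow moves no point out of U.
  obtain ⟨q, hq⟩ : ∃ q : PrimeSpectrum (Sec Y U),
      (specOverMap (TrivSqZeroExt.fstHom K (Sec Y U) (Sec Y U))).left q = p' := by
    have h1 : Function.Surjective (PrimeSpectrum.comap
        (TrivSqZeroExt.fstHom K (Sec Y U) (Sec Y U)).toRingHom) := by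
      rw [← Set.range_eq_univ, range_comap_of_surjective _ _
        TrivSqZeroExt.fst_surjective, Set.eq_univ_iff_forall]
      intro p a ha
      have h2 : a * a = 0 := by
        have h3 : a.fst = 0 := ha
        refine TrivSqZeroExt.ext ?_ ?_
        · simp [h3]
        · simp [h3]
      exact (p.2.mem_or_mem (h2 ▸ p.asIdeal.zero_mem : a * a ∈ p.asIdeal)).elim id id
    exact h1 p'
  have h2 : (flow ξ (chart hU)).left p' = (chart hU).left q := by
    rw [← hq]
    change (specOverMap (TrivSqZeroExt.fstHom K (Sec Y U) (Sec Y U)) ≫ flow ξ (chart hU)).left q = _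
    rw [fst_comp_flow]
  change (flow ξ (chart hU)).left p' ∈ U
  rw [h2, ← SetLike.mem_coe, ← range_chart hU]
  exact ⟨q, rfl⟩

/-- The flows on the chart and on the stalk are compatible, so one derivation of the sections over U
induces the derivations at all points of U. -/
lemma snd_flow_chart {ξ : TangentSpaceAt (1 : Point G)} {U : Y.left.Opens}
    {hU : IsAffineOpen U} {ψ : Sec Y U →ₐ[K] (Sec Y U)[ε]}
    (hψ : specOverMap ψ ≫ chart hU = flow ξ (chart hU)) {y : Point Y} (hy : pt y ∈ U)
    {φ : LocalRing y →ₐ[K] (LocalRing y)[ε]}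
    (hφ : specOverMap φ ≫ fromStalk y = flow ξ (fromStalk y)) (s : Sec Y U) :
    (φ (germAlg y U hy s)).snd = germAlg y U hy (ψ s).snd := by
  have h : φ.comp (germAlg y U hy) = (dualMap (germAlg y U hy)).comp ψ := by
    apply specOverMap_injective
    rw [← cancel_mono (chart hU), specOverMap_comp, Category.assoc, germAlg_comp_chart, hφ,
      specOverMap_comp, Category.assoc, hψ, dualMap_comp_flow, germAlg_comp_chart]
  rw [← snd_dualMap, ← AlgHom.comp_apply, ← AlgHom.comp_apply, h]

variable [IsAlgClosed K] [CharZero K] [IsVariety G] [IsVariety Y] [IrreducibleSpace Y.left]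

/-- Let `s` be functions at `y` which are coordinates along the orbit of `y`, and which generate
a prime ideal. Then the generic point of `s = 0` lies in every non-empty `G`-invariant open set. -/
theorem fromStalk_mem_of_invariant (y : Point Y) {d : ℕ}
    (ξ : Fin d → TangentSpaceAt (1 : Point G)) (s : Fin d → maxIdeal y)
    (hξ : ∀ i j, differential (orbitMap G y) (one_comp_orbitMap y) (ξ i)
      ((maxIdeal y).toCotangent (s j)) = if i = j then 1 else 0)
    (P : PrimeSpectrum (LocalRing y))
    (hP : P.asIdeal = Ideal.span (Set.range fun j => (s j : LocalRing y)))
    (W : Y.left.Opens) (hW : (W : Set Y.left).Nonempty)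
    (hinv : ∀ (g : Point G) (z : Point Y), pt z ∈ W → pt (g • z) ∈ W) :
    (fromStalk y).left P ∈ W := by
  have := isIntegral_left Y
  by_contra hη
  obtain ⟨U, hU, hyU, -⟩ := exists_affineOpen_mem isOpen_univ (Set.mem_univ (pt y))
  -- functions vanishing outside `W`
  let J : Ideal (Sec Y U) :=
    { carrier := {a | ∀ (z : Point Y) (hz : pt z ∈ U), pt z ∉ W → evalAt z (germAlg z U hz a) = 0}
      add_mem' := fun {a b} ha hb z hz hzW => by
        rw [map_add, map_add, ha z hz hzW, hb z hz hzW, add_zero]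
      zero_mem' := fun z hz hzW => by rw [map_zero, map_zero]
      smul_mem' := fun c a ha z hz hzW => by
        rw [smul_eq_mul, map_mul, map_mul, ha z hz hzW, mul_zero] }
  -- A function of J non-zero at the generic point of the slice would be non-zero at some point off
  -- W, hence at a K-point there.
  have hJP : ∀ a ∈ J, germAlg y U hyU a ∈ P.asIdeal := by
    intro a ha
    by_contra haP
    have h1 := (fromStalk_mem_basicOpen_iff y hU hyU P a).mpr haP
    obtain ⟨z, hz, hzW⟩ := exists_point_mem (X := Y)
      (Z := (Y.left.basicOpen (U := U) a : Set Y.left) ∩ (W : Set Y.left)ᶜ)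
      ((Y.left.basicOpen (U := U) a).isOpen.isLocallyClosed.inter
        W.isOpen.isClosed_compl.isLocallyClosed) ⟨_, h1, hη⟩
    have hzU : pt z ∈ U := Y.left.basicOpen_le _ hz
    exact (mem_basicOpen_iff z U hzU a).mp hz (ha z hzU hzW)
  choose D φ hφD hφ hDξ using fun i => exists_derivation_of_tangent (ξ i) y
  have hbot : J.map (germAlg y U hyU) = ⊥ := by
    refine eq_bot_of_derivation_mem (D := D) (s := fun j => (s j : LocalRing y))
      (fun j => (s j).2) (fun i j => ?_) (fun i => ?_) ?_
    · rw [mem_maxIdeal_iff (evalAt y), map_sub, hDξ, pointDer_of_mem, hξ]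
      split_ifs <;> simp
    · obtain ⟨ψ, hψ⟩ := exists_flow_chart (ξ i) hU
      -- The complement of W contains the whole orbit of each of its K-points z, so a function of J
      -- vanishes along that orbit and its derivative in an orbit direction is zero at z.
      have hJψ : ∀ a ∈ J, (ψ a).snd ∈ J := by
        intro a ha z hz hzW
        obtain ⟨D', φ', hφD', hφ', hDξ'⟩ := exists_derivation_of_tangent (ξ i) z
        rw [← snd_flow_chart hψ hz hφ', hφD', hDξ']
        have hmem : germAlg z U hz a ∈ maxIdeal z := (mem_maxIdeal_iff (evalAt z)).mpr (ha z hz hzW)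
        rw [pointDer_of_mem _ ⟨_, hmem⟩]
        refine differential_orbitMap_mem z (ξ i) _ ⟨U, hz, a, rfl, ?_⟩
        rintro _ ⟨_, ⟨g, rfl⟩, rfl⟩ hgz
        have hgzU : pt (g • z) ∈ U := Y.left.basicOpen_le _ hgz
        refine (mem_basicOpen_iff (g • z) U hgzU a).mp hgz (ha _ hgzU fun hgW => hzW ?_)
        have := hinv g⁻¹ _ hgW
        rwa [inv_smul_smul] at this
      intro b hb
      refine Submodule.span_induction (p := fun b _ => D i b ∈ J.map (germAlg y U hyU))
        ?_ ?_ ?_ ?_ hb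
      · rintro _ ⟨a, ha, rfl⟩
        have h1 := snd_flow_chart hψ hyU (hφ i) a
        rw [hφD] at h1
        change D i (germAlg y U hyU a) ∈ _
        rw [h1]
        exact Ideal.mem_map_of_mem _ (hJψ a ha)
      · rw [map_zero]; exact Ideal.zero_mem _
      · intro b c _ _ hb hc
        rw [map_add]; exact Ideal.add_mem _ hb hc
      · intro c b hb hDb
        rw [smul_eq_mul, Derivation.leibniz]
        exact Ideal.add_mem _ (Ideal.mul_mem_left _ _ hDb) (Ideal.mul_mem_right _ _ hb)
    · rw [← hP, Ideal.map_le_iff_le_comap]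
      exact hJP
  -- W meets U by irreducibility, so some non-zero function on U vanishes off W, contradicting that
  -- J becomes zero in an integral local ring.
  obtain ⟨z, hzU, hzW⟩ : ((U : Set Y.left) ∩ W).Nonempty :=
    nonempty_preirreducible_inter U.isOpen W.isOpen ⟨_, hyU⟩ hW
  obtain ⟨a, haW, hza⟩ := hU.exists_basicOpen_le ⟨z, hzW⟩ hzU
  have haJ : (a : Sec Y U) ∈ J := fun z hz hzW => by
    by_contra h
    exact hzW (haW ((mem_basicOpen_iff z U hz a).mpr h))
  have h1 : germAlg y U hyU a = 0 := by
    rw [← Ideal.mem_bot, ← hbot]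
    exact Ideal.mem_map_of_mem _ haJ
  have h2 : a = 0 := germAlg_injective y U hyU (h1.trans (map_zero _).symm)
  rw [h2, Scheme.basicOpen_zero] at hza
  exact hza

end InvariantOpen

/-! ### Local isomorphisms and fractions. -/

section LocalIso

/-- If `f` is a local isomorphism at a generisation `p'` of `p`, every germ at `p` becomes a
pulled back function after multiplication by a pulled back function not vanishing at `p'`. -/
lemma exists_germ_mul_eq {X Y : Scheme.{u}} (f : X ⟶ Y) [IsIntegral X] {p p' : X} (h : p' ⤳ p)
    [IsIso (f.stalkMap p')] {U : Y.Opens} (hU : IsAffineOpen U) (hp : p ∈ f ⁻¹ᵁ U)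
    (b : X.presheaf.stalk p) :
    ∃ a q : Γ(Y, U), f p' ∈ Y.basicOpen q ∧
      X.presheaf.germ (f ⁻¹ᵁ U) p hp (f.app U q) * b =
        X.presheaf.germ (f ⁻¹ᵁ U) p hp (f.app U a) := by
  have hp' : f p' ∈ U := h.mem_open (f ⁻¹ᵁ U).isOpen hp
  let := Y.presheaf.algebra_section_stalk ⟨f p', hp'⟩
  have hloc := hU.isLocalization_stalk ⟨f p', hp'⟩
  obtain ⟨c, hc⟩ : ∃ c, f.stalkMap p' c = X.presheaf.stalkSpecializes h b :=
    (ConcreteCategory.bijective_of_isIso (f.stalkMap p')).2 _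
  obtain ⟨⟨a, q⟩, haq⟩ := IsLocalization.surj (hU.primeIdealOf ⟨f p', hp'⟩).asIdeal.primeCompl c
  have hq := IsLocalization.map_units (Y.presheaf.stalk (f p')) q
  refine ⟨a, q, (Y.mem_basicOpen q.1 _ hp').mpr hq, ?_⟩
  -- On an integral scheme the identity can be checked after generisation, where the map of stalks
  -- is invertible.
  have hinj : Function.Injective (X.presheaf.stalkSpecializes h) := by
    rw [injective_iff_map_eq_zero]
    intro e he
    obtain ⟨V, hV, s, rfl⟩ := X.presheaf.exists_germ_eq e
    have h1 := congr(($(X.presheaf.germ_stalkSpecializes hV h)).hom s)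
    have h2 : X.presheaf.germ V p' (h.mem_open V.isOpen hV) s = 0 := h1.symm.trans he
    have h3 : s = 0 := germ_injective_of_isIntegral X p' _ (h2.trans (map_zero _).symm)
    rw [h3, map_zero]
  apply hinj
  have hg (s : Γ(Y, U)) : X.presheaf.stalkSpecializes h
      (X.presheaf.germ (f ⁻¹ᵁ U) p hp (f.app U s)) =
        f.stalkMap p' (Y.presheaf.germ U (f p') hp' s) := by
    have h1 := congr(($(X.presheaf.germ_stalkSpecializes (U := f ⁻¹ᵁ U) hp h)).hom (f.app U s))
    have h2 := congr(($(f.germ_stalkMap U p' hp')).hom s)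
    exact h1.trans h2.symm
  rw [map_mul, hg, hg, ← hc, ← map_mul, mul_comm]
  exact congrArg _ haq

/-- Stability of "local isomorphism at a point" under translation by automorphisms. -/
lemma isIso_stalkMap_of_comm {X Y : Scheme.{u}} (f : X ⟶ Y) (g : X ⟶ X) (g' : Y ⟶ Y)
    [IsIso g] [IsIso g'] (hc : g ≫ f = f ≫ g') (p : X) [IsIso (f.stalkMap (g p))] :
    IsIso (f.stalkMap p) := by
  have h1 : IsIso ((g ≫ f).stalkMap p) := by
    rw [Scheme.Hom.stalkMap_comp]
    exact IsIso.comp_isIso' ‹_› (inferInstanceAs (IsIso (g.stalkMap p)))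
  rw [hc, Scheme.Hom.stalkMap_comp] at h1
  have h2 : IsIso (g'.stalkMap (f p)) := inferInstance
  exact @IsIso.of_isIso_comp_left _ _ _ _ _ (g'.stalkMap (f p)) (f.stalkMap p) h2 h1

lemma isIso_stalkMap_of_partialIso {X Y : Scheme.{u}} (f : X ⟶ Y) (e : X.PartialIso Y)
    (he : e.iso.hom ≫ e.target.ι = e.source.ι ≫ f) {p : X} (hp : p ∈ e.source) :
    IsIso (f.stalkMap p) := by
  have h1 : IsOpenImmersion (e.source.ι ≫ f) := he ▸ inferInstance
  let p' : e.source.toScheme := ⟨p, hp⟩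
  have h2 : IsIso ((e.source.ι ≫ f).stalkMap p') := inferInstance
  rw [Scheme.Hom.stalkMap_comp] at h2
  have h3 : IsIso (e.source.ι.stalkMap p') := inferInstance
  exact @IsIso.of_isIso_comp_right _ _ _ _ _ (f.stalkMap (e.source.ι p')) (e.source.ι.stalkMap p')
    h3 h2

end LocalIso

/-! ### Invariant hulls, and their intersection with slices. -/

section Translates

variable {K : Type u} [Field K] {G : Over (Spec (.of K))} [GrpObj G]
  {X Y : Over (Spec (.of K))} [ModObj G X] [ModObj G Y]

instance (g : Point G) : IsIso (translation X g) :=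
  ⟨translation X g⁻¹, by rw [← translation_mul, inv_mul_cancel, translation_one],
    by rw [← translation_mul, mul_inv_cancel, translation_one]⟩

instance (g : Point G) : IsIso (translation X g).left :=
  inferInstanceAs (IsIso ((Over.forget _).map (translation X g)))

lemma translation_comp (f : X ⟶ Y) [IsModHom G f] (g : Point G) :
    translation X g ≫ f = f ≫ translation Y g := by
  have e (Z : Over (Spec (.of K))) [ModObj G Z] : translation Z g = (toUnit Z ≫ g) • 𝟙 Z := rfl
  rw [e, e, IsModHom.map_smul, Category.id_comp, ModObj.comp_smul, Category.comp_id,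
    ← Category.assoc, toUnit_unique (f ≫ toUnit Y) (toUnit X)]

/-- The union of the translates of an open subset. -/
def invariantHull (G : Over (Spec (.of K))) [GrpObj G] [ModObj G X] (U : X.left.Opens) :
    X.left.Opens := ⨆ g : Point G, (translation X g).left ⁻¹ᵁ U

lemma mem_invariantHull {U : X.left.Opens} {p : X.left} :
    p ∈ invariantHull G U ↔ ∃ g : Point G, (translation X g).left p ∈ U := by
  rw [invariantHull, TopologicalSpace.Opens.mem_iSup]
  rfl

lemma pt_mem_invariantHull {U : X.left.Opens} {x : Point X} :
    pt x ∈ invariantHull G U ↔ ∃ g : Point G, pt (g • x) ∈ U := by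
  rw [mem_invariantHull]
  refine exists_congr fun g => ?_
  rw [pt_comp (comp_translation x g)]

lemma le_invariantHull (U : X.left.Opens) : U ≤ invariantHull G U := by
  intro p hp
  refine mem_invariantHull.mpr ⟨1, ?_⟩
  rw [translation_one]
  exact hp

lemma smul_mem_invariantHull {U : X.left.Opens} (g : Point G) (x : Point X)
    (hx : pt x ∈ invariantHull G U) : pt (g • x) ∈ invariantHull G U := by
  obtain ⟨g', hg'⟩ := pt_mem_invariantHull.mp hx
  refine pt_mem_invariantHull.mpr ⟨g' * g⁻¹, ?_⟩
  rwa [smul_smul, inv_mul_cancel_right]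

variable [IsAlgClosed K] [CharZero K] [IsVariety G] [IsVariety X] [IsVariety Y]
  [IrreducibleSpace X.left] [IrreducibleSpace Y.left]

omit [IsVariety Y] [IrreducibleSpace Y.left] in
/-- For a birational equivariant morphism, the local rings of `X` and `Y` agree up to denominators
which do not vanish on the generic point of a transversal slice to the orbit. -/
theorem exists_pullback_mul_eq (f : X ⟶ Y) [IsModHom G f] (hf : IsBirational f) {x : Point X}
    {y : Point Y} (hy : x ≫ f = y) {d : ℕ}
    (ξ : Fin d → TangentSpaceAt (1 : Point G)) (s : Fin d → maxIdeal x)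
    (hξ : ∀ i j, differential (orbitMap G x) (one_comp_orbitMap x) (ξ i)
      ((maxIdeal x).toCotangent (s j)) = if i = j then 1 else 0)
    (hP : (Ideal.span (Set.range fun j => (s j : LocalRing x))).IsPrime) (b : LocalRing x) :
    ∃ a q : LocalRing y, pullback f hy q ∉ Ideal.span (Set.range fun j => (s j : LocalRing x)) ∧
      pullback f hy q * b = pullback f hy a := by
  obtain ⟨e, he⟩ := hf
  have := isIntegral_left X
  let P : PrimeSpectrum (LocalRing x) := ⟨_, hP⟩
  obtain ⟨p, hp⟩ : (e.source : Set X.left).Nonempty := e.dense_source.nonempty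
  -- The domain of the partial isomorphism need not be invariant; its hull is, and translation
  -- carries the local isomorphism property from e.source to the generic point of the slice.
  have hη := fromStalk_mem_of_invariant x ξ s hξ P rfl (invariantHull G e.source)
    ⟨p, le_invariantHull _ hp⟩ smul_mem_invariantHull
  obtain ⟨g, hg⟩ := mem_invariantHull.mp hη
  have h1 := isIso_stalkMap_of_partialIso f.left e he hg
  have h2 : IsIso (f.left.stalkMap ((fromStalk x).left P)) :=
    isIso_stalkMap_of_comm f.left (translation X g).left (translation Y g).left
      congr(($(translation_comp f g)).left) _
  obtain ⟨U, hU, hyU, -⟩ := exists_affineOpen_mem isOpen_univ (Set.mem_univ (pt y))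
  have hxU : pt x ∈ f.left ⁻¹ᵁ U := mem_preimage hy hyU
  obtain ⟨a, q, hq, haq⟩ := exists_germ_mul_eq f.left (fromStalk_left_specializes x P) hU hxU b
  refine ⟨germ y U hyU a, germ y U hyU q, fun hqP => ?_, ?_⟩
  · have h3 := fromStalk_mem_basicOpen_iff y hU hyU
      (PrimeSpectrum.comap (pullback f hy).toRingHom P) q
    have h4 : (fromStalk y).left (PrimeSpectrum.comap (pullback f hy).toRingHom P) =
        f.left ((fromStalk x).left P) := by
      change (specOverMap (pullback f hy) ≫ fromStalk y).left P = (fromStalk x ≫ f).left P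
      rw [fromStalk_comp f hy]
    rw [h4] at h3
    exact h3.mp hq hqP
  · rw [pullback_germ, pullback_germ]
    exact haq

/-- An element of the stabilizer which acts trivially on the functions on a transversal slice to
the orbit is trivial. -/
theorem eq_one_of_forall_sub_mem (hfree : GenericallyFree G Y) (y : Point Y) {d : ℕ}
    (ξ : Fin d → TangentSpaceAt (1 : Point G)) (s : Fin d → maxIdeal y)
    (hξ : ∀ i j, differential (orbitMap G y) (one_comp_orbitMap y) (ξ i)
      ((maxIdeal y).toCotangent (s j)) = if i = j then 1 else 0)
    (hP : (Ideal.span (Set.range fun j => (s j : LocalRing y))).IsPrime)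
    (h : Point G) (hh : h • y = y)
    (htriv : ∀ a, pullback (translation Y h) ((comp_translation y h).trans hh) a - a ∈
      Ideal.span (Set.range fun j => (s j : LocalRing y))) : h = 1 := by
  obtain ⟨U, hUd, hU⟩ := hfree
  let I := Ideal.span (Set.range fun j => (s j : LocalRing y))
  let P : PrimeSpectrum (LocalRing y) := ⟨I, hP⟩
  obtain ⟨p, hp⟩ : (U : Set Y.left).Nonempty := hUd.nonempty
  have hη := fromStalk_mem_of_invariant y ξ s hξ P rfl (invariantHull G U)
    ⟨p, le_invariantHull _ hp⟩ smul_mem_invariantHull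
  let π : LocalRing y →ₐ[K] LocalRing y ⧸ I := Ideal.Quotient.mkₐ K I
  -- The fixed locus of h. The slice maps into it, so its generic point lies both there and in the
  -- hull of the free locus.
  let E := Limits.equalizer (translation Y h) (𝟙 Y)
  let j : E ⟶ Y := Limits.equalizer.ι (translation Y h) (𝟙 Y)
  have hq : (specOverMap π ≫ fromStalk y) ≫ translation Y h =
      (specOverMap π ≫ fromStalk y) ≫ 𝟙 Y := by
    rw [Category.assoc, fromStalk_comp _ ((comp_translation y h).trans hh), ← Category.assoc,
      ← specOverMap_comp, Category.comp_id]
    congr 2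
    refine AlgHom.ext fun a => ?_
    exact (Ideal.Quotient.eq (I := I)).mpr (htriv a)
  let q := Limits.equalizer.lift (specOverMap π ≫ fromStalk y) hq
  have hqj : q ≫ j = specOverMap π ≫ fromStalk y := Limits.equalizer.lift_ι _ _
  let z : PrimeSpectrum (LocalRing y ⧸ I) := ⟨⊥, by
    have := (Ideal.Quotient.isDomain_iff_prime I).mpr hP
    exact Ideal.isPrime_bot⟩
  have hz : (specOverMap π).left z = P := by
    refine PrimeSpectrum.ext ?_
    exact Ideal.mk_ker
  have hjz : j.left (q.left z) = (fromStalk y).left P := by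
    rw [← hz]
    change (q ≫ j).left z = (specOverMap π ≫ fromStalk y).left z
    rw [hqj]
  have hjc : IsClosedImmersion j.left := inferInstanceAs
    (IsClosedImmersion (Limits.equalizer.ι (translation Y h) (𝟙 Y)).left)
  have hE : LocallyOfFiniteType E.hom := by
    rw [← Over.w j]
    infer_instance
  -- The fixed locus therefore has a K-point in the hull; a translate of it lies in U and is fixed
  -- by a conjugate of h.
  obtain ⟨e, he⟩ := exists_point_mem (X := E) (Z := (j.left ⁻¹ᵁ invariantHull G U : E.left.Opens))
    (TopologicalSpace.Opens.isOpen _).isLocallyClosed ⟨q.left z, by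
      change j.left (q.left z) ∈ invariantHull G U
      rw [hjz]
      exact hη⟩
  have hfix : h • (e ≫ j) = e ≫ j := by
    rw [← comp_translation, Category.assoc, Limits.equalizer.condition, Category.comp_id]
  have hmem : pt (e ≫ j) ∈ invariantHull G U := by
    rw [← pt_comp (x := e) rfl]
    exact he
  obtain ⟨g, hg⟩ := pt_mem_invariantHull.mp hmem
  have h1 : g * h * g⁻¹ ∈ MulAction.stabilizer (Point G) (g • (e ≫ j)) := by
    rw [MulAction.mem_stabilizer_iff, smul_smul, inv_mul_cancel_right, mul_smul, hfix]
  rw [hU _ hg, Subgroup.mem_bot, conj_eq_one_iff] at h1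
  exact h1

end Translates

/-! ### Equidimensionality and generic smoothness of affine domains. -/

section Dimension

/-- Over a Jacobson ring a maximal ideal of the polynomial ring contracts to a maximal ideal, and
each variable adds one to the height. -/
lemma height_mvPolynomial_of_isMaximal {K : Type*} [Field K] {n : ℕ}
    (M : Ideal (MvPolynomial (Fin n) K)) [hM : M.IsMaximal] : M.height = n := by
  induction n with
  | zero =>
    have h1 : IsField (MvPolynomial (Fin 0) K) :=
      (MvPolynomial.isEmptyAlgEquiv K (Fin 0)).toMulEquiv.isField (Field.toIsField K)
    let := h1.toField
    rw [Ideal.eq_bot_of_prime M]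
    exact Ideal.height_bot
  | succ n ih =>
    let e := (MvPolynomial.finSuccEquiv K n).toRingEquiv
    let P : Ideal (Polynomial (MvPolynomial (Fin n) K)) := M.map e
    have hP : P.IsMaximal := Ideal.map_isMaximal_of_equiv e
    have hp : (P.comap (Polynomial.C : MvPolynomial (Fin n) K →+* _)).IsMaximal :=
      Polynomial.isMaximal_comap_C_of_isJacobsonRing P
    have hover : P.LiesOver (P.comap (Polynomial.C : MvPolynomial (Fin n) K →+* _)) := ⟨rfl⟩
    have h2 : P.height = n + 1 := by
      rw [Polynomial.height_eq_height_add_one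
        (P.comap (Polynomial.C : MvPolynomial (Fin n) K →+* _)) P, ih]
    have h3 : P.height = M.height := e.height_map M
    rw [← h3, h2, Nat.cast_succ]

/-- Incomparability makes contraction of primes strictly monotone, which gives the upper bound;
going down over an integrally closed ring gives the lower one. -/
lemma height_of_isIntegral {R S : Type*} [CommRing R] [CommRing S] [Algebra R S] [IsDomain S]
    [FaithfulSMul R S] [Algebra.IsIntegral R S] [IsIntegrallyClosed R] [IsNoetherianRing R]
    [IsNoetherianRing S] (P : Ideal S) [P.IsPrime] : P.height = (P.under R).height := by
  refine le_antisymm ?_ ?_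
  · rw [(⟨P, inferInstance⟩ : PrimeSpectrum S).height_eq_orderHeight,
      (⟨P.under R, inferInstance⟩ : PrimeSpectrum R).height_eq_orderHeight]
    refine Order.height_le_height_apply_of_strictMono
      (fun Q : PrimeSpectrum S => (⟨Q.asIdeal.under R, inferInstance⟩ : PrimeSpectrum R)) ?_ _
    intro Q Q' h
    exact Ideal.IsIntegral.comap_lt_comap (R := R) h
  · rw [Ideal.height_eq_height_add_of_liesOver_of_hasGoingDown (P.under R) P]
    exact le_self_add

open DualNumber in
-- Uniqueness as in Hensel's lemma: the difference of the two images of t has square zero, so in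
-- Taylor's formula for P only the linear term survives, and its coefficient P'(t) is a unit.
lemma algHom_eq_of_aeval_eq_zero {K R S : Type*} [Field K] [CommRing R] [CommRing S] [Algebra K S]
    [Algebra R S] {φ ψ : S →ₐ[K] K[ε]} (hfst : ∀ a, (φ a).fst = (ψ a).fst)
    (hR : ∀ a, φ (algebraMap R S a) = ψ (algebraMap R S a)) {t : S} {P : Polynomial R}
    (hP : Polynomial.aeval t P = 0)
    (hP' : (φ (Polynomial.aeval t (Polynomial.derivative P))).fst ≠ 0) : φ t = ψ t := by
  let f : R →+* K[ε] := ψ.toRingHom.comp (algebraMap R S)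
  have hf : φ.toRingHom.comp (algebraMap R S) = f := RingHom.ext hR
  have e1 (Q : Polynomial R) : (Q.map f).eval (φ t) = φ (Polynomial.aeval t Q) := by
    rw [← hf, Polynomial.eval_map, Polynomial.aeval_def]
    exact (Polynomial.hom_eval₂ Q (algebraMap R S) φ.toRingHom t).symm
  have e2 (Q : Polynomial R) : (Q.map f).eval (ψ t) = ψ (Polynomial.aeval t Q) := by
    rw [Polynomial.eval_map, Polynomial.aeval_def]
    exact (Polynomial.hom_eval₂ Q (algebraMap R S) ψ.toRingHom t).symm
  obtain ⟨k, hk⟩ := Polynomial.binomExpansion (P.map f) (ψ t) (φ t - ψ t)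
  have hsq : (φ t - ψ t) ^ 2 = 0 := by
    rw [pow_two]
    ext
    · simp [hfst]
    · simp [hfst]
  rw [add_sub_cancel, e1, e2, hP, map_zero, map_zero, hsq, mul_zero, add_zero, zero_add,
    Polynomial.derivative_map, e2] at hk
  have hu : IsUnit (ψ (Polynomial.aeval t (Polynomial.derivative P))) := by
    rw [TrivSqZeroExt.isUnit_iff_isUnit_fst, ← hfst]
    exact hP'.isUnit
  exact sub_eq_zero.mp ((hu.mul_right_eq_zero).mp hk.symm)

/-- Take a non-zero annihilating polynomial of least degree; in characteristic zero its derivative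
is non-zero of smaller degree. -/
lemma exists_aeval_derivative_ne_zero {R S : Type*} [CommRing R] [CommRing S] [Algebra R S]
    [CharZero R] [IsDomain R] [FaithfulSMul R S] {t : S} (ht : IsAlgebraic R t) :
    ∃ P : Polynomial R, Polynomial.aeval t P = 0 ∧
      Polynomial.aeval t (Polynomial.derivative P) ≠ 0 := by
  classical
  have h : ∃ n, ∃ P : Polynomial R, P ≠ 0 ∧ Polynomial.aeval t P = 0 ∧ P.natDegree = n := by
    obtain ⟨P, h0, h1⟩ := ht
    exact ⟨_, P, h0, h1, rfl⟩
  obtain ⟨P, h0, h1, h2⟩ := Nat.find_spec h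
  refine ⟨P, h1, fun h3 => ?_⟩
  have hdeg : P.natDegree ≠ 0 := by
    intro hd
    rw [Polynomial.eq_C_of_natDegree_eq_zero hd] at h0 h1
    rw [Polynomial.aeval_C] at h1
    exact h0 (by rw [(FaithfulSMul.algebraMap_eq_zero_iff R S).mp h1, Polynomial.C_0])
  have hlt := Polynomial.natDegree_derivative_lt hdeg
  rw [h2] at hlt
  exact Nat.find_min h hlt ⟨_, fun h4 => hdeg (Polynomial.derivative_eq_zero.mp h4), h3, rfl⟩

open DualNumber in
/-- A finitely generated domain is equidimensional and generically smooth. -/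
lemma exists_height_eq_and_algHom_ext (K S : Type*) [Field K] [CharZero K] [CommRing S]
    [IsDomain S] [Algebra K S] [Algebra.FiniteType K S] :
    ∃ (D : ℕ) (w : Fin D → S), (∀ P : Ideal S, P.IsMaximal → P.height = D) ∧
      ∃ g : S, g ≠ 0 ∧ ∀ φ ψ : S →ₐ[K] K[ε], (∀ a, (φ a).fst = (ψ a).fst) →
        (∀ i, φ (w i) = ψ (w i)) → (φ g).fst ≠ 0 → φ = ψ := by
  -- Noether normalization: heights come from the polynomial ring, and a K[ε]-point is determined by
  -- its coordinates where the finite map is unramified.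
  obtain ⟨D, θ, hinj, hint⟩ := exists_integral_inj_algHom_of_fg K S
  let : Algebra (MvPolynomial (Fin D) K) S := θ.toRingHom.toAlgebra
  have hsc : IsScalarTower K (MvPolynomial (Fin D) K) S := .of_algHom θ
  have hfaith : FaithfulSMul (MvPolynomial (Fin D) K) S :=
    (faithfulSMul_iff_algebraMap_injective _ _).mpr hinj
  have hint' : Algebra.IsIntegral (MvPolynomial (Fin D) K) S := ⟨hint⟩
  have hnoeth : IsNoetherianRing S := Algebra.FiniteType.isNoetherianRing K S
  have hic : IsIntegrallyClosed (MvPolynomial (Fin D) K) := inferInstance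
  refine ⟨D, fun i => θ (MvPolynomial.X i), fun P hP => ?_, ?_⟩
  · have h1 : (P.under (MvPolynomial (Fin D) K)).IsMaximal :=
      Ideal.isMaximal_comap_of_isIntegral_of_isMaximal P
    rw [height_of_isIntegral (R := MvPolynomial (Fin D) K) P,
      height_mvPolynomial_of_isMaximal]
  · classical
    obtain ⟨T, hT⟩ : (⊤ : Subalgebra K S).FG := Algebra.FiniteType.out
    have key (t : S) := exists_aeval_derivative_ne_zero
      (Algebra.IsIntegral.isIntegral (R := MvPolynomial (Fin D) K) t).isAlgebraic
    choose P hP hP' using key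
    refine ⟨∏ t ∈ T, Polynomial.aeval t (Polynomial.derivative (P t)),
      Finset.prod_ne_zero_iff.mpr fun t _ => hP' t, fun φ ψ hfst hw hg => ?_⟩
    have hR (a : MvPolynomial (Fin D) K) : φ (θ a) = ψ (θ a) := by
      have : φ.comp θ = ψ.comp θ := MvPolynomial.algHom_ext hw
      exact DFunLike.congr_fun this a
    refine AlgHom.ext_of_adjoin_eq_top hT fun t ht => ?_
    refine algHom_eq_of_aeval_eq_zero hfst hR (hP t) fun h0 => hg ?_
    rw [← Finset.mul_prod_erase T _ ht, map_mul, TrivSqZeroExt.fst_mul, h0, zero_mul]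

end Dimension

/-! ### Cotangent spaces over K and over the residue field. -/

section Cotangent

open IsLocalRing

variable {K R : Type*} [Field K] [CommRing R] [IsLocalRing R] [Algebra K R]

instance : IsScalarTower K (ResidueField R) (CotangentSpace R) where
  smul_assoc c a m := by
    obtain ⟨a, rfl⟩ := residue_surjective a
    have h1 : c • residue R a = residue R (c • a) := by
      rw [Algebra.smul_def, Algebra.smul_def, map_mul]
      rfl
    rw [h1]
    exact smul_assoc c a m

lemma bijective_algebraMap_residueField
    (h : ∀ a : R, ∃ c : K, a - algebraMap K R c ∈ maximalIdeal R) :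
    Function.Bijective (Algebra.linearMap K (ResidueField R)) := by
  refine ⟨(algebraMap K (ResidueField R)).injective, fun a => ?_⟩
  obtain ⟨a, rfl⟩ := residue_surjective a
  obtain ⟨c, hc⟩ := h a
  refine ⟨c, ?_⟩
  have : residue R (a - algebraMap K R c) = 0 := (residue_eq_zero_iff _).mpr hc
  rw [map_sub, sub_eq_zero] at this
  exact this.symm

lemma finite_cotangentSpace [IsNoetherianRing R]
    (h : ∀ a : R, ∃ c : K, a - algebraMap K R c ∈ maximalIdeal R) :
    Module.Finite K (CotangentSpace R) :=
  have : Module.Finite K (ResidueField R) :=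
    .of_surjective _ (bijective_algebraMap_residueField h).2
  .trans (ResidueField R) _

lemma finrank_cotangentSpace_eq
    (h : ∀ a : R, ∃ c : K, a - algebraMap K R c ∈ maximalIdeal R) :
    Module.finrank K (CotangentSpace R) =
      Module.finrank (ResidueField R) (CotangentSpace R) := by
  rw [← Module.finrank_mul_finrank K (ResidueField R),
    ← (LinearEquiv.ofBijective _ (bijective_algebraMap_residueField h)).finrank_eq,
    Module.finrank_self, one_mul]

end Cotangent

/-! ### Krull dimension and local rings at K-points. -/

section LocalDimension

open TopologicalSpace

variable {K : Type u} [Field K] {X : Over (Spec (.of K))} [IsVariety X]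

instance (x : Point X) : Module.Finite K (maxIdeal x).Cotangent :=
  finite_cotangentSpace fun a => ⟨_, sub_algebraMap_mem a⟩

lemma ringKrullDim_le_finrank_cotangent (x : Point X) :
    ringKrullDim (LocalRing x) ≤ (Module.finrank K (maxIdeal x).Cotangent : ℕ) := by
  have h := ringKrullDim_le_spanFinrank_maximalIdeal (LocalRing x)
  rw [IsLocalRing.spanFinrank_maximalIdeal_eq_finrank_cotangentSpace,
    ← finrank_cotangentSpace_eq (K := K) fun a => ⟨_, sub_algebraMap_mem a⟩] at h
  exact h

lemma IsSmoothPoint.ringKrullDim_eq {x : Point X} (hx : IsSmoothPoint x) :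
    ringKrullDim (LocalRing x) = (Module.finrank K (maxIdeal x).Cotangent : ℕ) := by
  rw [← (IsRegularLocalRing.iff_finrank_cotangentSpace (LocalRing x)).mp hx,
    ← finrank_cotangentSpace_eq (K := K) fun a => ⟨_, sub_algebraMap_mem a⟩]

omit [IsVariety X] in
lemma ringKrullDim_le_topologicalKrullDim (x : Point X) :
    ringKrullDim (LocalRing x) ≤ topologicalKrullDim X.left := by
  have h1 : ringKrullDim (LocalRing x) = Order.coheight (pt x) := ringKrullDim_stalk_eq_coheight _
  rw [h1, topologicalKrullDim, Order.krullDim_eq_of_orderIso irreducibleSetEquivPoints]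
  exact Order.coheight_le_krullDim _

/-- The smallest member of a chain of irreducible closed sets contains a K-point, and the generic
points of the chain are all generisations of that point. -/
lemma topologicalKrullDim_le [IsAlgClosed K] {n : WithBot ℕ∞}
    (h : ∀ x : Point X, ringKrullDim (LocalRing x) ≤ n) : topologicalKrullDim X.left ≤ n := by
  refine iSup_le fun l => ?_
  obtain ⟨x, hx⟩ := exists_point_mem l.head.isClosed.isLocallyClosed l.head.isIrreducible.nonempty
  refine le_trans ?_ (h x)
  have h1 : ringKrullDim (LocalRing x) = Order.coheight (pt x) := ringKrullDim_stalk_eq_coheight _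
  rw [h1]
  let l' : LTSeries X.left := l.map irreducibleSetEquivPoints irreducibleSetEquivPoints.strictMono
  have h2 : pt x ≤ l'.head := by
    rw [Scheme.le_iff_specializes]
    have h3 : l.head = irreducibleSetEquivPoints.symm l'.head := by
      rw [LTSeries.head_map, OrderIso.symm_apply_apply]
    rw [h3] at hx
    exact specializes_iff_mem_closure.mpr hx
  have := Order.length_le_coheight h2
  exact_mod_cast this

omit [IsVariety X] in
lemma ringKrullDim_eq_height (x : Point X) {U : X.left.Opens} (hU : IsAffineOpen U)
    (hx : pt x ∈ U) :
    ∃ P : Ideal (Sec X U), P.IsMaximal ∧ ringKrullDim (LocalRing x) = P.height := by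
  let P : Ideal Γ(X.left, U) := (hU.primeIdealOf ⟨pt x, hx⟩).asIdeal
  let : Algebra Γ(X.left, U) (X.left.presheaf.stalk (pt x)) :=
    TopCat.Presheaf.algebra_section_stalk X.left.presheaf ⟨pt x, hx⟩
  have hloc : IsLocalization.AtPrime (X.left.presheaf.stalk (pt x)) P :=
    hU.isLocalization_stalk ⟨pt x, hx⟩
  have h1 : (maxIdeal x).comap (germAlg x U hx) = P :=
    IsLocalization.AtPrime.under_maximalIdeal (X.left.presheaf.stalk (pt x)) P
  have h2 : P = RingHom.ker ((evalAt x).comp (germAlg x U hx)) := by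
    rw [← h1]
    ext a
    exact mem_maxIdeal_iff (evalAt x)
  refine ⟨P, ?_, IsLocalization.AtPrime.ringKrullDim_eq_height P (X.left.presheaf.stalk (pt x))⟩
  rw [h2]
  exact RingHom.ker_isMaximal_of_surjective _ fun c => ⟨algebraMap K _ c, AlgHom.commutes _ c⟩

/-- On an irreducible affine open subset, the local dimension is constant and some point has a
tangent space of at most that dimension. -/
lemma exists_ringKrullDim_eq_of_isIrreducible [IsAlgClosed K] [CharZero K] {U : X.left.Opens}
    (hU : IsAffineOpen U) (hirr : IsIrreducible (U : Set X.left)) :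
    ∃ D : ℕ, (∀ x : Point X, pt x ∈ U → ringKrullDim (LocalRing x) = D) ∧
      ∃ x : Point X, pt x ∈ U ∧ Module.finrank K (TangentSpaceAt x) ≤ D := by
  have := isDomain_sec hirr
  have := finiteType_sec (X := X) hU
  obtain ⟨D, w, hD, g, hg, hext⟩ := exists_height_eq_and_algHom_ext K (Sec X U)
  refine ⟨D, fun x hx => ?_, ?_⟩
  · obtain ⟨P, hP, h⟩ := ringKrullDim_eq_height x hU hx
    rw [h, hD P hP]
    rfl
  · have hne : (X.left.basicOpen (show Γ(X.left, U) from g) : Set X.left).Nonempty := by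
      rw [Set.nonempty_iff_ne_empty]
      intro h0
      exact hg ((basicOpen_eq_bot_iff _).mp (TopologicalSpace.Opens.ext h0))
    obtain ⟨x, hx⟩ := exists_point_mem
      (X.left.basicOpen (show Γ(X.left, U) from g)).isOpen.isLocallyClosed hne
    have hxU : pt x ∈ U := X.left.basicOpen_le _ hx
    refine ⟨x, hxU, ?_⟩
    -- At a point where g is non-zero, a tangent vector is determined by its values on the D
    -- functions w.
    let ev : TangentSpaceAt x →ₗ[K] Fin D → K := LinearMap.pi fun i =>
      Module.Dual.eval K _ ((maxIdeal x).toCotangent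
        ⟨_, sub_algebraMap_mem (germAlg x U hxU (w i))⟩)
    have hev (t : TangentSpaceAt x) (i : Fin D) : ev t i = pointDer t (germAlg x U hxU (w i)) := rfl
    have hinj : Function.Injective ev := by
      intro t t' htt
      refine tangentHom_injective (germAlg_hom_ext hU hxU fun a => ?_)
      refine DFunLike.congr_fun (hext ((tangentHom t).comp (germAlg x U hxU))
        ((tangentHom t').comp (germAlg x U hxU)) (fun a => ?_) (fun i => ?_) ?_) a
      · simp only [AlgHom.comp_apply, fst_tangentHom]
      · refine TrivSqZeroExt.ext ?_ ?_
        · simp only [AlgHom.comp_apply, fst_tangentHom]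
        · simp only [AlgHom.comp_apply, snd_tangentHom]
          rw [← hev, htt, hev]
      · rw [AlgHom.comp_apply, fst_tangentHom]
        exact (mem_basicOpen_iff x U hxU _).mp hx
    calc Module.finrank K (TangentSpaceAt x) ≤ Module.finrank K (Fin D → K) :=
          LinearMap.finrank_le_finrank_of_injective hinj
      _ = D := by simp

/-- The local dimension is constant on each affine chart, and any two non-empty charts share a
K-point by irreducibility. -/
lemma IsSmoothPoint.topologicalKrullDim_eq [IsAlgClosed K] [CharZero K] [IrreducibleSpace X.left]
    {x : Point X} (hx : IsSmoothPoint x) :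
    topologicalKrullDim X.left = (Module.finrank K (maxIdeal x).Cotangent : ℕ) := by
  rw [← hx.ringKrullDim_eq]
  refine le_antisymm (topologicalKrullDim_le fun x' => ?_) (ringKrullDim_le_topologicalKrullDim x)
  obtain ⟨U, hU, hxU, -⟩ := exists_affineOpen_mem (X := X) isOpen_univ (Set.mem_univ (pt x))
  obtain ⟨U', hU', hxU', -⟩ := exists_affineOpen_mem (X := X) isOpen_univ (Set.mem_univ (pt x'))
  have hirr (V : X.left.Opens) (z : X.left) (hz : z ∈ V) : IsIrreducible (V : Set X.left) :=
    ⟨⟨z, hz⟩, (PreirreducibleSpace.isPreirreducible_univ (X := X.left)).open_subset V.isOpen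
      (Set.subset_univ _)⟩
  obtain ⟨D, hD, -⟩ := exists_ringKrullDim_eq_of_isIrreducible hU (hirr U _ hxU)
  obtain ⟨D', hD', -⟩ := exists_ringKrullDim_eq_of_isIrreducible hU' (hirr U' _ hxU')
  obtain ⟨z, hzU, hzU'⟩ := exists_point_mem (X := X) (U.isOpen.inter U'.isOpen).isLocallyClosed
    (nonempty_preirreducible_inter U.isOpen U'.isOpen ⟨_, hxU⟩ ⟨_, hxU'⟩)
  rw [hD x hxU, ← hD z hzU, hD' z hzU', hD' x' hxU']

end LocalDimension

/-! ### The dimension of an algebraic group. -/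

section GroupDimension

variable {K : Type u} [Field K] {X Y G : Over (Spec (.of K))} [GrpObj G]

lemma pullback_eq_id {x : Point X} (φ : X ⟶ X) (hφ : φ = 𝟙 X) (h : x ≫ φ = x) :
    pullback φ h = AlgHom.id K _ := by
  subst hφ
  exact pullback_id x h

/-- The isomorphism of local rings given by an isomorphism. -/
def pullbackEquiv (φ : X ⟶ Y) (ψ : Y ⟶ X) (h : φ ≫ ψ = 𝟙 X) (h' : ψ ≫ φ = 𝟙 Y) {x : Point X}
    {y : Point Y} (hx : x ≫ φ = y) (hy : y ≫ ψ = x) : LocalRing y ≃ₐ[K] LocalRing x :=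
  .ofAlgHom (pullback φ hx) (pullback ψ hy)
    (by
      rw [← pullback_comp φ ψ hx hy (by rw [h, Category.comp_id])]
      exact pullback_eq_id _ h _)
    (by
      rw [← pullback_comp ψ φ hy hx (by rw [h', Category.comp_id])]
      exact pullback_eq_id _ h' _)

/-- The isomorphism of tangent spaces given by an isomorphism. -/
def differentialEquiv (φ : X ⟶ Y) (ψ : Y ⟶ X) (h : φ ≫ ψ = 𝟙 X) (h' : ψ ≫ φ = 𝟙 Y) {x : Point X}
    {y : Point Y} (hx : x ≫ φ = y) (hy : y ≫ ψ = x) : TangentSpaceAt x ≃ₗ[K] TangentSpaceAt y :=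
  .ofLinearMap (differential φ hx) (differential ψ hy)
    (by
      rw [← differential_comp ψ φ _ rfl hy hx (by rw [h', Category.comp_id])]
      exact differential_id _ _ h' _)
    (by
      rw [← differential_comp φ ψ _ rfl hx hy (by rw [h, Category.comp_id])]
      exact differential_id _ _ h _)

lemma leftMul_comp_leftMul (g h : Point G) : leftMul h ≫ leftMul g = leftMul (g * h) := by
  have e (g : Point G) : leftMul g = (toUnit G ≫ g) * 𝟙 G := rfl
  rw [e g, MonObj.comp_mul, Category.comp_id, ← Category.assoc,
    toUnit_unique (leftMul h ≫ toUnit G) (toUnit G), e, e, ← mul_assoc, MonObj.comp_mul]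

lemma leftMul_one : leftMul (1 : Point G) = 𝟙 G := by
  rw [leftMul, MonObj.comp_one, one_mul]

lemma leftMul_comp_inv (g : Point G) : leftMul g ≫ leftMul g⁻¹ = 𝟙 G := by
  rw [leftMul_comp_leftMul, inv_mul_cancel, leftMul_one]

lemma leftMul_inv_comp (g : Point G) : leftMul g⁻¹ ≫ leftMul g = 𝟙 G := by
  rw [leftMul_comp_leftMul, mul_inv_cancel, leftMul_one]

variable [IsAlgClosed K] [CharZero K] [IsVariety G]

/-- Algebraic groups in characteristic zero are smooth. -/
lemma topologicalKrullDim_group :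
    topologicalKrullDim G.left = (Module.finrank K (TangentSpaceAt (1 : Point G)) : ℕ) := by
  have h1 (g : Point G) : (1 : Point G) ≫ leftMul g = g := (comp_leftMul g 1).trans (mul_one g)
  have h2 (g : Point G) : g ≫ leftMul g⁻¹ = 1 := (comp_leftMul g⁻¹ g).trans (inv_mul_cancel g)
  have hdim (g : Point G) : ringKrullDim (LocalRing g) = ringKrullDim (LocalRing (1 : Point G)) :=
    ringKrullDim_eq_of_ringEquiv (pullbackEquiv (leftMul g) (leftMul g⁻¹)
      (leftMul_comp_inv g) (leftMul_inv_comp g) (h1 g) (h2 g)).toRingEquiv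
  have htop : topologicalKrullDim G.left = ringKrullDim (LocalRing (1 : Point G)) :=
    le_antisymm (topologicalKrullDim_le fun g => (hdim g).le)
      (ringKrullDim_le_topologicalKrullDim _)
  have : Nonempty G.left := ⟨pt (1 : Point G)⟩
  -- Only an irreducible open subset is needed here. Some point of it has a tangent space no larger
  -- than the local dimension, and translation carries this to the identity.
  obtain ⟨N, hNo, hN, -⟩ := exists_irreducible_open (α := G.left) continuous_id
  obtain ⟨z, hz⟩ := hN.nonempty
  obtain ⟨U, hU, hzU, hUN⟩ := exists_affineOpen_mem hNo hz
  obtain ⟨D, hD, g, hgU, hg⟩ := exists_ringKrullDim_eq_of_isIrreducible hU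
    ⟨⟨z, hzU⟩, hN.isPreirreducible.open_subset U.isOpen hUN⟩
  have hfin : Module.finrank K (TangentSpaceAt (1 : Point G)) =
      Module.finrank K (TangentSpaceAt g) :=
    (differentialEquiv (leftMul g) (leftMul g⁻¹) (leftMul_comp_inv g) (leftMul_inv_comp g)
      (h1 g) (h2 g)).finrank_eq
  have hle := ringKrullDim_le_finrank_cotangent g
  rw [hD g hgU] at hle
  have hle' : D ≤ Module.finrank K (TangentSpaceAt g) := by
    rw [Subspace.dual_finrank_eq]
    exact_mod_cast hle
  rw [htop, ← hdim g, hD g hgU, hfin, le_antisymm hle' hg]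

end GroupDimension

/-! ### Simultaneous eigenvectors for finite abelian groups. -/

section EigenBasis

variable {H K M Q : Type*} [Group H] [Finite H] [IsMulCommutative H] [Field K]
  [AddCommGroup M] [Module K M] [AddCommGroup Q] [Module K Q]

omit [Finite H] in
lemma exists_dual_basis_eq [Module.Finite K Q] {n : ℕ} (b : Module.Basis (Fin n) K (Module.Dual K Q)) :
    ∃ c : Module.Basis (Fin n) K Q, ∀ i j, b j (c i) = if i = j then 1 else 0 := by
  refine ⟨b.dualBasis.map (Module.evalEquiv K Q).symm, fun i j => ?_⟩
  have h := Module.apply_evalEquiv_symm_apply (R := K) (M := Q) (b j) (b.dualBasis i)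
  rw [Module.Basis.map_apply, h, Module.Basis.dualBasis_apply_self]
  simp only [eq_comm]

variable [IsAlgClosed K] [CharZero K]

lemma sum_characters_eq_zero [Fintype (H →* Kˣ)] {h : H} (hh : h ≠ 1) :
    ∑ χ : H →* Kˣ, (χ h : K) = 0 := by
  let : CommGroup H := { (inferInstance : Group H) with mul_comm := mul_comm' }
  obtain ⟨ψ, hψ⟩ := CommGroup.exists_apply_ne_one_of_hasEnoughRootsOfUnity H K hh
  have h1 : ∑ χ : H →* Kˣ, (χ h : K) = (ψ h : K) * ∑ χ : H →* Kˣ, (χ h : K) := by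
    rw [Finset.mul_sum]
    exact (Fintype.sum_equiv (Equiv.mulLeft ψ) _ _ fun χ => by simp).symm
  have h2 : ((ψ h : K) - 1) * ∑ χ : H →* Kˣ, (χ h : K) = 0 := by
    rw [sub_mul, one_mul, ← h1, sub_self]
  refine (mul_eq_zero.mp h2).resolve_left fun h3 => hψ (Units.ext ?_)
  exact sub_eq_zero.mp h3

/-- A representation of a finite abelian group is spanned by eigenvectors. -/
lemma span_eigenvectors_eq_top (ρ : Representation K H M) :
    Submodule.span K {m | ∃ χ : CharGroup H K, ∀ h, ρ h m = (χ.toMul h : K) • m} = ⊤ := by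
  let : CommGroup H := { (inferInstance : Group H) with mul_comm := mul_comm' }
  have : Finite (H →* Kˣ) := inferInstance
  have := Fintype.ofFinite H
  have := Fintype.ofFinite (H →* Kˣ)
  classical
  rw [eq_top_iff]
  intro m _
  -- The unnormalized projectors onto the character eigenspaces add up to a multiple of the
  -- identity, by orthogonality of characters.
  have h1 : ∑ χ : H →* Kˣ, ∑ h : H, (χ h⁻¹ : K) • ρ h m = (Fintype.card (H →* Kˣ) : K) • m := by
    rw [Finset.sum_comm, Finset.sum_eq_single 1]
    · simp [Nat.cast_smul_eq_nsmul]
    · intro h _ hh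
      rw [← Finset.sum_smul, sum_characters_eq_zero (by simpa using hh), zero_smul]
    · simp
  have h2 : (Fintype.card (H →* Kˣ) : K) ≠ 0 := Nat.cast_ne_zero.mpr Fintype.card_ne_zero
  rw [← inv_smul_smul₀ h2 m, ← h1]
  refine Submodule.smul_mem _ _ (Submodule.sum_mem _ fun χ _ => Submodule.subset_span
    ⟨Additive.ofMul χ, fun g => ?_⟩)
  rw [map_sum, Finset.smul_sum]
  refine Fintype.sum_equiv (Equiv.mulLeft g) _ _ fun h => ?_
  rw [map_smul, ← Module.End.mul_apply, ← map_mul, smul_smul, Equiv.coe_mulLeft, mul_inv_rev,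
    toMul_ofMul, ← Units.val_mul, ← map_mul]
  congr 3
  rw [mul_comm h⁻¹, mul_inv_cancel_left]

/-- No action on Q is needed, nor finiteness of M: eigenvectors span M, so their images span Q and
contain a basis. This lifts a basis of cotangent functionals to eigenfunctions in the maximal ideal.
-/
lemma exists_eigen_basis [Module.Finite K Q] (ρ : Representation K H M) (q : M →ₗ[K] Q)
    (hq : Function.Surjective q) {n : ℕ} (hn : Module.finrank K Q = n) :
    ∃ (v : Fin n → M) (χ : Fin n → CharGroup H K) (b : Module.Basis (Fin n) K Q),
      (∀ h j, ρ h (v j) = ((χ j).toMul h : K) • v j) ∧ ∀ j, b j = q (v j) := by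
  let E : Set M := {m | ∃ χ : CharGroup H K, ∀ h, ρ h m = (χ.toMul h : K) • m}
  have hE : ⊤ ≤ Submodule.span K (q '' E) := by
    rw [← Submodule.map_span, span_eigenvectors_eq_top, Submodule.map_top, LinearMap.range_eq_top.mpr hq]
  let b₀ := Module.Basis.ofSpan hE
  let b := b₀.reindex ((Module.Basis.indexEquiv b₀ (Module.finBasisOfFinrankEq K Q hn)))
  have hb (j : Fin n) : ∃ v : M, v ∈ E ∧ q v = b j := by
    rw [Module.Basis.reindex_apply]
    exact Module.Basis.ofSpan_subset hE ⟨_, rfl⟩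
  choose v hv hvb using hb
  choose χ hχ using hv
  exact ⟨v, χ, b, fun h j => hχ j h, fun j => (hvb j).symm⟩

end EigenBasis

/-! ### Parameters adapted to an orbit. -/

section Conormal

variable {K : Type u} [Field K] {G : Over (Spec (.of K))} [GrpObj G]
  {X : Over (Spec (.of K))} [ModObj G X] (x : Point X) (H : Subgroup (Point G))
  (hH : H ≤ MulAction.stabilizer (Point G) x)

/-- The action of a group of automorphisms fixing `x` on the local ring at `x`. -/
def localAction (h : H) : LocalRing x →ₐ[K] LocalRing x :=
  pullback (translation X h.1) ((comp_translation x h.1).trans (hH h.2))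

lemma localAction_mem (h : H) {a : LocalRing x} (ha : a ∈ maxIdeal x) :
    localAction x H hH h a ∈ maxIdeal x :=
  maxIdeal_le _ _ ha

lemma localAction_one : localAction x H hH 1 = AlgHom.id K _ :=
  pullback_eq_id _ translation_one _

/-- Pullback reverses composition; commutativity of H turns the resulting right action into a left
one. -/
lemma localAction_mul [IsMulCommutative H] (g h : H) :
    localAction x H hH (g * h) = (localAction x H hH g).comp (localAction x H hH h) := by
  rw [mul_comm']
  have h1 : translation X (h * g).1 = translation X g.1 ≫ translation X h.1 := translation_mul _ _
  refine (pullback_comp (translation X g.1) (translation X h.1)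
    ((comp_translation x g.1).trans (hH g.2)) ((comp_translation x h.1).trans (hH h.2))
    (by rw [← h1]; exact (comp_translation x _).trans (hH (h * g).2))).symm.trans ?_ |>.symm
  congr 1
  exact h1.symm

/-- The action of `H` on the maximal ideal at a fixed point. -/
def maxIdealRep [IsMulCommutative H] : Representation K H (maxIdeal x) where
  toFun h :=
    { toFun := fun m => ⟨localAction x H hH h m, localAction_mem x H hH h m.2⟩
      map_add' := fun _ _ => Subtype.ext (map_add _ _ _)
      map_smul' := fun c m => Subtype.ext (map_smul (localAction x H hH h) c (m : LocalRing x)) }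
  map_one' := LinearMap.ext fun m => Subtype.ext
    (DFunLike.congr_fun (localAction_one x H hH) (m : LocalRing x))
  map_mul' g h := LinearMap.ext fun m => Subtype.ext
    (DFunLike.congr_fun (localAction_mul x H hH g h) (m : LocalRing x))

/-- The elements of the maximal ideal whose differentials vanish along the orbit. -/
def conormal (G : Over (Spec (.of K))) [GrpObj G] {X : Over (Spec (.of K))} [ModObj G X]
    (x : Point X) : Submodule K (maxIdeal x) where
  carrier := {m | ∀ t ∈ orbitTangentSpace G x, t ((maxIdeal x).toCotangent m) = 0}
  add_mem' := fun {m m'} hm hm' t ht => by rw [map_add, map_add, hm t ht, hm' t ht, add_zero]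
  zero_mem' := fun t _ => by rw [map_zero, map_zero]
  smul_mem' := fun c m hm t ht => by
    have h : (maxIdeal x).toCotangent (c • m) = c • (maxIdeal x).toCotangent m :=
      ((maxIdeal x).toCotangent.restrictScalars K).map_smul c m
    rw [h, map_smul, hm t ht, smul_zero]

/-- The action of `H` on the conormal elements. -/
def conormalRep [IsMulCommutative H] : Representation K H (conormal G x) where
  toFun h := (maxIdealRep x H hH h).restrict fun _ hm _ ht =>
    hm _ (tangentRep_mem x ⟨h.1, hH h.2⟩ ht)
  map_one' := LinearMap.ext fun m => Subtype.ext
    (DFunLike.congr_fun (map_one (maxIdealRep x H hH)) (m : maxIdeal x))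
  map_mul' g h := LinearMap.ext fun m => Subtype.ext
    (DFunLike.congr_fun (map_mul (maxIdealRep x H hH) g h) (m : maxIdeal x))

/-- Conormal elements as linear functionals on the normal space. -/
def conormalPairing (G : Over (Spec (.of K))) [GrpObj G] {X : Over (Spec (.of K))} [ModObj G X]
    (x : Point X) : conormal G x →ₗ[K] Module.Dual K (NormalSpace G x) where
  toFun m := (orbitTangentSpace G x).liftQ
    (Module.Dual.eval K _ ((maxIdeal x).toCotangent m.1)) m.2
  map_add' m m' := Submodule.linearMap_qext _ <| LinearMap.ext fun t =>
    congrArg t (((maxIdeal x).toCotangent.restrictScalars K).map_add m.1 m'.1) |>.trans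
      (t.map_add _ _)
  map_smul' c m := Submodule.linearMap_qext _ <| LinearMap.ext fun t =>
    congrArg t (((maxIdeal x).toCotangent.restrictScalars K).map_smul c m.1) |>.trans
      (t.map_smul c _)

/-- The cotangent space is finite dimensional, hence reflexive: a functional on the normal space is
given by a cotangent vector, which lifts to the maximal ideal. -/
lemma conormalPairing_surjective [IsVariety X] :
    Function.Surjective (conormalPairing G x) := by
  intro l
  let c := (Module.evalEquiv K (maxIdeal x).Cotangent).symm (l ∘ₗ (orbitTangentSpace G x).mkQ)
  obtain ⟨m, hm⟩ := (maxIdeal x).toCotangent_surjective c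
  have key (t : TangentSpaceAt x) : t ((maxIdeal x).toCotangent m) = l (Submodule.Quotient.mk t) := by
    rw [hm]
    exact Module.apply_evalEquiv_symm_apply (R := K) (M := (maxIdeal x).Cotangent) t _
  refine ⟨⟨m, fun t ht => ?_⟩, Submodule.linearMap_qext _ <| LinearMap.ext fun t => key t⟩
  rw [key, (Submodule.Quotient.mk_eq_zero _).mpr ht, map_zero]

variable [IsAlgClosed K] [CharZero K] [IsVariety X] [Finite H] [IsMulCommutative H]

/-- The normal representation is a sum of characters, which are the weights of suitable
functions vanishing to first order along the orbit. -/
lemma exists_conormal_eigen_basis {r : ℕ} (hr : Module.finrank K (NormalSpace G x) = r) :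
    ∃ (v : Fin r → maxIdeal x) (χ : Fin r → CharGroup H K),
      (∀ h j, localAction x H hH h (v j) = ((χ j).toMul h : K) • (v j : LocalRing x)) ∧
      IsSumOfCharacters (normalRep x H hH) χ ∧
      ∀ t : TangentSpaceAt x, (∀ j, t ((maxIdeal x).toCotangent (v j)) = 0) →
        t ∈ orbitTangentSpace G x := by
  obtain ⟨v, χ, b, hv, hb⟩ := exists_eigen_basis (conormalRep x H hH) (conormalPairing G x)
    (conormalPairing_surjective x) (Subspace.dual_finrank_eq.trans hr)
  obtain ⟨c, hc⟩ := exists_dual_basis_eq b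
  have hzero (n : NormalSpace G x) (hn : ∀ j, b j n = 0) : n = 0 := by
    rw [← Module.forall_dual_apply_eq_zero_iff K]
    intro l
    rw [← b.sum_repr l, LinearMap.sum_apply]
    exact Finset.sum_eq_zero fun j _ => by rw [LinearMap.smul_apply, hn, smul_zero]
  -- Pullback of functions is the transpose of the action on tangent vectors, so the dual basis has
  -- the same characters, not their inverses.
  have hbv (h : H) (j : Fin r) (n : NormalSpace G x) :
      b j (normalRep x H hH h n) = ((χ j).toMul h : K) * b j n := by
    obtain ⟨t, rfl⟩ := Submodule.Quotient.mk_surjective _ n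
    have h1 : b j (normalRep x H hH h (Submodule.Quotient.mk t)) =
        conormalPairing G x (conormalRep x H hH h (v j)) (Submodule.Quotient.mk t) := by
      rw [hb]
      rfl
    rw [h1, hv, map_smul, hb]
    rfl
  refine ⟨fun j => (v j).1, χ, fun h j => ?_, ⟨c, fun h i => ?_⟩, fun t ht => ?_⟩
  · exact congrArg (fun m : conormal G x => ((m.1 : maxIdeal x) : LocalRing x)) (hv h j)
  · rw [← sub_eq_zero]
    refine hzero _ fun j => ?_
    rw [map_sub, hbv, map_smul, hc, smul_eq_mul]
    split_ifs with hij
    · rw [hij, sub_self]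
    · rw [mul_zero, mul_zero, sub_self]
  · rw [← Submodule.Quotient.mk_eq_zero]
    refine hzero _ fun j => ?_
    rw [hb]
    exact ht j

variable [IsVariety G]

/-- Functions at `x` restricting to coordinates along the orbit. -/
lemma exists_orbit_eigen_basis (hx : Finite (MulAction.stabilizer (Point G) x)) {d : ℕ}
    (hd : Module.finrank K (TangentSpaceAt (1 : Point G)) = d) :
    ∃ (s : Fin d → maxIdeal x) (χ : Fin d → CharGroup H K)
      (ξ : Module.Basis (Fin d) K (TangentSpaceAt (1 : Point G))),
      (∀ h j, localAction x H hH h (s j) = ((χ j).toMul h : K) • (s j : LocalRing x)) ∧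
      ∀ i j, differential (orbitMap G x) (one_comp_orbitMap x) (ξ i)
        ((maxIdeal x).toCotangent (s j)) = if i = j then 1 else 0 := by
  let D := differential (orbitMap G x) (one_comp_orbitMap x)
  -- Differentials of functions at x restricted to the Lie algebra; this is onto because the
  -- differential of the orbit map is injective.
  let q : maxIdeal x →ₗ[K] Module.Dual K (TangentSpaceAt (1 : Point G)) :=
    D.dualMap ∘ₗ (Module.Dual.eval K _) ∘ₗ ((maxIdeal x).toCotangent.restrictScalars K)
  have hq : Function.Surjective q := by
    refine (LinearMap.dualMap_surjective_of_injective
      (differential_orbitMap_injective x hx)).comp ?_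
    exact (Module.evalEquiv K (maxIdeal x).Cotangent).surjective.comp
      (maxIdeal x).toCotangent_surjective
  obtain ⟨s, χ, b, hs, hb⟩ := exists_eigen_basis (maxIdealRep x H hH) q hq
    (Subspace.dual_finrank_eq.trans hd)
  obtain ⟨ξ, hξ⟩ := exists_dual_basis_eq b
  refine ⟨s, χ, ξ, fun h j => congrArg Subtype.val (hs h j), fun i j => ?_⟩
  rw [← hξ i j, hb]
  rfl

omit [Finite H] [IsMulCommutative H] in
lemma finrank_orbitTangentSpace (hx : Finite (MulAction.stabilizer (Point G) x)) :
    Module.finrank K (orbitTangentSpace G x) =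
      Module.finrank K (TangentSpaceAt (1 : Point G)) := by
  let D : TangentSpaceAt (1 : Point G) →ₗ[K] orbitTangentSpace G x :=
    LinearMap.codRestrict _ (differential (orbitMap G x) (one_comp_orbitMap x))
      (differential_orbitMap_mem x)
  refine (LinearEquiv.ofBijective D ⟨fun a b h => ?_, fun t => ?_⟩).finrank_eq.symm
  · exact differential_orbitMap_injective x hx (congrArg Subtype.val h)
  · obtain ⟨ξ, hξ⟩ := exists_differential_orbitMap_eq x t.2
    exact ⟨ξ, Subtype.ext hξ⟩

omit [Finite H] [IsMulCommutative H] in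
lemma finrank_of_topologicalKrullDim_eq [IrreducibleSpace X.left]
    (hx : Finite (MulAction.stabilizer (Point G) x)) (hsm : IsSmoothPoint x) {r : ℕ}
    (hdim : topologicalKrullDim X.left = topologicalKrullDim G.left + r) :
    Module.finrank K (maxIdeal x).Cotangent =
      Module.finrank K (TangentSpaceAt (1 : Point G)) + r ∧
    Module.finrank K (NormalSpace G x) = r := by
  rw [hsm.topologicalKrullDim_eq, topologicalKrullDim_group] at hdim
  have h1 : Module.finrank K (maxIdeal x).Cotangent =
      Module.finrank K (TangentSpaceAt (1 : Point G)) + r := by exact_mod_cast hdim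
  refine ⟨h1, ?_⟩
  have h2 := Submodule.finrank_quotient_add_finrank (orbitTangentSpace G x)
  have h3 : Module.finrank K (TangentSpaceAt x) = Module.finrank K (maxIdeal x).Cotangent :=
    Subspace.dual_finrank_eq
  rw [finrank_orbitTangentSpace x hx] at h2
  exact Nat.add_right_cancel ((h2.trans (h3.trans h1)).trans (add_comm _ _))

omit [Finite H] [IsMulCommutative H] in
/-- Conormal coordinates and coordinates along the orbit form a system of parameters. -/
lemma isRegularSystem_sumElim (hsm : IsSmoothPoint x) {r d : ℕ} (hdim : Module.finrank K (maxIdeal x).Cotangent = d + r)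
    (v : Fin r → maxIdeal x) (s : Fin d → maxIdeal x)
    (hv : ∀ t : TangentSpaceAt x, (∀ j, t ((maxIdeal x).toCotangent (v j)) = 0) →
        t ∈ orbitTangentSpace G x)
    (ξ : Module.Basis (Fin d) K (TangentSpaceAt (1 : Point G)))
    (hξ : ∀ i j, differential (orbitMap G x) (one_comp_orbitMap x) (ξ i)
      ((maxIdeal x).toCotangent (s j)) = if i = j then 1 else 0) :
    IsRegularSystem (Sum.elim (fun j => (v j : LocalRing x)) fun j => (s j : LocalRing x)) := by
  let w : Fin r ⊕ Fin d → maxIdeal x := Sum.elim v s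
  have hw : (Sum.elim (fun j => (v j : LocalRing x)) fun j => (s j : LocalRing x)) =
      fun i => (w i : LocalRing x) := by
    ext (i | i) <;> rfl
  rw [hw]
  -- A tangent vector killed by the conormal functions comes from the Lie algebra, and there the
  -- functions s are coordinates.
  have hspan : Submodule.span K (Set.range fun i => (maxIdeal x).toCotangent (w i)) = ⊤ := by
    rw [← Subspace.dualAnnihilator_inj, Submodule.dualAnnihilator_top, eq_bot_iff]
    intro t ht
    rw [Submodule.mem_dualAnnihilator] at ht
    have ht' (i) : t ((maxIdeal x).toCotangent (w i)) = 0 := ht _ (Submodule.subset_span ⟨i, rfl⟩)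
    obtain ⟨e, he⟩ := exists_differential_orbitMap_eq x (hv t fun j => ht' (Sum.inl j))
    have he0 : e = 0 := by
      refine ξ.ext_elem fun j => ?_
      have h1 := ht' (Sum.inr j)
      rw [← he, ← ξ.sum_repr e] at h1
      simp only [map_sum, map_smul, LinearMap.sum_apply, LinearMap.smul_apply] at h1
      change ∑ i, ξ.repr e i • differential (orbitMap G x) (one_comp_orbitMap x) (ξ i)
        ((maxIdeal x).toCotangent (s j)) = 0 at h1
      simp only [hξ] at h1
      simpa using h1
    rw [← he, he0, map_zero]
    exact Submodule.zero_mem _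
  refine ⟨le_antisymm ?_ ?_, ?_⟩
  · rw [Ideal.span_le]
    rintro _ ⟨i, rfl⟩
    exact (w i).2
  -- Nakayama lifts generation of the cotangent space to generation of the maximal ideal.
  · refine Submodule.le_of_le_smul_of_le_jacobson_bot (I := maxIdeal x)
      (IsNoetherian.noetherian (maxIdeal x)) (IsLocalRing.maximalIdeal_le_jacobson _) fun m hm => ?_
    have h1 : (maxIdeal x).toCotangent ⟨m, hm⟩ ∈
        Submodule.span K (Set.range fun i => (maxIdeal x).toCotangent (w i)) := by
      rw [hspan]; trivial
    obtain ⟨c, hc⟩ := (Submodule.mem_span_range_iff_exists_fun K).mp h1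
    have h2 : (maxIdeal x).toCotangent (∑ i, c i • w i) = (maxIdeal x).toCotangent ⟨m, hm⟩ := by
      rw [← hc]
      exact (map_sum ((maxIdeal x).toCotangent.restrictScalars K) _ _).trans
        (Finset.sum_congr rfl fun i _ =>
          ((maxIdeal x).toCotangent.restrictScalars K).map_smul (c i) (w i))
    rw [Ideal.toCotangent_eq] at h2
    have h3 : ((∑ i, c i • w i : maxIdeal x) : LocalRing x) ∈
        Ideal.span (Set.range fun i => (w i : LocalRing x)) := by
      rw [AddSubmonoidClass.coe_finsetSum]
      refine Ideal.sum_mem _ fun i _ => ?_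
      exact Submodule.smul_of_tower_mem _ (c i) (Ideal.subset_span ⟨i, rfl⟩)
    rw [← sub_sub_cancel ((∑ i, c i • w i : maxIdeal x) : LocalRing x) m]
    refine sub_mem (Submodule.mem_sup_left h3) (Submodule.mem_sup_right ?_)
    rw [smul_eq_mul, ← pow_two]
    exact h2
  · rw [hsm.ringKrullDim_eq, hdim]
    simp [add_comm]

end Conormal

/-! ### Trivial action on a slice. -/

section TrivialAction

open IsLocalRing

variable {K R : Type u} [Field K] [CommRing R] [IsLocalRing R] [IsNoetherianRing R] [Algebra K R]

/-- An endomorphism which fixes some of the parameters and scales the others is the identity modulo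
the ideal generated by the latter. -/
lemma sub_mem_span_of_forall_eq (hres : ∀ a : R, ∃ c : K, a - algebraMap K R c ∈ maximalIdeal R)
    {r d : ℕ} {z : Fin r ⊕ Fin d → R} (hz : IsRegularSystem z) (τ : R →ₐ[K] R)
    (hinl : ∀ j, τ (z (Sum.inl j)) = z (Sum.inl j)) {c : Fin d → K}
    (hinr : ∀ j, τ (z (Sum.inr j)) = c j • z (Sum.inr j)) (a : R) :
    τ a - a ∈ Ideal.span (z '' Set.range Sum.inr) := by
  let I := Ideal.span (z '' Set.range Sum.inr)
  have hI (j : Fin d) : z (Sum.inr j) ∈ I := Ideal.subset_span ⟨_, ⟨j, rfl⟩, rfl⟩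
  have := hz.isLocalRing_quotient (Set.range Sum.inr)
  let π : R →ₐ[K] R ⧸ I := Ideal.Quotient.mkₐ K I
  have hpoly : (π.comp τ).comp (MvPolynomial.aeval z) = π.comp (MvPolynomial.aeval z) := by
    refine MvPolynomial.algHom_ext fun i => ?_
    simp only [AlgHom.comp_apply, MvPolynomial.aeval_X]
    rcases i with j | j
    · rw [hinl]
    · have h0 : π (z (Sum.inr j)) = 0 := Ideal.Quotient.eq_zero_iff_mem.mpr (hI j)
      rw [hinr, map_smul, h0, smul_zero]
  have hτ : (maximalIdeal R).map τ ≤ maximalIdeal R := by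
    rw [← hz.span_range, Ideal.map_span, Ideal.span_le]
    rintro _ ⟨_, ⟨i | i, rfl⟩, rfl⟩
    · rw [hinl]
      exact Ideal.subset_span ⟨_, rfl⟩
    · rw [hinr]
      exact Submodule.smul_of_tower_mem _ _ (Ideal.subset_span ⟨_, rfl⟩)
  -- The claim is exact on polynomials in the parameters, which approximate a to any order; Krull's
  -- intersection theorem in R/I finishes.
  have hmem (N : ℕ) : π (τ a - a) ∈ maximalIdeal (R ⧸ I) ^ N := by
    obtain ⟨p, hp⟩ := exists_mvPolynomial hres hz.span_range N a
    have h1 := DFunLike.congr_fun hpoly p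
    simp only [AlgHom.comp_apply] at h1
    have h2 : π (τ a - a) = π (τ (a - MvPolynomial.aeval z p) - (a - MvPolynomial.aeval z p)) := by
      simp only [map_sub, h1]
      ring
    have h3 : τ (a - MvPolynomial.aeval z p) ∈ maximalIdeal R ^ N := by
      refine Ideal.pow_right_mono hτ N ?_
      rw [← Ideal.map_pow]
      exact Ideal.mem_map_of_mem _ hp
    have hπ : (maximalIdeal R).map π ≤ maximalIdeal (R ⧸ I) := by
      have : IsLocalHom (Ideal.Quotient.mk I) :=
        .of_surjective _ Ideal.Quotient.mk_surjective
      exact ((IsLocalRing.local_hom_TFAE (Ideal.Quotient.mk I)).out 0 2).mp this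
    rw [h2]
    refine Ideal.pow_right_mono hπ N ?_
    rw [← Ideal.map_pow]
    exact Ideal.mem_map_of_mem _ (sub_mem h3 hp)
  have h0 : π (τ a - a) ∈ ⨅ N, maximalIdeal (R ⧸ I) ^ N := (Ideal.mem_iInf).mpr hmem
  rw [Ideal.iInf_pow_eq_bot_of_isLocalRing _ (maximalIdeal.isMaximal _).ne_top] at h0
  exact Ideal.Quotient.eq_zero_iff_mem.mp h0

end TrivialAction

/-! ### Injectivity of pullback under a birational morphism. -/

section Birational

variable {K : Type u} [Field K] {X Y : Over (Spec (.of K))}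
  [IsVariety X] [IsVariety Y] [IrreducibleSpace X.left] [IrreducibleSpace Y.left]

/-- The image of f contains a dense open set, so a function pulling back to zero has empty
non-vanishing locus and is zero since Y is reduced. -/
lemma IsBirational.pullback_injective {f : X ⟶ Y} (hf : IsBirational f) {x : Point X}
    {y : Point Y} (hy : x ≫ f = y) : Function.Injective (pullback f hy) := by
  have := isIntegral_left X
  obtain ⟨e, he⟩ := hf
  rw [injective_iff_map_eq_zero]
  intro a ha
  obtain ⟨U, hyU, s, rfl⟩ := exists_germ a
  rw [pullback_germ] at ha
  have h1 : f.left.app U s = 0 :=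
    germAlg_injective x (f.left ⁻¹ᵁ U) (mem_preimage hy hyU) (ha.trans (map_zero _).symm)
  have h2 : s = 0 := by
    rw [← basicOpen_eq_bot_iff]
    by_contra hne
    have hne' : (Y.left.basicOpen s : Set Y.left).Nonempty := by
      rw [Set.nonempty_iff_ne_empty]
      exact fun h0 => hne (TopologicalSpace.Opens.ext h0)
    obtain ⟨p, hp, hpe⟩ := nonempty_preirreducible_inter (Y.left.basicOpen s).isOpen
      e.target.isOpen hne' e.dense_target.nonempty
    obtain ⟨p', hp'⟩ := e.iso.hom.surjective ⟨p, hpe⟩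
    have h3 : f.left (e.source.ι p') = p := by
      have h4 := congr($(he) p')
      rw [Scheme.Hom.comp_apply, Scheme.Hom.comp_apply, hp'] at h4
      exact h4.symm
    have h5 : e.source.ι p' ∈ f.left ⁻¹ᵁ Y.left.basicOpen s := by
      change f.left (e.source.ι p') ∈ Y.left.basicOpen s
      rw [h3]
      exact hp
    rw [Scheme.preimage_basicOpen, h1, Scheme.basicOpen_zero] at h5
    exact h5
  rw [h2, map_zero]

end Birational

/-! ### Comparison of the characters at x and y. -/

section Invariant

variable {K : Type u} [Field K] [IsAlgClosed K] [CharZero K] {G : Over (Spec (.of K))} [GrpObj G]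
  [IsVariety G] {X Y : Over (Spec (.of K))} [IsVariety X] [IsVariety Y]
  [IrreducibleSpace X.left] [IrreducibleSpace Y.left] [ModObj G X] [ModObj G Y]

omit [IsAlgClosed K] [CharZero K] [IsVariety G] [IsVariety X] [IsVariety Y]
  [IrreducibleSpace X.left] [IrreducibleSpace Y.left] in
lemma pullback_localAction (H : Subgroup (Point G)) (f : X ⟶ Y) [IsModHom G f] {x : Point X}
    {y : Point Y} (hxy : x ≫ f = y) (hHx : H ≤ MulAction.stabilizer (Point G) x)
    (hHy : H ≤ MulAction.stabilizer (Point G) y) (h : H) (a : LocalRing y) :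
    pullback f hxy (localAction y H hHy h a) = localAction x H hHx h (pullback f hxy a) := by
  have e0 : x ≫ f ≫ translation Y h.1 = y := by
    rw [← Category.assoc, hxy]
    exact (comp_translation y h.1).trans (hHy h.2)
  have e1 := pullback_comp f (translation Y h.1) hxy ((comp_translation y h.1).trans (hHy h.2)) e0
  have e2 := pullback_comp (translation X h.1) f ((comp_translation x h.1).trans (hHx h.2))
    hxy (by rw [translation_comp f h.1]; exact e0)
  refine (DFunLike.congr_fun e1 a).symm.trans (Eq.trans ?_ (DFunLike.congr_fun e2 a))
  congr 2
  exact (translation_comp f h.1).symm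

/-- The characters of the normal representations at corresponding points of birational
`G`-varieties have the same wedge up to sign. -/
theorem exists_characters_wedge_eq (H : Subgroup (Point G)) [Finite H] [IsMulCommutative H]
    (hYfree : GenericallyFree G Y) {r : ℕ} (hr : Group.rank H = r)
    (hXdim : topologicalKrullDim X.left = topologicalKrullDim G.left + (r : ℕ))
    (hYdim : topologicalKrullDim Y.left = topologicalKrullDim G.left + (r : ℕ))
    (f : X ⟶ Y) [IsModHom G f] (hf : IsBirational f) {x : Point X} {y : Point Y}
    (hxy : x ≫ f = y) (hx : IsSmoothPoint x) (hy : IsSmoothPoint y)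
    (hHx : H ≤ MulAction.stabilizer (Point G) x) (hHy : H ≤ MulAction.stabilizer (Point G) y)
    (hstabx : Finite (MulAction.stabilizer (Point G) x))
    (hstab : Finite (MulAction.stabilizer (Point G) y)) :
    ∃ β α : Fin r → CharGroup H K, IsSumOfCharacters (normalRep x H hHx) β ∧
      IsSumOfCharacters (normalRep y H hHy) α ∧ wedge α = wedge β := by
  obtain ⟨hCx, hNx⟩ := finrank_of_topologicalKrullDim_eq x hstabx hx hXdim
  obtain ⟨hCy, hNy⟩ := finrank_of_topologicalKrullDim_eq y hstab hy hYdim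
  obtain ⟨u, β, hβ, hβsum, hu⟩ := exists_conormal_eigen_basis x H hHx hNx
  obtain ⟨v, α, hα, hαsum, hv⟩ := exists_conormal_eigen_basis y H hHy hNy
  obtain ⟨d, hd⟩ : ∃ d, Module.finrank K (TangentSpaceAt (1 : Point G)) = d := ⟨_, rfl⟩
  rw [hd] at hCx hCy
  obtain ⟨s, δ, ξ, hδ, hξ⟩ := exists_orbit_eigen_basis y H hHy hstab hd
  -- The orbit coordinates at x are pulled back from y; they remain coordinates because f carries
  -- the orbit map of x to that of y.
  let s' : Fin d → maxIdeal x := fun j => ⟨pullback f hxy (s j), maxIdeal_le f hxy (s j).2⟩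
  have hξ' (i j) : differential (orbitMap G x) (one_comp_orbitMap x) (ξ i)
      ((maxIdeal x).toCotangent (s' j)) = if i = j then 1 else 0 := by
    rw [← hξ i j, differential_comp (orbitMap G x) f (orbitMap G y)
      (by rw [orbitMap_comp, hxy]) (one_comp_orbitMap x) hxy]
    rfl
  have hza := isRegularSystem_sumElim y hy hCy v s hv ξ hξ
  have hzb := isRegularSystem_sumElim x hx hCx u s' hu ξ hξ'
  have hPa := hza.isPrime_span (Set.range Sum.inr)
  have hPb := hzb.isPrime_span (Set.range Sum.inr)
  have hτ := pullback_localAction H f hxy hHx hHy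
  refine ⟨β, α, hβsum, hαsum, ?_⟩
  refine wedge_eq_of_birational (fun a => ⟨_, sub_algebraMap_mem a⟩)
    (fun a => ⟨_, sub_algebraMap_mem a⟩) (pullback f hxy) (hf.pullback_injective hxy) hza hzb
    (fun _ => rfl) (localAction y H hHy) (localAction x H hHx) hτ (δ := δ) hα hβ (fun h j => ?_)
    (fun b => ?_) (fun h hh => ?_) hr
  · change localAction x H hHx h (pullback f hxy (s j)) = _
    rw [← hτ, hδ, map_smul]
    rfl
  · rw [← Set.range_comp] at hPb ⊢
    exact exists_pullback_mul_eq f hf hxy ξ s' hξ' hPb b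
  -- An element killed by all α fixes the conormal parameters and scales the orbit coordinates, so
  -- it acts trivially on the slice and generic freeness of Y forces it to be 1.
  · refine Subtype.ext (eq_one_of_forall_sub_mem hYfree y ξ s hξ ?_ h.1 (hHy h.2) fun a => ?_)
    · rw [← Set.range_comp] at hPa
      exact hPa
    · have h1 := sub_mem_span_of_forall_eq (fun a => ⟨_, sub_algebraMap_mem a⟩) hza
        (localAction y H hHy h) (fun j => (hα h j).trans (by rw [hh]; exact one_smul K _))
        (hδ h) a
      rw [← Set.range_comp] at h1
      exact h1

end Invariant

end GVariety

end

theorem theorem5p1 {K : Type u} [Field K] [IsAlgClosed K] [CharZero K]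
    -- an algebraic group and a finite abelian subgroup
    (G : Over (Spec (.of K))) [GrpObj G] [GVariety.IsVariety G]
    (H : Subgroup (GVariety.Point G)) [Finite H] [IsMulCommutative H]
    -- two irreducible generically free `G`-varieties of dimension `dim G + rank H`
    (X Y : Over (Spec (.of K))) [GVariety.IsVariety X] [GVariety.IsVariety Y]
    [IrreducibleSpace X.left] [IrreducibleSpace Y.left]
    [ModObj G X] [ModObj G Y]
    (hXfree : GVariety.GenericallyFree G X) (hYfree : GVariety.GenericallyFree G Y)
    (hXdim : topologicalKrullDim X.left = topologicalKrullDim G.left + (Group.rank H : ℕ))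
    (hYdim : topologicalKrullDim Y.left = topologicalKrullDim G.left + (Group.rank H : ℕ))
    -- a `G`-equivariant birational morphism
    (f : X ⟶ Y) [IsModHom G f] (hf : GVariety.IsBirational f)
    (x : GVariety.Point X) (hx : GVariety.IsSmoothPoint x)
    (hHx : H ≤ MulAction.stabilizer (GVariety.Point G) x)
    (hy : GVariety.IsSmoothPoint (x ≫ f))
    (hstab : Finite (MulAction.stabilizer (GVariety.Point G) (x ≫ f))) :
    -- the invariants are defined: both normal representations are sums of `rank H` characters
    (∃ χ : Fin (Group.rank H) → GVariety.CharGroup H K,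
      GVariety.IsSumOfCharacters (GVariety.normalRep x H hHx) χ) ∧
    (∃ χ : Fin (Group.rank H) → GVariety.CharGroup H K,
      GVariety.IsSumOfCharacters
        (GVariety.normalRep (x ≫ f) H (hHx.trans (GVariety.stabilizer_le f x))) χ) ∧
    GVariety.invariant x H hHx =
      GVariety.invariant (x ≫ f) H (hHx.trans (GVariety.stabilizer_le f x)) := by
  have hstabx : Finite (MulAction.stabilizer (GVariety.Point G) x) :=
    Finite.of_injective _ (Subgroup.inclusion_injective (GVariety.stabilizer_le f x))
  obtain ⟨β, α, hβ, hα, h⟩ := GVariety.exists_characters_wedge_eq H hYfree rfl hXdim hYdim f hf rfl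
    hx hy hHx (hHx.trans (GVariety.stabilizer_le f x)) hstabx hstab
  refine ⟨⟨β, hβ⟩, ⟨α, hα⟩, ?_⟩
  rw [GVariety.invariant, GVariety.invariant, GVariety.characterWedge_eq hβ,
    GVariety.characterWedge_eq hα, h]
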